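/- Fix $d\ge 1$, $\alpha_G\in(1,\infty]$, $\beta_G>2$. Let $W$ be a real random variable for which there are constants $c_G,C_G>0$, $t_G\ge 0$ with $c_G z^{1-\beta_G}\le \mathbb P(W>z)\le C_G z^{1-\beta_G}$ for all $z>t_G$. For every $n$ let $(X^{(n)}_i)_{i\in[n]}$ be i.i.d. uniform on $[-\frac12,\frac12]^d$ and let $(W^{(n)}_i)_{i\in[n]}$ be nonnegative (possibly random) weights independent of the locations, such that, as $n\to\infty$, $$\frac1n\sum_{i=1}^n \mathbf 1\{W^{(n)}_i\le x\}\to \mathbb P(W\le x)\ \text{ in probability, for every continuity point } x \text{ of the distribution function of } W,\qquad \frac1n\sum_{i=1}^n W^{(n)}_i\to\mathbb E[W]\ \text{ in probability}.$$ Let $\mathrm{GIRG}_{n}$ be the random graph on $[n]$ in which, conditionally on locations and weights, the edges $\{i,j\}$, $i\ne j$, are present independently with probabilities $$p_{i,j}=1\wedge\Big(\frac{W^{(n)}_iW^{(n)}_j}{\sum_{k\in[n]}W^{(n)}_k}\Big)^{\alpha_G}\|X^{(n)}_i-X^{(n)}_j\|^{-d\alpha_G}\quad(\alpha_G<\infty),\qquad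 p_{i,j}=\mathbf 1\Big\{\Big(\frac{W^{(n)}_iW^{(n)}_j}{\sum_{k\in[n]}W^{(n)}_k}\Big)^{1/d}>\|X^{(n)}_i-X^{(n)}_j\|\Big\}\quad(\alpha_G=\infty),$$ where $\|\cdot\|$ is the Euclidean norm. Let the infinite GIRG be the random graph on $\{0,1,2,\dots\}$ where $Y_0=0$, $Y_1,Y_2,\dots$ are the atoms of a unit-rate homogeneous Poisson point process on $\mathbb R^d$, $(W_i)_{i\ge0}$ are i.i.d. copies of $W$ independent of $(Y_i)_{i\ge 0}$, and, conditionally on these, the edges $\{i,j\}$, $i\neq j$, are present independently with probabilities $\kappa(\|Y_i-Y_j\|,W_i,W_j)$, where $$\kappa(t,x,y)=1\wedge\Big(\frac{xy}{\mathbb E[W]}\Big)^{\alpha_G}t^{-d\alpha_G}\quad(\alpha_G<\infty),\qquad \kappa(t,x,y)=\mathbf 1\Big\{\Big(\frac{xy}{\mathbb E[W]}\Big)^{1/d}>t\Big\}\quad(\alpha_G=\infty).$$ Then $(\mathrm{GIRG}_n)_{n\ge1}$ converges locally in probability to the infinite GIRG rooted at $0$. That is: the infinite GIRG is almost surely locally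 finite, and for every $r>0$ and every locally finite rooted graph $(H,h)$, the proportion of vertices $i\in[n]$ whose $r$-neighbourhood in $\mathrm{GIRG}_n$ (the subgraph induced by the vertices within graph distance $r$ of $i$, rooted at $i$) is rooted isomorphic to $(H,h)$ converges in probability, as $n\to\infty$, to the probability that the $r$-neighbourhood of $0$ in the infinite GIRG is rooted isomorphic to $(H,h)$. -/

import Mathlib

open MeasureTheory ProbabilityTheory Filter Topology
open scoped ENNReal NNReal

namespace SpatialGraph

noncomputable section

/-! ### Rooted graphs and local convergence in probability -/

/-- Two rooted graphs are rooted isomorphic: there is a graph isomorphism which maps root to root. -/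
def RootedIso {V₁ V₂ : Type*} (G₁ : SimpleGraph V₁) (o₁ : V₁) (G₂ : SimpleGraph V₂) (o₂ : V₂) :
    Prop :=
  ∃ φ : G₁ ≃g G₂, φ o₁ = o₂

/-- Every vertex has finite degree. -/
def IsLocallyFinite {V : Type*} (G : SimpleGraph V) : Prop :=
  ∀ v, (G.neighborSet v).Finite

/-- The vertices within graph distance `r` of `o` (the distance is `⊤` between components). -/
def ballSet {V : Type*} (G : SimpleGraph V) (o : V) (r : ℕ) : Set V :=
  {v | G.edist o v ≤ r}

lemma mem_ballSet_self {V : Type*} (G : SimpleGraph V) (o : V) (r : ℕ) : o ∈ ballSet G o r := by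
  simp [ballSet]

/-- The `r`-neighbourhood of `o` in `G` (the subgraph induced by the ball of radius `r`, rooted at
`o`) is rooted isomorphic to `(H, h)`. -/
def BallIso {V U : Type*} (G : SimpleGraph V) (o : V) (r : ℕ) (H : SimpleGraph U) (h : U) : Prop :=
  RootedIso (G.induce (ballSet G o r)) ⟨o, mem_ballSet_self G o r⟩ H h

/-- `Z n` converges in probability to the constant `c`; the `Z n` may live on different probability
spaces `(Ω n, P n)`. -/
def TendstoInProb {Ω : ℕ → Type*} [∀ n, MeasurableSpace (Ω n)] (P : ∀ n, Measure (Ω n))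
    (Z : ∀ n, Ω n → ℝ) (c : ℝ) : Prop :=
  ∀ ε : ℝ, 0 < ε → Tendsto (fun n => P n {ω | ε ≤ |Z n ω - c|}) atTop (𝓝 0)

/-- The finite random graphs `G n` converge locally in probability to the random rooted graph
`(G', o)` with law determined by `Q`: the limit is almost surely locally finite, and for every
radius `r` and every locally finite rooted graph `(H, h)`, the proportion of vertices of `G n` whose
`r`-neighbourhood is isomorphic to `(H, h)` converges in probability to the probability that the
`r`-neighbourhood of `o` in `G'` is. Neighbourhoods of real radius are those of its integer part. -/
def ConvergesLocallyInProb {Ω : ℕ → Type*} [∀ n, MeasurableSpace (Ω n)] (P : ∀ n, Measure (Ω n))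
    {V : ℕ → Type*} [∀ n, Fintype (V n)] (G : ∀ n, Ω n → SimpleGraph (V n))
    {Ω' : Type*} [MeasurableSpace Ω'] (Q : Measure Ω')
    {V' : Type*} (G' : Ω' → SimpleGraph V') (o : V') : Prop :=
  (∀ᵐ ω ∂Q, IsLocallyFinite (G' ω)) ∧
  ∀ (r : ℕ) (U : Type) (H : SimpleGraph U) (h : U), IsLocallyFinite H →
    TendstoInProb P
      (fun n ω => ({i : V n | BallIso (G n ω) i r H h}.ncard : ℝ) / (Fintype.card (V n) : ℝ))
      (Q.real {ω | BallIso (G' ω) o r H h})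

/-! ### Spatial inhomogeneous random graphs -/

/-- `G` is a spatial inhomogeneous random graph with locations `X`, weights `W` and connection
function `κ`: conditionally on `(X, W)`, the edges are present independently of each other, the edge
`{i, j}` with probability `κ ‖X i - X j‖ (W i) (W j)`. Conditional independence is expressed by the
product formula for the simultaneous presence of any finite set `S` of potential edges, each being
listed as a pair `(i, j)` with `i < j`. The connection function may depend on the sample point `ω`
(it is then to be a function of the locations and weights). -/
structure IsSIRG {Ω : Type*} [MeasurableSpace Ω] (P : Measure Ω) {d : ℕ} {ι : Type*} [LinearOrder ι]
    (X : Ω → ι → EuclideanSpace ℝ (Fin d)) (W : Ω → ι → ℝ) (κ : Ω → ℝ → ℝ → ℝ → ℝ)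
    (G : Ω → SimpleGraph ι) : Prop where
  measurable_location : Measurable X
  measurable_weight : Measurable W
  measurableSet_adj : ∀ i j, MeasurableSet {ω | (G ω).Adj i j}
  condProb_edges : ∀ S : Finset (ι × ι), (∀ e ∈ S, e.1 < e.2) →
    P⟦{ω | ∀ e ∈ S, (G ω).Adj e.1 e.2} |
        MeasurableSpace.comap X inferInstance ⊔ MeasurableSpace.comap W inferInstance⟧
      =ᵐ[P] fun ω => ∏ e ∈ S, κ ω ‖X ω e.1 - X ω e.2‖ (W ω e.1) (W ω e.2)

/-! ### Geometric inhomogeneous random graphs -/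

/-- The GIRG connection function with normalisation `L`: `1 ∧ (x y / L) ^ α * t ^ (-d α)` for
`α < ∞`, and the indicator of `(x y / L) ^ (1 / d) > t` for `α = ∞`. It matters for `t > 0` and
`x, y ≥ 0` only: distinct vertices almost surely have distinct locations. -/
def girgKernel (α : ℝ≥0∞) (d : ℕ) (L t x y : ℝ) : ℝ :=
  open scoped Classical in
  if α = ∞ then (if t < (x * y / L) ^ (1 / (d : ℝ)) then 1 else 0)
  else min 1 ((x * y / L) ^ α.toReal * t ^ (-((d : ℝ) * α.toReal)))

/-- The box `[-1/2, 1/2] ^ d`. -/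
def unitBox (d : ℕ) : Set (EuclideanSpace ℝ (Fin d)) :=
  {x | ∀ k, x k ∈ Set.Icc (-(1 / 2) : ℝ) (1 / 2)}

/-- `G` is a GIRG on the `n` vertices `Fin n` with nonnegative weights `W` and locations `X`
which are i.i.d. uniform on the box, independently of the weights. -/
structure IsGIRG {Ω : Type*} [MeasurableSpace Ω] (P : Measure Ω) (α : ℝ≥0∞) (d n : ℕ)
    (X : Ω → Fin n → EuclideanSpace ℝ (Fin d)) (W : Ω → Fin n → ℝ)
    (G : Ω → SimpleGraph (Fin n)) : Prop where
  uniform_location : ∀ i, pdf.IsUniform (fun ω => X ω i) (unitBox d) P volume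
  indep_locations : iIndepFun (fun i ω => X ω i) P
  indep_location_weight : IndepFun X W P
  weight_nonneg : ∀ᵐ ω ∂P, ∀ i, 0 ≤ W ω i
  isSIRG : IsSIRG P X W (fun ω => girgKernel α d (∑ k, W ω k)) G

/-- The random measure `Γ` is a homogeneous Poisson point process of unit rate. -/
structure IsUnitPoissonProcess {Ω : Type*} [MeasurableSpace Ω] (P : Measure Ω) {d : ℕ}
    (Γ : Ω → Measure (EuclideanSpace ℝ (Fin d))) : Prop where
  count_law : ∀ A : Set (EuclideanSpace ℝ (Fin d)), MeasurableSet A → volume A ≠ ∞ →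
    ∀ k : ℕ, P {ω | Γ ω A = k} = poissonMeasure (volume A).toNNReal {k}
  count_indep : ∀ (m : ℕ) (A : Fin m → Set (EuclideanSpace ℝ (Fin d))),
    (∀ j, MeasurableSet (A j)) → Pairwise (fun j k => Disjoint (A j) (A k)) →
      iIndepFun (fun j ω => Γ ω (A j)) P

/-- `G` is an infinite GIRG on the vertex set `ℕ` with limiting weight law `μ`: vertex `0` is
at the origin, the locations of the vertices `1, 2, …` are the atoms of a unit-rate homogeneous
Poisson point process, the weights are i.i.d. with law `μ` and independent of the locations, and the
kernel is normalised by the mean of `μ`. -/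
structure IsInfiniteGIRG {Ω : Type*} [MeasurableSpace Ω] (P : Measure Ω) (α : ℝ≥0∞) (d : ℕ)
    (μ : Measure ℝ) (Y : Ω → ℕ → EuclideanSpace ℝ (Fin d)) (W : Ω → ℕ → ℝ)
    (G : Ω → SimpleGraph ℕ) : Prop where
  location_zero : ∀ ω, Y ω 0 = 0
  poisson_location : IsUnitPoissonProcess P
    (fun ω => Measure.sum (fun i : ℕ => Measure.dirac (Y ω (i + 1))))
  weight_law : ∀ i, P.map (fun ω => W ω i) = μ
  indep_weights : iIndepFun (fun i ω => W ω i) P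
  indep_location_weight : IndepFun Y W P
  isSIRG : IsSIRG P Y W (fun _ => girgKernel α d (∫ x, x ∂μ)) G

/-- The upper tail of `μ` is of power-law type with exponent `β`:
`c z ^ (1 - β) ≤ μ (z, ∞) ≤ C z ^ (1 - β)` for all `z > t₀`. -/
def HasPowerLawTail (μ : Measure ℝ) (β : ℝ) : Prop :=
  ∃ c C t₀ : ℝ, 0 < c ∧ 0 < C ∧ 0 ≤ t₀ ∧ ∀ z, t₀ < z →
    c * z ^ (1 - β) ≤ μ.real (Set.Ioi z) ∧ μ.real (Set.Ioi z) ≤ C * z ^ (1 - β)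

end

end SpatialGraph

namespace SpatialGraph

noncomputable section

/-! ### Balls in graphs -/

/-! After scaling by n^(1/d) the locations seen from a vertex look like a unit-rate Poisson process.
The kernel normalised by the total weight becomes, at scaled distances, the kernel normalised by the
mean weight (`girgKernel_scale`). The two models are compared through factorial moments, without a
coupling.

Keep only the vertices within scaled distance K of the root, and let C be the finite set of those
other than the root. A neighbourhood event in the graph on the root and C is a set function of C,
hence a sum over R ⊆ C of its Möbius transform, and the term of R depends only on the graph induced
on the root and R. A second Möbius inversion, over sets of edges, makes each term a linear
combination of counts of tuples joined by prescribed edges. Dropping all R with at least M elements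
costs at most (1/2)^M * 5^|C| (`abs_ballInd_sub_sum_homCount_le`), and 5^|C| has bounded mean in
both models.

It remains to find the limits of the counts. In the finite graphs the mean count per vertex is close
to an integral of `clusterIntegral` against a power of the empirical weight measure. That integrand
is bounded and continuous, so weak convergence of the weights gives the limit `clusterDensity`.
Given the weights, disjoint tuples factorise and intersecting pairs contribute O(1/n)
(`IsGIRG.lintegral_clusterCount_sq_le`), so Chebyshev's inequality gives concentration
(`tendstoInProb_clusterCount`). In the infinite graph the factorial moment measures of the Poisson
process are Lebesgue measures (`factorialMeasure_eq_volume`), so the expected count at the root is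
the same `clusterDensity` (`IsInfiniteGIRG.lintegral_homCount`).

Finally K is removed. In the infinite graph this is local finiteness
(`IsInfiniteGIRG.ae_isLocallyFinite`), which follows from the finite expected degree: the kernel is
integrable because α > 1. In the finite graphs few vertices may have a long edge within r steps. The
total edge mass is a constant times the mean weight, and the mass of edges of bounded length
converges too, so the mass of long edges has a limit, which is small for large cutoffs
(`tendsto_lintegral_clusterAverage_compl`). An exchange of sums over the two ends of an edge carries
this from one step to the next (`farAverage_succ_le`). -/

lemma mem_ballSet_iff_exists_walk {V : Type*} {G : SimpleGraph V} {o v : V} {r : ℕ} :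
    v ∈ ballSet G o r ↔ ∃ p : G.Walk o v, p.length ≤ r := by
  constructor
  · intro h
    have h' : G.edist o v ≤ r := h
    have hne : G.edist o v ≠ ⊤ := fun H => by simp [H] at h'
    obtain ⟨p, hp⟩ := SimpleGraph.exists_walk_of_edist_ne_top hne
    exact ⟨p, by rw [← hp] at h'; exact_mod_cast h'⟩
  · rintro ⟨p, hp⟩
    exact (SimpleGraph.edist_le p).trans (by exact_mod_cast hp)

lemma mem_ballSet_succ {V : Type*} {G : SimpleGraph V} {o v : V} {r : ℕ} :
    v ∈ ballSet G o (r + 1) ↔ v = o ∨ ∃ j, G.Adj o j ∧ v ∈ ballSet G j r := by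
  simp only [mem_ballSet_iff_exists_walk]
  constructor
  · rintro ⟨p, hp⟩
    cases p with
    | nil => exact Or.inl rfl
    | cons hadj q => exact Or.inr ⟨_, hadj, q, by simpa using hp⟩
  · rintro (rfl | ⟨j, hadj, q, hq⟩)
    · exact ⟨SimpleGraph.Walk.nil, by simp⟩
    · exact ⟨SimpleGraph.Walk.cons hadj q, by simpa using hq⟩

lemma mem_ballSet_zero {V : Type*} {G : SimpleGraph V} {o v : V} :
    v ∈ ballSet G o 0 ↔ v = o := by
  rw [ballSet, Set.mem_ofPred_eq, Nat.cast_zero, nonpos_iff_eq_zero, SimpleGraph.edist_eq_zero_iff,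
    eq_comm]

lemma finite_ballSet {V : Type*} {G : SimpleGraph V} (hG : IsLocallyFinite G) (r : ℕ) :
    ∀ o, (ballSet G o r).Finite := by
  induction r with
  | zero => exact fun o => (Set.finite_singleton o).subset fun v hv => mem_ballSet_zero.1 hv
  | succ r ih =>
    intro o
    refine ((Set.finite_singleton o).union ((hG o).biUnion fun j _ => ih j)).subset fun v hv => ?_
    rcases mem_ballSet_succ.1 hv with h | ⟨j, hj, h⟩
    · exact Or.inl h
    · exact Or.inr (Set.mem_biUnion (show j ∈ G.neighborSet o from hj) h)

lemma mem_ballSet_map {V V' : Type*} {G : SimpleGraph V} {G' : SimpleGraph V'} (φ : G →g G')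
    {o v : V} {r : ℕ} (h : v ∈ ballSet G o r) : φ v ∈ ballSet G' (φ o) r := by
  obtain ⟨p, hp⟩ := mem_ballSet_iff_exists_walk.1 h
  exact mem_ballSet_iff_exists_walk.2 ⟨p.map φ, by simpa using hp⟩

lemma RootedIso.trans {V₁ V₂ V₃ : Type*} {G₁ : SimpleGraph V₁} {G₂ : SimpleGraph V₂}
    {G₃ : SimpleGraph V₃} {o₁ : V₁} {o₂ : V₂} {o₃ : V₃} (h : RootedIso G₁ o₁ G₂ o₂)
    (h' : RootedIso G₂ o₂ G₃ o₃) : RootedIso G₁ o₁ G₃ o₃ := by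
  obtain ⟨φ, rfl⟩ := h
  obtain ⟨ψ, rfl⟩ := h'
  exact ⟨φ.trans ψ, rfl⟩

lemma RootedIso.symm {V₁ V₂ : Type*} {G₁ : SimpleGraph V₁} {G₂ : SimpleGraph V₂}
    {o₁ : V₁} {o₂ : V₂} (h : RootedIso G₁ o₁ G₂ o₂) : RootedIso G₂ o₂ G₁ o₁ := by
  obtain ⟨φ, rfl⟩ := h
  exact ⟨φ.symm, by simp⟩

/-- An injective map which preserves and reflects adjacency, and maps the set `s` onto the set `t`,
induces an isomorphism of the induced subgraphs. -/
lemma rootedIso_induce_of_image_eq {V V' : Type*} {G : SimpleGraph V} {G' : SimpleGraph V'}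
    (φ : G ↪g G') {s : Set V} {t : Set V'} (hst : φ '' s = t) {o : V} (ho : o ∈ s)
    (ho' : φ o ∈ t) : RootedIso (G.induce s) ⟨o, ho⟩ (G'.induce t) ⟨φ o, ho'⟩ := by
  subst hst
  exact ⟨⟨Equiv.Set.image φ s φ.injective, by simp⟩, rfl⟩

/-- A walk is lifted edge by edge: its next vertex is in the ball, hence in the range, and `φ`
reflects adjacency. The range hypothesis passes to the smaller ball around that vertex. -/
lemma mem_ballSet_of_map_mem {V V' : Type*} {G : SimpleGraph V} {G' : SimpleGraph V'}
    (φ : G ↪g G') {w : V} {r : ℕ} : ∀ {o : V}, ballSet G' (φ o) r ⊆ Set.range φ →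
      φ w ∈ ballSet G' (φ o) r → w ∈ ballSet G o r := by
  induction r with
  | zero => exact fun _ hv => mem_ballSet_zero.2 (φ.injective (mem_ballSet_zero.1 hv))
  | succ r ih =>
    intro o h hv
    rcases mem_ballSet_succ.1 hv with h1 | ⟨j, hj, hjv⟩
    · exact mem_ballSet_succ.2 (Or.inl (φ.injective h1))
    · obtain ⟨k, rfl⟩ := h (mem_ballSet_succ.2 (Or.inr ⟨j, hj, mem_ballSet_self _ _ _⟩))
      refine mem_ballSet_succ.2 (Or.inr ⟨k, φ.map_adj_iff.1 hj, ih ?_ hjv⟩)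
      exact fun x hx => h (mem_ballSet_succ.2 (Or.inr ⟨_, hj, hx⟩))

/-- Embeddings do not increase distances, and there is no shortcut outside the range because the
whole target ball lies in it; so `φ` maps ball onto ball. -/
lemma ballIso_congr_of_image_ballSet {V V' U : Type*} {G : SimpleGraph V} {G' : SimpleGraph V'}
    (φ : G ↪g G') {o : V} {r : ℕ} (h : ballSet G' (φ o) r ⊆ Set.range φ)
    {H : SimpleGraph U} {u : U} : BallIso G o r H u ↔ BallIso G' (φ o) r H u := by
  have himage : φ '' ballSet G o r = ballSet G' (φ o) r := by
    refine Set.Subset.antisymm (fun v ⟨w, hw, hwv⟩ => hwv ▸ mem_ballSet_map φ.toHom hw) ?_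
    intro v hv
    obtain ⟨w, rfl⟩ := h hv
    exact ⟨w, mem_ballSet_of_map_mem φ h hv, rfl⟩
  have hiso := rootedIso_induce_of_image_eq φ himage (mem_ballSet_self G o r)
    (mem_ballSet_self G' (φ o) r)
  exact ⟨fun h' => hiso.symm.trans h', fun h' => hiso.trans h'⟩

lemma ballIso_induce_iff_of_ballSet_subset {V U : Type*} {G : SimpleGraph V} {o : V} {r : ℕ}
    {T : Set V} (ho : o ∈ T) (hT : ballSet G o r ⊆ T) {H : SimpleGraph U} {u : U} :
    BallIso (G.induce T) ⟨o, ho⟩ r H u ↔ BallIso G o r H u :=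
  ballIso_congr_of_image_ballSet (SimpleGraph.Embedding.induce T) (o := ⟨o, ho⟩) (by
    intro v hv
    exact ⟨⟨v, hT hv⟩, rfl⟩)

lemma ballIso_induce_comap_iff {V V' U : Type*} {G : SimpleGraph V'} {f : V → V'}
    (hf : Function.Injective f) {s : Set V} {t : Set V'} (hst : f '' s = t) {o : V} {o' : V'}
    (hoo : f o = o') (ho : o ∈ s) (ho' : o' ∈ t) {r : ℕ} {H : SimpleGraph U} {u : U} :
    BallIso ((G.comap f).induce s) ⟨o, ho⟩ r H u ↔ BallIso (G.induce t) ⟨o', ho'⟩ r H u := by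
  subst hst hoo
  let ψ : (G.comap f).induce s ≃g G.induce (f '' s) := ⟨Equiv.Set.image f s hf, by simp⟩
  exact ballIso_congr_of_image_ballSet ψ.toEmbedding (o := ⟨o, ho⟩) (fun v _ => ψ.surjective v)

/-! ### Expansion of local functionals into counts -/

/-- The Möbius transform of a set function. -/
def moebius {α : Type*} (F : Finset α → ℝ) (R : Finset α) : ℝ :=
  ∑ R' ∈ R.powerset, (-1) ^ (R.card - R'.card) * F R'

/-- Möbius inversion on the Boolean lattice: after exchanging the sums, the alternating sum over the
interval from R' to T vanishes unless R' = T. -/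
lemma sum_moebius {α : Type*} [DecidableEq α] (F : Finset α → ℝ) (T : Finset α) :
    ∑ R ∈ T.powerset, moebius F R = F T := by
  unfold moebius
  have h1 : ∑ R ∈ T.powerset, ∑ R' ∈ R.powerset, (-1 : ℝ) ^ (R.card - R'.card) * F R' =
      ∑ R' ∈ T.powerset, ∑ R ∈ Finset.Icc R' T, (-1 : ℝ) ^ (R.card - R'.card) * F R' := by
    refine Finset.sum_comm' fun R R' => ?_
    simp only [Finset.mem_powerset, Finset.mem_Icc]
    exact ⟨fun h => ⟨⟨h.2, h.1⟩, h.2.trans h.1⟩, fun h => ⟨h.1.2, h.1.1⟩⟩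
  rw [h1]
  have h2 : ∀ R' ∈ T.powerset, ∑ R ∈ Finset.Icc R' T, (-1 : ℝ) ^ (R.card - R'.card) * F R' =
      if R' = T then F T else 0 := by
    intro R' hR'
    have hsub := Finset.mem_powerset.1 hR'
    -- The interval is parametrised by R' ∪ Q with Q ⊆ T \ R', which turns the sign into (-1)^|Q|.
    rw [Finset.Icc_eq_image_powerset hsub, Finset.sum_image]
    · have h3 : ∀ Q ∈ (T \ R').powerset,
          (-1 : ℝ) ^ ((R' ∪ Q).card - R'.card) * F R' = (((-1 : ℤ) ^ Q.card : ℤ) : ℝ) * F R' := by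
        intro Q hQ
        have hd : Disjoint R' Q :=
          Finset.disjoint_of_subset_right (Finset.mem_powerset.1 hQ) Finset.disjoint_sdiff
        rw [Finset.card_union_of_disjoint hd]
        simp
      rw [Finset.sum_congr rfl h3, ← Finset.sum_mul, ← Int.cast_sum,
        Finset.sum_powerset_neg_one_pow_card]
      by_cases hT : R' = T
      · simp [hT]
      · have : T \ R' ≠ ∅ := fun h => hT (hsub.antisymm (Finset.sdiff_eq_empty_iff_subset.1 h))
        simp [hT, this]
    · intro Q hQ Q' hQ' hQQ
      have hd : ∀ Q ∈ (T \ R').powerset, Disjoint R' Q := fun Q hQ =>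
        Finset.disjoint_of_subset_right (Finset.mem_powerset.1 hQ) Finset.disjoint_sdiff
      have e : ∀ Q ∈ (T \ R').powerset, (R' ∪ Q) \ R' = Q := fun Q hQ => by
        rw [Finset.union_sdiff_left, Finset.sdiff_eq_self_of_disjoint (hd Q hQ).symm]
      simp only at hQQ
      rw [← e Q hQ, ← e Q' hQ', hQQ]
  rw [Finset.sum_congr rfl h2]
  simp

lemma abs_moebius_le {α : Type*} {F : Finset α → ℝ} (hF : ∀ R, |F R| ≤ 1) (R : Finset α) :
    |moebius F R| ≤ 2 ^ R.card := by
  refine (Finset.abs_sum_le_sum_abs _ _).trans ?_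
  calc ∑ R' ∈ R.powerset, |(-1) ^ (R.card - R'.card) * F R'| ≤ ∑ R' ∈ R.powerset, (1 : ℝ) :=
        Finset.sum_le_sum fun R' _ => by simpa [abs_mul] using hF R'
    _ = 2 ^ R.card := by simp

/-- For |R| ≥ M the transform is at most 2^|R| ≤ (1/2)^M * 4^|R|, and the sum of 4^|R| over all R ⊆
T is 5^|T|. This is where the base 5 of all exponential moments below comes from. -/
lemma abs_sub_sum_moebius_le {α : Type*} [DecidableEq α] {F : Finset α → ℝ} (hF : ∀ R, |F R| ≤ 1)
    (T : Finset α) (M : ℕ) :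
    |F T - ∑ m ∈ Finset.range M, ∑ R ∈ T.powersetCard m, moebius F R| ≤
      (1 / 2) ^ M * 5 ^ T.card := by
  have h1 : ∑ m ∈ Finset.range M, ∑ R ∈ T.powersetCard m, moebius F R =
      ∑ R ∈ T.powerset with R.card < M, moebius F R := by
    rw [← Finset.sum_fiberwise_of_maps_to (g := Finset.card) (t := Finset.range M)]
    · refine Finset.sum_congr rfl fun m hm => Finset.sum_congr ?_ fun _ _ => rfl
      ext R
      simp only [Finset.mem_powersetCard, Finset.mem_filter, Finset.mem_powerset]
      have := Finset.mem_range.1 hm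
      constructor
      · rintro ⟨h, rfl⟩; exact ⟨⟨h, this⟩, rfl⟩
      · rintro ⟨⟨h, _⟩, h'⟩; exact ⟨h, h'⟩
    · intro R hR
      simpa using (Finset.mem_filter.1 hR).2
  rw [h1, ← sum_moebius F T, ← Finset.sum_filter_add_sum_filter_not T.powerset
      (fun R => R.card < M),
    add_sub_cancel_left]
  refine (Finset.abs_sum_le_sum_abs _ _).trans ?_
  have h5 : (5 : ℝ) ^ T.card = ∑ R ∈ T.powerset, (4 : ℝ) ^ R.card := by
    have := Finset.sum_pow_mul_eq_add_pow (4 : ℝ) 1 T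
    norm_num at this
    exact this.symm
  rw [h5, Finset.mul_sum]
  refine (Finset.sum_le_sum (g := fun R => (1 / 2 : ℝ) ^ M * 4 ^ R.card) fun R hR => ?_).trans
    (Finset.sum_le_sum_of_subset_of_nonneg (Finset.filter_subset _ _) fun _ _ _ => by positivity)
  have hM : M ≤ R.card := not_lt.1 (Finset.mem_filter.1 hR).2
  refine (abs_moebius_le hF R).trans ?_
  have e : (4 : ℝ) ^ R.card = 2 ^ R.card * 2 ^ R.card := by rw [← mul_pow]; norm_num
  rw [e, ← mul_assoc]
  refine le_mul_of_one_le_left (by positivity) ?_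
  calc (1 : ℝ) = (1 / 2) ^ M * 2 ^ M := by rw [← mul_pow]; norm_num
    _ ≤ (1 / 2) ^ M * 2 ^ R.card := by
      gcongr
      norm_num

/-- The potential edges between the vertices `0, …, m`. -/
def potentialEdges (m : ℕ) : Finset (Fin (m + 1) × Fin (m + 1)) :=
  Finset.univ.filter fun e => e.1 < e.2

/-- The tuple `t` consists of distinct vertices of `C` different from `o`, and the edges between the
vertices `o, t 0, …, t (m - 1)` listed in `S` are present. -/
def IsRootedHom {V : Type*} (G : SimpleGraph V) (o : V) (C : Set V) {m : ℕ}
    (S : Finset (Fin (m + 1) × Fin (m + 1))) (t : Fin m → V) : Prop :=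
  Function.Injective (Fin.cons o t : Fin (m + 1) → V) ∧ (∀ a, t a ∈ C) ∧
    ∀ e ∈ S, G.Adj ((Fin.cons o t : Fin (m + 1) → V) e.1) ((Fin.cons o t : Fin (m + 1) → V) e.2)

open scoped Classical in
/-- The number of tuples of distinct vertices of `C`, different from `o`, for which the edges listed
in `S` are present. -/
def homCount {V : Type*} (G : SimpleGraph V) (o : V) (C : Set V) {m : ℕ}
    (S : Finset (Fin (m + 1) × Fin (m + 1))) : ℝ≥0∞ :=
  ∑' t : Fin m → V, if IsRootedHom G o C S t then 1 else 0

open scoped Classical in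
/-- The injective tuples with values in a finite set. -/
def injTuples {V : Type*} (C : Finset V) (m : ℕ) : Finset (Fin m → V) :=
  (Fintype.piFinset fun _ : Fin m => C).filter Function.Injective

lemma mem_injTuples {V : Type*} {C : Finset V} {m : ℕ} {t : Fin m → V} :
    t ∈ injTuples C m ↔ (∀ a, t a ∈ C) ∧ Function.Injective t := by
  classical
  simp [injTuples, Fintype.mem_piFinset]

lemma card_injTuples {V : Type*} (C : Finset V) (m : ℕ) :
    (injTuples C m).card = C.card.descFactorial m := by
  classical
  have e : {t // t ∈ injTuples C m} ≃ (Fin m ↪ C) :=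
    { toFun := fun t => ⟨fun a => ⟨t.1 a, (mem_injTuples.1 t.2).1 a⟩, fun a b hab =>
        (mem_injTuples.1 t.2).2 (congrArg Subtype.val hab)⟩
      invFun := fun f => ⟨fun a => (f a : V), mem_injTuples.2 ⟨fun a => (f a).2,
        fun a b hab => f.injective (Subtype.ext hab)⟩⟩
      left_inv := fun t => rfl
      right_inv := fun f => rfl }
  have := Fintype.card_congr e
  rw [Fintype.card_coe, Fintype.card_embedding_eq, Fintype.card_fin, Fintype.card_coe] at this
  exact this

open scoped Classical in
lemma homCount_eq_card {V : Type*} (G : SimpleGraph V) (o : V) (C : Finset V) (ho : o ∉ C) {m : ℕ}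
    (S : Finset (Fin (m + 1) × Fin (m + 1))) :
    homCount G o C S = (((injTuples C m).filter fun t => ∀ e ∈ S,
      G.Adj ((Fin.cons o t : Fin (m + 1) → V) e.1)
        ((Fin.cons o t : Fin (m + 1) → V) e.2)).card : ℕ) := by
  unfold homCount
  rw [tsum_eq_sum (s := injTuples C m), ← Finset.sum_filter_add_sum_filter_not (injTuples C m)
    (fun t => ∀ e ∈ S, G.Adj ((Fin.cons o t : Fin (m + 1) → V) e.1)
        ((Fin.cons o t : Fin (m + 1) → V) e.2))]
  · have h1 : ∀ t ∈ (injTuples C m).filter (fun t => ∀ e ∈ S,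
        G.Adj ((Fin.cons o t : Fin (m + 1) → V) e.1) ((Fin.cons o t : Fin (m + 1) → V) e.2)),
        (if IsRootedHom G o (C : Set V) S t then (1 : ℝ≥0∞) else 0) = 1 := by
      intro t ht
      obtain ⟨ht1, ht2⟩ := Finset.mem_filter.1 ht
      obtain ⟨h3, h4⟩ := mem_injTuples.1 ht1
      exact if_pos ⟨Fin.cons_injective_iff.2 ⟨fun ⟨a, ha⟩ => ho (ha ▸ h3 a), h4⟩, h3, ht2⟩
    have h2 : ∀ t ∈ (injTuples C m).filter (fun t => ¬ ∀ e ∈ S,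
        G.Adj ((Fin.cons o t : Fin (m + 1) → V) e.1) ((Fin.cons o t : Fin (m + 1) → V) e.2)),
        (if IsRootedHom G o (C : Set V) S t then (1 : ℝ≥0∞) else 0) = 0 := by
      intro t ht
      exact if_neg fun h => (Finset.mem_filter.1 ht).2 h.2.2
    rw [Finset.sum_congr rfl h1, Finset.sum_congr rfl h2]
    simp
  · intro t ht
    exact if_neg fun h => ht (mem_injTuples.2 ⟨h.2.1, (Fin.cons_injective_iff.1 h.1).2⟩)

lemma homCount_empty {V : Type*} (G : SimpleGraph V) (o : V) (C : Finset V) (ho : o ∉ C) (m : ℕ) :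
    homCount G o C (∅ : Finset (Fin (m + 1) × Fin (m + 1))) = (C.card.descFactorial m : ℕ) := by
  classical
  rw [homCount_eq_card G o C ho, ← card_injTuples]
  simp

/-- An exponential moment of the number of points as a sum of factorial moments. -/
lemma five_pow_card_eq_tsum {V : Type*} (G : SimpleGraph V) (o : V) (C : Finset V) (ho : o ∉ C) :
    (5 : ℝ≥0∞) ^ C.card = ∑' m : ℕ, ENNReal.ofReal (4 ^ m / m.factorial) *
      homCount G o C (∅ : Finset (Fin (m + 1) × Fin (m + 1))) := by
  rw [tsum_eq_sum (s := Finset.range (C.card + 1))]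
  · have h : ∀ m ∈ Finset.range (C.card + 1), ENNReal.ofReal (4 ^ m / m.factorial) *
        homCount G o C (∅ : Finset (Fin (m + 1) × Fin (m + 1))) = 4 ^ m
            * (C.card.choose m : ℕ) := by
      intro m _
      rw [homCount_empty G o C ho, Nat.descFactorial_eq_factorial_mul_choose, Nat.cast_mul,
        ← mul_assoc, ENNReal.ofReal_div_of_pos (by positivity), ENNReal.ofReal_natCast,
        ENNReal.div_mul_cancel (by positivity) (by simp)]
      rw [ENNReal.ofReal_pow (by norm_num)]
      norm_num
    rw [Finset.sum_congr rfl h]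
    -- The binomial expansion of (4 + 1)^|C|.
    have := add_pow (4 : ℝ≥0∞) 1 C.card
    norm_num at this
    rw [← this]
  · intro m hm
    have : C.card.descFactorial m = 0 := Nat.descFactorial_eq_zero_iff_lt.2 (by simpa using hm)
    rw [homCount_empty G o C ho, this]
    simp

/-- The injective tuples with image R are the orderings of R, so each m-set is counted m! times. -/
lemma sum_injTuples_image {V : Type*} [DecidableEq V] (C : Finset V) (m : ℕ) (f : Finset V → ℝ) :
    ∑ t ∈ injTuples C m, f (Finset.univ.image t) =
      (m.factorial : ℝ) * ∑ R ∈ C.powersetCard m, f R := by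
  rw [← Finset.sum_fiberwise_of_maps_to (g := fun t : Fin m → V => Finset.univ.image t)
    (t := C.powersetCard m), Finset.mul_sum]
  · refine Finset.sum_congr rfl fun R hR => ?_
    obtain ⟨hRC, hRm⟩ := Finset.mem_powersetCard.1 hR
    have : (injTuples C m).filter (fun t => Finset.univ.image t = R) = injTuples R m := by
      ext t
      simp only [Finset.mem_filter, mem_injTuples]
      constructor
      · rintro ⟨⟨_, h⟩, rfl⟩
        exact ⟨fun a => Finset.mem_image_of_mem _ (Finset.mem_univ _), h⟩
      · rintro ⟨h, h'⟩
        refine ⟨⟨fun a => hRC (h a), h'⟩, Finset.eq_of_subset_of_card_le ?_ ?_⟩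
        · intro v hv
          obtain ⟨a, _, rfl⟩ := Finset.mem_image.1 hv
          exact h a
        · rw [Finset.card_image_of_injective _ h', hRm]; simp
    rw [Finset.sum_congr rfl (g := fun _ => f R), Finset.sum_const, this, card_injTuples, hRm,
      Nat.descFactorial_self, nsmul_eq_mul]
    intro t ht
    rw [(Finset.mem_filter.1 ht).2]
  · intro t ht
    obtain ⟨h, h'⟩ := mem_injTuples.1 ht
    refine Finset.mem_powersetCard.2 ⟨fun v hv => ?_, ?_⟩
    · obtain ⟨a, _, rfl⟩ := Finset.mem_image.1 hv
      exact h a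
    · rw [Finset.card_image_of_injective _ h']; simp

open scoped Classical in
/-- The indicator that the `r`-neighbourhood of `o` in the subgraph induced by `o` and `R` is
isomorphic to `(H, h)`. -/
def ballInd {V U : Type*} (r : ℕ) (H : SimpleGraph U) (h : U) (G : SimpleGraph V) (o : V)
    (R : Set V) : ℝ :=
  if BallIso (G.induce (insert o R)) ⟨o, Set.mem_insert o R⟩ r H h then 1 else 0

lemma abs_ballInd_le {V U : Type*} (r : ℕ) (H : SimpleGraph U) (h : U) (G : SimpleGraph V) (o : V)
    (R : Set V) : |ballInd r H h G o R| ≤ 1 := by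
  unfold ballInd
  split_ifs <;> simp

/-- Transports the event from the vertices of a tuple to `Fin (m + 1)`, so that the coefficients of
the expansion depend on the pattern of edges and not on the ambient graph. -/
lemma ballInd_comap {V V' U : Type*} (r : ℕ) (H : SimpleGraph U) (h : U) (G : SimpleGraph V')
    {f : V → V'} (hf : Function.Injective f) (o : V) (R : Set V) :
    ballInd r H h (G.comap f) o R = ballInd r H h G (f o) (f '' R) := by
  unfold ballInd
  rw [ballIso_induce_comap_iff hf (t := insert (f o) (f '' R)) (Set.image_insert_eq) rfl]

/-- The coefficient of the count of `(m, S)` in the expansion of `ballInd r H h`. -/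
def ballCoeff {U : Type*} (r : ℕ) (H : SimpleGraph U) (h : U) (m : ℕ)
    (S : Finset (Fin (m + 1) × Fin (m + 1))) : ℝ :=
  (m.factorial : ℝ)⁻¹ * moebius (fun T : Finset (Fin (m + 1) × Fin (m + 1)) =>
    moebius (fun A : Finset (Fin m) => ballInd r H h
      (SimpleGraph.fromRel fun a b : Fin (m + 1) => (a, b) ∈ T) 0 (Fin.succ '' (A : Set (Fin m))))
    Finset.univ) S

/-- Increasing pairs encode a graph on `Fin (m + 1)` without loss, since `fromRel` restores the
symmetry. Hence set functions of edge sets are functions of graphs, as `ballCoeff` requires. -/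
lemma fromRel_filter_potentialEdges {m : ℕ} (g : SimpleGraph (Fin (m + 1)))
    [DecidablePred fun e : Fin (m + 1) × Fin (m + 1) => g.Adj e.1 e.2] :
    SimpleGraph.fromRel (fun a b : Fin (m + 1) =>
      (a, b) ∈ (potentialEdges m).filter fun e => g.Adj e.1 e.2) = g := by
  ext a b
  simp only [SimpleGraph.fromRel_adj, potentialEdges, Finset.mem_filter, Finset.mem_univ, true_and]
  constructor
  · rintro ⟨_, h | h⟩
    · exact h.2
    · exact h.2.symm
  · intro h
    refine ⟨h.ne, ?_⟩
    rcases lt_or_gt_of_ne h.ne with h' | h'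
    · exact Or.inl ⟨h', h⟩
    · exact Or.inr ⟨h', h.symm⟩

lemma moebius_image {α β : Type*} [DecidableEq β] (F : Finset β → ℝ) {f : α → β}
    (hf : Function.Injective f) (A : Finset α) :
    moebius F (A.image f) = moebius (fun A' => F (A'.image f)) A := by
  unfold moebius
  rw [Finset.powerset_image, Finset.sum_image]
  · simp [Finset.card_image_of_injective _ hf]
  · exact fun A _ B _ h => Finset.image_injective hf h

/-- The indicator of a local event is, up to a small error, a linear combination of counts. -/
theorem abs_ballInd_sub_sum_homCount_le {V U : Type*} (r : ℕ) (H : SimpleGraph U) (h : U)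
    (G : SimpleGraph V) (o : V) (C : Finset V) (ho : o ∉ C) (M : ℕ) :
    |ballInd r H h G o C - ∑ m ∈ Finset.range M, ∑ S ∈ (potentialEdges m).powerset,
      ballCoeff r H h m S * (homCount G o C S).toReal| ≤ (1 / 2) ^ M * 5 ^ C.card := by
  classical
  have key : ∀ m, ∑ S ∈ (potentialEdges m).powerset,
      ballCoeff r H h m S * (homCount G o C S).toReal =
      ∑ R ∈ C.powersetCard m, moebius (fun R : Finset V => ballInd r H h G o R) R := by
    intro m
    have h0 := sum_injTuples_image C m (moebius fun R : Finset V => ballInd r H h G o R)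
    have h1 : ∀ t ∈ injTuples C m, moebius (fun R : Finset V => ballInd r H h G o R)
        (Finset.univ.image t) = ∑ S ∈ (potentialEdges m).powerset,
          if ∀ e ∈ S, G.Adj ((Fin.cons o t : Fin (m + 1) → V) e.1)
            ((Fin.cons o t : Fin (m + 1) → V) e.2)
          then m.factorial * ballCoeff r H h m S else 0 := by
      intro t ht
      obtain ⟨h2, h3⟩ := mem_injTuples.1 ht
      have hinj : Function.Injective (Fin.cons o t : Fin (m + 1) → V) :=
        Fin.cons_injective_iff.2 ⟨fun ⟨a, ha⟩ => ho (ha ▸ h2 a), h3⟩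
      set g := G.comap (Fin.cons o t : Fin (m + 1) → V) with hg
      have h4 : moebius (fun R : Finset V => ballInd r H h G o R) (Finset.univ.image t) =
          moebius (fun A : Finset (Fin m) => ballInd r H h g 0 (Fin.succ '' (A : Set (Fin m))))
            Finset.univ := by
        rw [moebius_image _ h3]
        congr 1
        ext A
        rw [hg, ballInd_comap r H h G hinj]
        congr 1
        rw [← Set.image_comp]
        simp only [Finset.coe_image]
        rfl
      -- The second inversion, over edge sets: the value at the graph `g` is the sum of the
      -- transform over all subsets S of its edges, which are the S whose edges are all present
      -- along the tuple.
      have h5 := sum_moebius (fun T : Finset (Fin (m + 1) × Fin (m + 1)) =>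
        moebius (fun A : Finset (Fin m) => ballInd r H h
        (SimpleGraph.fromRel fun a b : Fin (m + 1) => (a, b) ∈ T) 0
          (Fin.succ '' (A : Set (Fin m)))) Finset.univ)
        ((potentialEdges m).filter fun e => g.Adj e.1 e.2)
      rw [fromRel_filter_potentialEdges] at h5
      rw [h4, ← h5, ← Finset.sum_filter]
      refine Finset.sum_congr ?_ fun S _ => ?_
      · ext S
        simp only [Finset.mem_powerset, Finset.mem_filter, Finset.subset_iff]
        exact ⟨fun h => ⟨fun e he => (h he).1, fun e he => (h he).2⟩,
          fun h e he => ⟨h.1 he, h.2 e he⟩⟩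
      · rw [ballCoeff, mul_inv_cancel_left₀ (by positivity)]
    rw [Finset.sum_congr rfl h1, Finset.sum_comm] at h0
    have h6 : ∀ S ∈ (potentialEdges m).powerset, ∑ t ∈ injTuples C m,
        (if ∀ e ∈ S, G.Adj ((Fin.cons o t : Fin (m + 1) → V) e.1)
            ((Fin.cons o t : Fin (m + 1) → V) e.2)
          then m.factorial * ballCoeff r H h m S else 0) =
        m.factorial * (ballCoeff r H h m S * (homCount G o C S).toReal) := by
      intro S _
      rw [homCount_eq_card G o C ho, ← Finset.sum_filter, Finset.sum_const, nsmul_eq_mul]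
      simp only [ENNReal.toReal_natCast]
      ring
    rw [Finset.sum_congr rfl h6, ← Finset.mul_sum] at h0
    exact mul_left_cancel₀ (by positivity) h0
  rw [Finset.sum_congr rfl fun m _ => key m]
  exact abs_sub_sum_moebius_le (F := fun R : Finset V => ballInd r H h G o R)
    (fun R => abs_ballInd_le r H h G o R) C M

/-! ### The connection function -/

lemma girgKernel_le_one (α : ℝ≥0∞) (d : ℕ) (L t x y : ℝ) : girgKernel α d L t x y ≤ 1 := by
  unfold girgKernel
  split_ifs <;> simp

lemma girgKernel_nonneg (α : ℝ≥0∞) (d : ℕ) {L t x y : ℝ} (h : 0 ≤ x * y / L) (ht : 0 ≤ t) :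
    0 ≤ girgKernel α d L t x y := by
  unfold girgKernel
  split_ifs
  · simp
  · simp
  · exact le_min zero_le_one (mul_nonneg (Real.rpow_nonneg h _) (Real.rpow_nonneg ht _))

lemma girgKernel_comm (α : ℝ≥0∞) (d : ℕ) (L t x y : ℝ) :
    girgKernel α d L t x y = girgKernel α d L t y x := by
  unfold girgKernel
  rw [mul_comm x y]

lemma girgKernel_one_left (α : ℝ≥0∞) (d : ℕ) (L t x y : ℝ) :
    girgKernel α d L t x y = girgKernel α d 1 t (x * y / L) 1 := by
  unfold girgKernel
  simp

lemma measurable_girgKernel (α : ℝ≥0∞) (d : ℕ) {β : Type*} [MeasurableSpace β]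
    {L t x y : β → ℝ} (hL : Measurable L) (ht : Measurable t) (hx : Measurable x)
    (hy : Measurable y) : Measurable fun b => girgKernel α d (L b) (t b) (x b) (y b) := by
  unfold girgKernel
  by_cases h : α = ∞
  · simp only [h, if_true]
    exact Measurable.ite (measurableSet_lt (by fun_prop) (by fun_prop)) measurable_const
      measurable_const
  · simp only [h, if_false]
    fun_prop

/-- The kernel is a function of (x y / L)^(1/d) / t, so a factor s^d in L acts like a factor s in t.
With s^d = n it trades the total weight for the mean weight. -/
lemma girgKernel_scale (α : ℝ≥0∞) {d : ℕ} (hd : 1 ≤ d) {s L t x y : ℝ} (hs : 0 < s) (ht : 0 ≤ t)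
    (h : 0 ≤ x * y / L) :
    girgKernel α d (s ^ d * L) t x y = girgKernel α d L (s * t) x y := by
  have hd' : (d : ℝ) ≠ 0 := by positivity
  have e : x * y / (s ^ d * L) = (x * y / L) / s ^ d := by
    rw [mul_comm (s ^ d) L, div_div]
  unfold girgKernel
  rw [e]
  split_ifs with h1 h2 h3 h3
  · rfl
  · exfalso
    apply h3
    rw [Real.div_rpow h (by positivity), ← Real.rpow_natCast, ← Real.rpow_mul hs.le,
      mul_one_div_cancel hd', Real.rpow_one, lt_div_iff₀ hs] at h2
    linarith
  · exfalso
    apply h2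
    rw [Real.div_rpow h (by positivity), ← Real.rpow_natCast, ← Real.rpow_mul hs.le,
      mul_one_div_cancel hd', Real.rpow_one, lt_div_iff₀ hs]
    linarith
  · rfl
  · rw [Real.div_rpow h (by positivity), Real.mul_rpow hs.le ht, ← Real.rpow_natCast s,
      ← Real.rpow_mul hs.le, Real.rpow_neg hs.le, div_eq_mul_inv, mul_assoc]

/-- The excluded value of t is the jump of the threshold kernel for α = ∞. -/
lemma continuousAt_girgKernel (α : ℝ≥0∞) {d : ℕ} (hd : 1 ≤ d) {L t x y : ℝ}
    (hL : L ≠ 0) (ht : t ≠ (x * y / L) ^ (1 / (d : ℝ))) :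
    ContinuousAt (fun p : ℝ × ℝ × ℝ => girgKernel α d p.1 t p.2.1 p.2.2) (L, x, y) := by
  have hq : ContinuousAt (fun p : ℝ × ℝ × ℝ => p.2.1 * p.2.2 / p.1) (L, x, y) :=
    ContinuousAt.div (by fun_prop) (by fun_prop) hL
  unfold girgKernel
  by_cases h : α = ∞
  · simp only [h, if_true]
    have hr : ContinuousAt (fun p : ℝ × ℝ × ℝ => (p.2.1 * p.2.2 / p.1) ^ (1 / (d : ℝ))) (L, x, y) :=
      hq.rpow_const (Or.inr (by positivity))
    rcases lt_or_gt_of_ne ht with h1 | h1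
    · refine (continuousAt_const (y := (1 : ℝ))).congr ?_
      filter_upwards [hr.eventually (lt_mem_nhds h1)] with p hp
      rw [if_pos hp]
    · refine (continuousAt_const (y := (0 : ℝ))).congr ?_
      filter_upwards [hr.eventually (gt_mem_nhds h1)] with p hp
      rw [if_neg (not_lt.2 hp.le)]
  · simp only [h, if_false]
    refine continuousAt_const.inf (ContinuousAt.mul ?_ continuousAt_const)
    exact hq.rpow_const (Or.inr ENNReal.toReal_nonneg)

lemma tendsto_girgKernel (α : ℝ≥0∞) {d : ℕ} (hd : 1 ≤ d) {ι : Type*} {l : Filter ι}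
    {L' x' y' : ι → ℝ} {L t x y : ℝ} (hL' : Tendsto L' l (𝓝 L)) (hx' : Tendsto x' l (𝓝 x))
    (hy' : Tendsto y' l (𝓝 y)) (hL : L ≠ 0) (ht : t ≠ (x * y / L) ^ (1 / (d : ℝ))) :
    Tendsto (fun i => girgKernel α d (L' i) t (x' i) (y' i)) l (𝓝 (girgKernel α d L t x y)) := by
  have h := (continuousAt_girgKernel α hd hL ht).tendsto.comp
    (hL'.prodMk_nhds (hx'.prodMk_nhds hy'))
  simpa only [Function.comp_def] using h

/-- As b is the larger index, it is not the vertex fixed at the origin, and the difference of the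
two locations is a surjective linear function of y. Preimages of null sets under such maps are null,
and spheres are null. -/
lemma volume_norm_sub_eq {d : ℕ} (hd : 1 ≤ d) {m : ℕ} {a b : Fin (m + 1)} (hab : a < b) (s : ℝ) :
    ∀ᵐ y : Fin m → EuclideanSpace ℝ (Fin d),
      ‖(Fin.cons 0 y : Fin (m + 1) → EuclideanSpace ℝ (Fin d)) a -
        (Fin.cons 0 y : Fin (m + 1) → EuclideanSpace ℝ (Fin d)) b‖ ≠ s := by
  have : Nonempty (Fin d) := ⟨⟨0, hd⟩⟩
  have hnull : ∀ᵐ z : EuclideanSpace ℝ (Fin d), z ∈ (Metric.sphere 0 s)ᶜ := by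
    exact compl_mem_ae_iff.2 (Measure.addHaar_sphere volume (0 : EuclideanSpace ℝ (Fin d)) s)
  have hb : b ≠ 0 := (Fin.pos_iff_ne_zero.1 (lt_of_le_of_lt (Fin.zero_le a) hab))
  obtain ⟨b', rfl⟩ := Fin.exists_succ_eq.2 hb
  let ℓ : (Fin m → EuclideanSpace ℝ (Fin d)) →ₗ[ℝ] EuclideanSpace ℝ (Fin d) :=
    { toFun := fun y => (Fin.cons 0 y : Fin (m + 1) → EuclideanSpace ℝ (Fin d)) a - y b'
      map_add' := by
        intro y z
        refine Fin.cases ?_ (fun a => ?_) a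
        · simp; abel
        · simp; abel
      map_smul' := by
        intro c y
        refine Fin.cases ?_ (fun a => ?_) a
        · simp
        · simp [smul_sub] }
  have hsurj : Function.Surjective ℓ := by
    intro z
    refine ⟨Function.update 0 b' (-z), ?_⟩
    change (Fin.cons 0 (Function.update 0 b' (-z)) : Fin (m + 1) → EuclideanSpace ℝ (Fin d)) a -
      (Function.update 0 b' (-z) : Fin m → EuclideanSpace ℝ (Fin d)) b' = z
    rw [Function.update_self]
    revert hab
    refine Fin.cases ?_ (fun a => ?_) a
    · simp
    · intro h
      have : a ≠ b' := fun h' => by simp [h'] at h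
      simp [this]
  have h2 := (ae_comp_linearMap_mem_iff ℓ (volume : Measure (Fin m → EuclideanSpace ℝ (Fin d)))
    volume hsurj (s := (Metric.sphere 0 s)ᶜ) Metric.isClosed_sphere.measurableSet.compl).2 hnull
  filter_upwards [h2] with y hy h3
  apply hy
  rw [mem_sphere_zero_iff_norm]
  simpa [ℓ] using h3

lemma lintegral_comp_const_smul {F : Type*} [NormedAddCommGroup F] [NormedSpace ℝ F]
    [FiniteDimensional ℝ F] [MeasurableSpace F] [BorelSpace F] (ν : Measure F) [ν.IsAddHaarMeasure]
    {s : ℝ} (hs : 0 < s) (f : F → ℝ≥0∞) :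
    ENNReal.ofReal (s ^ Module.finrank ℝ F) * ∫⁻ x, f (s • x) ∂ν = ∫⁻ x, f x ∂ν := by
  have h1 : ∫⁻ x, f (s • x) ∂ν = ∫⁻ x, f x ∂(ν.map (s • ·)) :=
    ((Homeomorph.smulOfNeZero s hs.ne').toMeasurableEquiv.measurableEmbedding.lintegral_map f).symm
  rw [h1, Measure.map_addHaar_smul ν hs.ne', lintegral_smul_measure, smul_eq_mul, ← mul_assoc,
    ← ENNReal.ofReal_mul (by positivity), abs_of_pos (by positivity),
    mul_inv_cancel₀ (by positivity), ENNReal.ofReal_one, one_mul]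

/-- The total mass of the connection function for unit weights. -/
def kernelMass (α : ℝ≥0∞) (d : ℕ) : ℝ≥0∞ :=
  ∫⁻ y : EuclideanSpace ℝ (Fin d), ENNReal.ofReal (girgKernel α d 1 ‖y‖ 1 1)

lemma kernelMass_ne_top {α : ℝ≥0∞} (hα : 1 < α) {d : ℕ} (hd : 1 ≤ d) : kernelMass α d ≠ ∞ := by
  unfold kernelMass
  by_cases h : α = ∞
  · refine ne_of_lt (lt_of_le_of_lt (lintegral_mono (g := (Metric.ball 0 1).indicator 1) ?_) ?_)
    · intro y
      simp only [girgKernel, h, if_true]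
      by_cases hy : ‖y‖ < 1
      · have : y ∈ Metric.ball (0 : EuclideanSpace ℝ (Fin d)) 1 := by simpa using hy
        simp [hy, this]
      · simp [hy]
    · rw [lintegral_indicator_one measurableSet_ball]
      exact measure_ball_lt_top
  · have hα' : 1 < α.toReal := by
      have := (ENNReal.toReal_lt_toReal ENNReal.one_ne_top h).2 hα
      simpa using this
    set ρ := (d : ℝ) * α.toReal with hρ
    have hd' : (1 : ℝ) ≤ d := by exact_mod_cast hd
    have hρd : (d : ℝ) < ρ := by nlinarith
    have hfin := finite_integral_one_add_norm (E := EuclideanSpace ℝ (Fin d)) (μ := volume)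
      (r := ρ) (by simpa using hρd)
    -- The majorant is ((1 + |y|)/2)^(-ρ): it is at least 1 for |y| ≤ 1, and at least |y|^(-ρ) for
    -- |y| ≥ 1 because then (1 + |y|)/2 ≤ |y|. It is integrable since ρ = d α > d.
    refine ne_of_lt (lt_of_le_of_lt (lintegral_mono (g := fun y => ENNReal.ofReal (2 ^ ρ) *
      ENNReal.ofReal ((1 + ‖y‖) ^ (-ρ))) fun y => ?_) ?_)
    · simp only
      rw [← ENNReal.ofReal_mul (by positivity)]
      apply ENNReal.ofReal_le_ofReal
      simp only [girgKernel, h, if_false]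
      have e : (2 : ℝ) ^ ρ * (1 + ‖y‖) ^ (-ρ) = ((1 + ‖y‖) / 2) ^ (-ρ) := by
        rw [Real.div_rpow (by positivity) (by norm_num), Real.rpow_neg (by norm_num : (0 : ℝ) ≤ 2)]
        field_simp
      rw [e, ← hρ]
      rcases le_total ‖y‖ 1 with hy | hy
      · refine (min_le_left _ _).trans ?_
        refine Real.one_le_rpow_of_pos_of_le_one_of_nonpos (by positivity) (by linarith) (by linarith)
      · refine (min_le_right _ _).trans ?_
        simp only [mul_one, div_one, Real.one_rpow, one_mul]
        exact Real.rpow_le_rpow_of_nonpos (by positivity) (by linarith) (by linarith)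
    · rw [lintegral_const_mul' _ _ ENNReal.ofReal_ne_top]
      exact ENNReal.mul_lt_top ENNReal.ofReal_lt_top hfin

/-- Scaling space by s = q^(-1/d) normalises q = x y / L to 1, and the Jacobian is q. For q = 0 the
kernel vanishes. Linearity in x y is what later makes the total edge mass a function of the mean
weight alone. -/
lemma lintegral_girgKernel {α : ℝ≥0∞} (hα : 1 < α) {d : ℕ} (hd : 1 ≤ d) {L x y : ℝ}
    (h : 0 ≤ x * y / L) :
    ∫⁻ z : EuclideanSpace ℝ (Fin d), ENNReal.ofReal (girgKernel α d L ‖z‖ x y) =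
      kernelMass α d * ENNReal.ofReal (x * y / L) := by
  have hd' : (d : ℝ) ≠ 0 := by positivity
  simp_rw [girgKernel_one_left α d L]
  set q := x * y / L with hq
  rcases h.eq_or_lt with h0 | h0
  · rw [← h0]
    have : ∀ z : EuclideanSpace ℝ (Fin d), ENNReal.ofReal (girgKernel α d 1 ‖z‖ 0 1) = 0 := by
      intro z
      rw [ENNReal.ofReal_eq_zero]
      unfold girgKernel
      have hd'' : (1 : ℝ) / d ≠ 0 := by positivity
      split_ifs with h1 h2
      · exfalso
        rw [zero_mul, zero_div, Real.zero_rpow hd''] at h2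
        exact (not_lt.2 (norm_nonneg z)) h2
      · rfl
      · have : α.toReal ≠ 0 := (ENNReal.toReal_pos (zero_lt_one.trans hα).ne' h1).ne'
        rw [zero_mul, zero_div, Real.zero_rpow this, zero_mul]
        exact min_le_right _ _
    simp [this]
  · set s := q ^ (-(1 / (d : ℝ))) with hs
    have hs0 : 0 < s := Real.rpow_pos_of_pos h0 _
    have hsd : s ^ d = q⁻¹ := by
      rw [hs, ← Real.rpow_natCast, ← Real.rpow_mul h0.le, neg_mul, one_div_mul_cancel hd',
        Real.rpow_neg_one]
    have hk : ∀ z : EuclideanSpace ℝ (Fin d), girgKernel α d 1 ‖z‖ q 1 =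
        girgKernel α d 1 ‖s • z‖ 1 1 := by
      intro z
      rw [norm_smul, Real.norm_of_nonneg hs0.le, ← girgKernel_scale α hd hs0 (norm_nonneg z)
        (by norm_num), girgKernel_one_left α d (s ^ d * 1), hsd]
      simp
    simp_rw [hk]
    have := lintegral_comp_const_smul (volume : Measure (EuclideanSpace ℝ (Fin d))) hs0
      (fun z => ENNReal.ofReal (girgKernel α d 1 ‖z‖ 1 1))
    rw [finrank_euclideanSpace_fin, hsd] at this
    rw [kernelMass, ← this, mul_comm, ← mul_assoc, ← ENNReal.ofReal_mul h0.le,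
      mul_inv_cancel₀ h0.ne']
    simp

/-! ### Integrals of products of connection probabilities -/

/-- The product of the connection probabilities of the pairs listed in `S`. -/
def edgeProd {d : ℕ} {J : Type*} (κ : ℝ → ℝ → ℝ → ℝ) (S : Finset (J × J))
    (x : J → EuclideanSpace ℝ (Fin d)) (w : J → ℝ) : ℝ≥0∞ :=
  ∏ e ∈ S, ENNReal.ofReal (κ ‖x e.1 - x e.2‖ (w e.1) (w e.2))

lemma measurable_edgeProd (α : ℝ≥0∞) {d : ℕ} {J : Type*} (S : Finset (J × J)) {β : Type*}
    [MeasurableSpace β] {L : β → ℝ} {x : β → J → EuclideanSpace ℝ (Fin d)} {w : β → J → ℝ}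
    (hL : Measurable L) (hx : Measurable x) (hw : Measurable w) :
    Measurable fun b => edgeProd (girgKernel α d (L b)) S (x b) (w b) := by
  unfold edgeProd
  refine Finset.measurable_prod _ fun e _ => ENNReal.measurable_ofReal.comp ?_
  exact measurable_girgKernel α d hL (by fun_prop) (by fun_prop) (by fun_prop)

lemma edgeProd_le_one (α : ℝ≥0∞) {d : ℕ} {J : Type*} (L : ℝ) (S : Finset (J × J))
    (x : J → EuclideanSpace ℝ (Fin d)) (w : J → ℝ) : edgeProd (girgKernel α d L) S x w ≤ 1 :=
  Finset.prod_le_one' fun _ _ => ENNReal.ofReal_le_one.2 (girgKernel_le_one _ _ _ _ _ _)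

/-- The integral over the locations in `B` of all vertices of a cluster but the first one, which is
at the origin, of the product of the connection probabilities of the pairs listed in `S`. -/
def clusterIntegral (α : ℝ≥0∞) {d m : ℕ} (B : Set (EuclideanSpace ℝ (Fin d)))
    (S : Finset (Fin (m + 1) × Fin (m + 1))) (L : ℝ) (v : Fin (m + 1) → ℝ) : ℝ≥0∞ :=
  ∫⁻ y : Fin m → EuclideanSpace ℝ (Fin d), (Set.univ.pi fun _ => B).indicator
    (fun y => edgeProd (girgKernel α d L) S (Fin.cons 0 y) v) y

variable {d m : ℕ}

lemma measurable_cons_zero : Measurable fun y : Fin m → EuclideanSpace ℝ (Fin d) =>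
    (Fin.cons 0 y : Fin (m + 1) → EuclideanSpace ℝ (Fin d)) := by
  refine measurable_pi_lambda _ fun a => ?_
  refine Fin.cases ?_ (fun a => ?_) a
  · simp
  · simpa using measurable_pi_apply a

lemma clusterIntegral_le (α : ℝ≥0∞) {B : Set (EuclideanSpace ℝ (Fin d))} (hB : MeasurableSet B)
    (S : Finset (Fin (m + 1) × Fin (m + 1))) (L : ℝ) (v : Fin (m + 1) → ℝ) :
    clusterIntegral α B S L v ≤ volume B ^ m := by
  calc clusterIntegral α B S L v
      ≤ ∫⁻ y : Fin m → EuclideanSpace ℝ (Fin d), (Set.univ.pi fun _ => B).indicator 1 y :=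
        lintegral_mono fun y => Set.indicator_le_indicator (edgeProd_le_one _ _ _ _ _)
    _ = volume B ^ m := by
        rw [lintegral_indicator_one (MeasurableSet.univ_pi fun _ => hB), volume_pi, Measure.pi_pi]
        simp

lemma measurable_indicator_edgeProd (α : ℝ≥0∞) {B : Set (EuclideanSpace ℝ (Fin d))}
    (hB : MeasurableSet B) (S : Finset (Fin (m + 1) × Fin (m + 1))) :
    Measurable fun p : (ℝ × (Fin (m + 1) → ℝ)) × (Fin m → EuclideanSpace ℝ (Fin d)) =>
      (Set.univ.pi fun _ => B).indicator
        (fun y => edgeProd (girgKernel α d p.1.1) S (Fin.cons 0 y) p.1.2) p.2 := by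
  have h1 : Measurable fun p : (ℝ × (Fin (m + 1) → ℝ)) × (Fin m → EuclideanSpace ℝ (Fin d)) =>
      edgeProd (girgKernel α d p.1.1) S (Fin.cons 0 p.2) p.1.2 :=
    measurable_edgeProd α S (measurable_fst.comp measurable_fst)
      (measurable_cons_zero.comp measurable_snd) (measurable_snd.comp measurable_fst)
  have h2 : MeasurableSet (Prod.snd ⁻¹' (Set.univ.pi fun _ => B) :
      Set ((ℝ × (Fin (m + 1) → ℝ)) × (Fin m → EuclideanSpace ℝ (Fin d)))) :=
    measurable_snd (MeasurableSet.univ_pi fun _ => hB)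
  have h3 : (fun p : (ℝ × (Fin (m + 1) → ℝ)) × (Fin m → EuclideanSpace ℝ (Fin d)) =>
      (Set.univ.pi fun _ => B).indicator
        (fun y => edgeProd (girgKernel α d p.1.1) S (Fin.cons 0 y) p.1.2) p.2) =
      (Prod.snd ⁻¹' (Set.univ.pi fun _ => B)).indicator fun p =>
        edgeProd (girgKernel α d p.1.1) S (Fin.cons 0 p.2) p.1.2 := by
    ext p
    by_cases hp : p.2 ∈ Set.univ.pi fun _ : Fin m => B
    · rw [Set.indicator_of_mem hp, Set.indicator_of_mem (Set.mem_preimage.2 hp)]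
    · rw [Set.indicator_of_notMem hp, Set.indicator_of_notMem (fun h => hp (Set.mem_preimage.1 h))]
  rw [h3]
  exact h1.indicator h2

lemma measurable_clusterIntegral (α : ℝ≥0∞) {B : Set (EuclideanSpace ℝ (Fin d))}
    (hB : MeasurableSet B) (S : Finset (Fin (m + 1) × Fin (m + 1))) {β : Type*} [MeasurableSpace β]
    {L : β → ℝ} {v : β → Fin (m + 1) → ℝ} (hL : Measurable L) (hv : Measurable v) :
    Measurable fun b => clusterIntegral α B S (L b) (v b) := by
  have h : Measurable fun p : ℝ × (Fin (m + 1) → ℝ) => clusterIntegral α B S p.1 p.2 :=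
    (measurable_indicator_edgeProd α hB S).lintegral_prod_right'
  have h' := h.comp (hL.prodMk hv)
  simpa only [Function.comp_def] using h'

/-- Dominated convergence with the indicator of B^m as majorant. The integrand is continuous in (L,
v) except for locations at a threshold distance, a null set because S lists pairs of distinct
vertices. -/
lemma continuousAt_clusterIntegral (α : ℝ≥0∞) (hd : 1 ≤ d)
    {B : Set (EuclideanSpace ℝ (Fin d))} (hB : MeasurableSet B) (hB' : volume B ≠ ∞)
    {S : Finset (Fin (m + 1) × Fin (m + 1))} (hS : S ⊆ potentialEdges m) {L : ℝ} (hL : L ≠ 0)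
    (v : Fin (m + 1) → ℝ) :
    ContinuousAt (fun p : ℝ × (Fin (m + 1) → ℝ) => clusterIntegral α B S p.1 p.2) (L, v) := by
  unfold ContinuousAt clusterIntegral
  refine tendsto_lintegral_filter_of_dominated_convergence
    ((Set.univ.pi fun _ => B).indicator 1) ?_ ?_ ?_ ?_
  · exact Eventually.of_forall fun p =>
      (measurable_indicator_edgeProd α hB S).comp (measurable_const.prodMk measurable_id)
  · exact Eventually.of_forall fun p => Eventually.of_forall fun y =>
      Set.indicator_le_indicator (edgeProd_le_one _ _ _ _ _)
  · rw [lintegral_indicator_one (MeasurableSet.univ_pi fun _ => hB), volume_pi, Measure.pi_pi]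
    simpa using ENNReal.pow_ne_top hB'
  · have hae : ∀ᵐ y : Fin m → EuclideanSpace ℝ (Fin d), ∀ e ∈ S,
        ‖(Fin.cons 0 y : Fin (m + 1) → EuclideanSpace ℝ (Fin d)) e.1 -
        (Fin.cons 0 y : Fin (m + 1) → EuclideanSpace ℝ (Fin d)) e.2‖ ≠
          (v e.1 * v e.2 / L) ^ (1 / (d : ℝ)) := by
      refine (Finset.eventually_all S).2 fun e he => volume_norm_sub_eq hd ?_ _
      exact (Finset.mem_filter.1 (hS he)).2
    filter_upwards [hae] with y hy
    by_cases hyB : y ∈ Set.univ.pi fun _ : Fin m => B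
    · simp only [Set.indicator_of_mem hyB]
      refine ENNReal.tendsto_finsetProd_of_ne_top _ (fun e he => ENNReal.tendsto_ofReal ?_)
        fun _ _ => ENNReal.ofReal_ne_top
      exact tendsto_girgKernel α hd ((continuous_fst.tendsto _))
        (((continuous_apply e.1).comp continuous_snd).tendsto _)
        (((continuous_apply e.2).comp continuous_snd).tendsto _) hL (hy e he)
    · simp only [Set.indicator_of_notMem hyB]
      exact tendsto_const_nhds

lemma tendsto_clusterIntegral (α : ℝ≥0∞) (hd : 1 ≤ d)
    {B : Set (EuclideanSpace ℝ (Fin d))} (hB : MeasurableSet B) (hB' : volume B ≠ ∞)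
    {S : Finset (Fin (m + 1) × Fin (m + 1))} (hS : S ⊆ potentialEdges m) {ι : Type*} {l : Filter ι}
    {L' : ι → ℝ} {v' : ι → Fin (m + 1) → ℝ} {L : ℝ} {v : Fin (m + 1) → ℝ}
    (hL' : Tendsto L' l (𝓝 L)) (hv' : Tendsto v' l (𝓝 v)) (hL : L ≠ 0) :
    Tendsto (fun i => clusterIntegral α B S (L' i) (v' i)) l (𝓝 (clusterIntegral α B S L v)) := by
  have h := (continuousAt_clusterIntegral α hd hB hB' hS hL v).tendsto.comp (hL'.prodMk_nhds hv')
  simpa only [Function.comp_def] using h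

/-- The probability, for independent uniform locations in the unit box, that a cluster is close and
connected by the edges in `S`. The locations are scaled by the factor `s`. -/
def boxIntegral (α : ℝ≥0∞) (B : Set (EuclideanSpace ℝ (Fin d))) (s : ℝ)
    (S : Finset (Fin (m + 1) × Fin (m + 1))) (L : ℝ) (v : Fin (m + 1) → ℝ) : ℝ≥0∞ :=
  ∫⁻ x : Fin (m + 1) → EuclideanSpace ℝ (Fin d),
    {x : Fin (m + 1) → EuclideanSpace ℝ (Fin d) | ∀ a : Fin m, s • (x a.succ - x 0) ∈ B}.indicator
      (fun x => edgeProd (girgKernel α d L) S x v) x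
    ∂(Measure.pi fun _ => (volume : Measure (EuclideanSpace ℝ (Fin d))).restrict (unitBox d))

lemma measurableSet_close {B : Set (EuclideanSpace ℝ (Fin d))} (hB : MeasurableSet B) (s : ℝ) :
    MeasurableSet {x : Fin (m + 1) → EuclideanSpace ℝ (Fin d) |
      ∀ a : Fin m, s • (x a.succ - x 0) ∈ B} := by
  have : {x : Fin (m + 1) → EuclideanSpace ℝ (Fin d) | ∀ a : Fin m, s • (x a.succ - x 0) ∈ B} =
      ⋂ a : Fin m, (fun x : Fin (m + 1) → EuclideanSpace ℝ (Fin d) =>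
        s • (x a.succ - x 0)) ⁻¹' B := by
    ext; simp
  rw [this]
  exact MeasurableSet.iInter fun a => (by fun_prop :
    Measurable fun x : Fin (m + 1) → EuclideanSpace ℝ (Fin d) => s • (x a.succ - x 0)) hB

lemma lintegral_pi_cons (ν : Measure (EuclideanSpace ℝ (Fin d))) [SigmaFinite ν]
    {f : (Fin (m + 1) → EuclideanSpace ℝ (Fin d)) → ℝ≥0∞} (hf : Measurable f) :
    ∫⁻ x, f x ∂(Measure.pi fun _ => ν) =
      ∫⁻ x₀, ∫⁻ x : Fin m → EuclideanSpace ℝ (Fin d), f (Fin.cons x₀ x) ∂(Measure.pi fun _ => ν)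
        ∂ν := by
  have h := (measurePreserving_piFinSuccAbove (fun _ : Fin (m + 1) => ν) 0).symm
  rw [← h.lintegral_comp hf, lintegral_prod]
  · simp [MeasurableEquiv.piFinSuccAbove, Fin.insertNthEquiv]
  · exact (hf.comp h.measurable).aemeasurable

/-- The other vertices are described by their scaled displacements from the first one; the kernel
sees differences only and absorbs the scale. -/
lemma boxIntegral_eq (α : ℝ≥0∞) (hd : 1 ≤ d) {B : Set (EuclideanSpace ℝ (Fin d))}
    (hB : MeasurableSet B) {s : ℝ} (hs : 0 < s)
    {S : Finset (Fin (m + 1) × Fin (m + 1))} {L : ℝ} (hL : 0 ≤ L) {v : Fin (m + 1) → ℝ}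
    (hv : ∀ a, 0 ≤ v a) :
    boxIntegral α B s S (s ^ d * L) v =
      ∫⁻ x₀ in unitBox d, ∫⁻ x : Fin m → EuclideanSpace ℝ (Fin d) in Set.univ.pi fun _ => unitBox d,
        (Set.univ.pi fun _ => B).indicator
          (fun y => edgeProd (girgKernel α d L) S (Fin.cons 0 y) v) (s • (x - fun _ => x₀)) := by
  unfold boxIntegral
  rw [lintegral_pi_cons]
  · refine lintegral_congr fun x₀ => ?_
    rw [volume_pi, Measure.restrict_pi_pi]
    refine lintegral_congr fun x => ?_
    by_cases hx : s • (x - fun _ => x₀) ∈ Set.univ.pi fun _ : Fin m => B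
    · rw [Set.indicator_of_mem hx, Set.indicator_of_mem]
      · unfold edgeProd
        refine Finset.prod_congr rfl fun e _ => ?_
        rw [girgKernel_scale α hd hs (norm_nonneg _)
          (div_nonneg (mul_nonneg (hv _) (hv _)) hL), ← norm_smul_of_nonneg hs.le]
        have h1 : ∀ a : Fin (m + 1),
            (Fin.cons 0 (s • (x - fun _ => x₀)) : Fin (m + 1) → EuclideanSpace ℝ (Fin d)) a =
            s • ((Fin.cons x₀ x : Fin (m + 1) → EuclideanSpace ℝ (Fin d)) a - x₀) := by
          intro a
          refine Fin.cases ?_ (fun a => ?_) a <;> simp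
        rw [h1, h1, ← smul_sub, sub_sub_sub_cancel_right]
      · intro a
        simpa using hx a (Set.mem_univ _)
    · rw [Set.indicator_of_notMem hx, Set.indicator_of_notMem]
      intro h
      exact hx fun a _ => by simpa using h a
  · have h2 : Measurable fun x : Fin (m + 1) → EuclideanSpace ℝ (Fin d) =>
        edgeProd (girgKernel α d (s ^ d * L)) S x v :=
      measurable_edgeProd α S measurable_const measurable_id measurable_const
    exact h2.indicator (measurableSet_close hB s)

lemma lintegral_comp_smul_sub_const {s : ℝ} (hs : 0 < s) (x₀ : EuclideanSpace ℝ (Fin d))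
    (g : (Fin m → EuclideanSpace ℝ (Fin d)) → ℝ≥0∞) :
    ENNReal.ofReal (s ^ (m * d)) * ∫⁻ x, g (s • (x - fun _ => x₀)) = ∫⁻ y, g y := by
  rw [lintegral_sub_right_eq_self (μ := volume) (fun x => g (s • x)) (fun _ => x₀)]
  have := lintegral_comp_const_smul (volume : Measure (Fin m → EuclideanSpace ℝ (Fin d))) hs g
  rwa [Module.finrank_pi_fintype, Finset.sum_const, finrank_euclideanSpace_fin, Finset.card_univ,
    Fintype.card_fin, smul_eq_mul] at this

lemma volume_box (ρ : ℝ) :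
    volume {x : EuclideanSpace ℝ (Fin d) | ∀ k, x k ∈ Set.Icc (-ρ) ρ} =
      ENNReal.ofReal (2 * ρ) ^ d := by
  have h := (PiLp.volume_preserving_ofLp (Fin d)).measure_preimage
    (s := Set.univ.pi fun _ => Set.Icc (-ρ) ρ)
    (MeasurableSet.univ_pi fun _ => measurableSet_Icc).nullMeasurableSet
  have e : {x : EuclideanSpace ℝ (Fin d) | ∀ k, x k ∈ Set.Icc (-ρ) ρ} =
      (fun x : EuclideanSpace ℝ (Fin d) => x.ofLp) ⁻¹' (Set.univ.pi fun _ => Set.Icc (-ρ) ρ) := by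
    ext
    simp only [Set.mem_preimage, Set.mem_pi, Set.mem_univ, true_imp_iff]
    rfl
  rw [e, h, volume_pi, Measure.pi_pi]
  simp [two_mul]

lemma measurableSet_box (ρ ρ' : ℝ) :
    MeasurableSet {x : EuclideanSpace ℝ (Fin d) | ∀ k, x k ∈ Set.Icc ρ ρ'} := by
  have : {x : EuclideanSpace ℝ (Fin d) | ∀ k, x k ∈ Set.Icc ρ ρ'} =
      ⋂ k, (fun x : EuclideanSpace ℝ (Fin d) => x k) ⁻¹' Set.Icc ρ ρ' := by
    ext; simp
  rw [this]
  exact MeasurableSet.iInter fun k => (by fun_prop : Measurable fun x :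
    EuclideanSpace ℝ (Fin d) => x k) measurableSet_Icc

lemma measurableSet_unitBox : MeasurableSet (unitBox d) := measurableSet_box _ _

lemma volume_unitBox : volume (unitBox d) = 1 := by
  have := volume_box (d := d) (1 / 2)
  norm_num at this
  exact this

/-- Letting the other vertices leave the box can only increase the integral. -/
lemma boxIntegral_le (α : ℝ≥0∞) (hd : 1 ≤ d) {B : Set (EuclideanSpace ℝ (Fin d))}
    (hB : MeasurableSet B) {s : ℝ} (hs : 0 < s)
    {S : Finset (Fin (m + 1) × Fin (m + 1))} {L : ℝ} (hL : 0 ≤ L) {v : Fin (m + 1) → ℝ}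
    (hv : ∀ a, 0 ≤ v a) :
    ENNReal.ofReal (s ^ (m * d)) * boxIntegral α B s S (s ^ d * L) v ≤
      clusterIntegral α B S L v := by
  rw [boxIntegral_eq α hd hB hs hL hv, ← lintegral_const_mul' _ _ ENNReal.ofReal_ne_top]
  calc _ ≤ ∫⁻ x₀ in unitBox d, clusterIntegral α B S L v := by
        refine lintegral_mono fun x₀ => ?_
        unfold clusterIntegral
        rw [← lintegral_comp_smul_sub_const hs x₀]
        exact mul_le_mul_right (setLIntegral_le_lintegral _ _) _
    _ = clusterIntegral α B S L v := by simp [volume_unitBox]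

/-- If the first vertex is at distance at least K / s from every face, the other vertices are in the
box automatically. Such positions fill a cube of side 1 - 2K/s; if this is negative the bound is
trivial, as `ENNReal.ofReal` is then 0. -/
lemma le_boxIntegral (α : ℝ≥0∞) (hd : 1 ≤ d) {B : Set (EuclideanSpace ℝ (Fin d))}
    (hB : MeasurableSet B) {K : ℝ} (hK : 0 ≤ K) (hBK : B ⊆ Metric.closedBall 0 K)
    {s : ℝ} (hs : 0 < s)
    {S : Finset (Fin (m + 1) × Fin (m + 1))} {L : ℝ} (hL : 0 ≤ L) {v : Fin (m + 1) → ℝ}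
    (hv : ∀ a, 0 ≤ v a) :
    ENNReal.ofReal (1 - 2 * K / s) ^ d * clusterIntegral α B S L v ≤
      ENNReal.ofReal (s ^ (m * d)) * boxIntegral α B s S (s ^ d * L) v := by
  rw [boxIntegral_eq α hd hB hs hL hv, ← lintegral_const_mul' _ _ ENNReal.ofReal_ne_top]
  set I := {x : EuclideanSpace ℝ (Fin d) | ∀ k, x k ∈ Set.Icc (-(1 / 2 - K / s)) (1 / 2 - K / s)}
    with hI
  have hvol : volume I = ENNReal.ofReal (1 - 2 * K / s) ^ d := by
    rw [hI, volume_box]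
    congr 2
    ring
  have h0 : 0 ≤ K / s := by positivity
  calc _ = ∫⁻ x₀ in I, clusterIntegral α B S L v := by
        rw [setLIntegral_const, hvol, mul_comm]
    _ ≤ ∫⁻ x₀ in I, ENNReal.ofReal (s ^ (m * d)) *
        ∫⁻ x : Fin m → EuclideanSpace ℝ (Fin d) in Set.univ.pi fun _ => unitBox d,
        (Set.univ.pi fun _ => B).indicator
          (fun y => edgeProd (girgKernel α d L) S (Fin.cons 0 y) v) (s • (x - fun _ => x₀)) := by
        refine setLIntegral_mono' (measurableSet_box _ _) fun x₀ hx₀ => ?_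
        unfold clusterIntegral
        rw [← lintegral_comp_smul_sub_const hs x₀]
        refine mul_le_mul_right (le_of_eq ?_) _
        rw [← lintegral_indicator (MeasurableSet.univ_pi fun _ => measurableSet_unitBox)]
        refine lintegral_congr fun x => ?_
        by_cases hx : s • (x - fun _ => x₀) ∈ Set.univ.pi fun _ : Fin m => B
        · rw [Set.indicator_of_mem (s := Set.univ.pi fun _ : Fin m => unitBox d)]
          intro a _ k
          have h1 := hBK (hx a (Set.mem_univ _))
          rw [mem_closedBall_zero_iff, Pi.smul_apply, norm_smul, Real.norm_of_nonneg hs.le,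
            ← le_div_iff₀' hs] at h1
          have h2 := abs_le.1 ((PiLp.norm_apply_le _ k).trans h1)
          have h3 : ((x - (fun _ => x₀) : Fin m → EuclideanSpace ℝ (Fin d)) a) k =
              x a k - x₀ k := rfl
          rw [h3] at h2
          have h4 := hx₀ k
          exact ⟨by linarith [h2.1, h4.1], by linarith [h2.2, h4.2]⟩
        · rw [Set.indicator_of_notMem hx, Set.indicator_apply_eq_zero.2]
          exact fun _ => Set.indicator_of_notMem hx _
    _ ≤ _ := by
        refine lintegral_mono' (Measure.restrict_mono_set _ ?_) le_rfl
        intro x hx k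
        have := hx k
        exact ⟨by linarith [this.1], by linarith [this.2]⟩

/-! ### Convergence in probability as convergence along a filter -/

/-- The filter of the events whose probability tends to one. -/
def probFilter {Ω : ℕ → Type*} [∀ n, MeasurableSpace (Ω n)] (P : ∀ n, Measure (Ω n)) :
    Filter (Σ n, Ω n) where
  sets := {s | Tendsto (fun n => P n {ω | (⟨n, ω⟩ : Σ n, Ω n) ∉ s}) atTop (𝓝 0)}
  univ_sets := by simp
  sets_of_superset := by
    intro s t hs hst
    exact tendsto_of_tendsto_of_tendsto_of_le_of_le tendsto_const_nhds hs (fun _ => zero_le)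
      fun n => measure_mono fun ω h h' => h (hst h')
  inter_sets := by
    intro s t hs ht
    have h := Tendsto.add hs ht
    rw [add_zero] at h
    refine tendsto_of_tendsto_of_tendsto_of_le_of_le tendsto_const_nhds h (fun _ => zero_le)
      fun n => (measure_mono fun ω h => ?_).trans (measure_union_le _ _)
    by_cases h' : (⟨n, ω⟩ : Σ n, Ω n) ∈ s
    · exact Or.inr fun h'' => h ⟨h', h''⟩
    · exact Or.inl h'

section

variable {Ω : ℕ → Type*} [∀ n, MeasurableSpace (Ω n)] {P : ∀ n, Measure (Ω n)}

lemma eventually_probFilter {p : (Σ n, Ω n) → Prop} :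
    (∀ᶠ x in probFilter P, p x) ↔ Tendsto (fun n => P n {ω | ¬ p ⟨n, ω⟩}) atTop (𝓝 0) := Iff.rfl

lemma eventually_probFilter_of_ae {p : (Σ n, Ω n) → Prop} (h : ∀ n, ∀ᵐ ω ∂(P n), p ⟨n, ω⟩) :
    ∀ᶠ x in probFilter P, p x := by
  rw [eventually_probFilter]
  have : ∀ n, P n {ω | ¬ p ⟨n, ω⟩} = 0 := fun n => ae_iff.1 (h n)
  simp [this]

lemma tendsto_fst_probFilter : Tendsto (Sigma.fst : (Σ n, Ω n) → ℕ) (probFilter P) atTop := by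
  rw [tendsto_atTop]
  intro N
  rw [eventually_probFilter]
  refine tendsto_const_nhds.congr' ?_
  filter_upwards [eventually_ge_atTop N] with n hn
  simp [hn]

lemma neBot_probFilter [∀ n, IsProbabilityMeasure (P n)] : (probFilter P).NeBot := by
  refine ⟨fun h => ?_⟩
  have h1 : ∀ᶠ _x in probFilter P, False := by rw [h]; exact eventually_bot
  rw [eventually_probFilter] at h1
  simp at h1

/-- Convergence in probability becomes convergence along one filter on the disjoint union of the
sample spaces, so limit algebra and continuous mapping come from `Tendsto`. -/
lemma tendstoInProb_iff {Z : ∀ n, Ω n → ℝ} {c : ℝ} : TendstoInProb P Z c ↔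
    Tendsto (fun p : Σ n, Ω n => Z p.1 p.2) (probFilter P) (𝓝 c) := by
  simp only [Metric.tendsto_nhds, eventually_probFilter, not_lt, Real.dist_eq]
  rfl

/-- Bounded convergence for convergence in probability. -/
lemma tendsto_lintegral_of_tendsto_probFilter [∀ n, IsProbabilityMeasure (P n)]
    {Z : ∀ n, Ω n → ℝ≥0∞} (hZ : ∀ n, Measurable (Z n)) {M c : ℝ≥0∞} (hM : M ≠ ∞)
    (hZM : ∀ n, ∀ᵐ ω ∂(P n), Z n ω ≤ M) (hc : c ≠ ∞)
    (h : Tendsto (fun p : Σ n, Ω n => Z p.1 p.2) (probFilter P) (𝓝 c)) :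
    Tendsto (fun n => ∫⁻ ω, Z n ω ∂(P n)) atTop (𝓝 c) := by
  rw [ENNReal.tendsto_nhds hc]
  intro ε hε
  have hε2 : 0 < ε / 2 := ENNReal.half_pos hε.ne'
  have h1 := (ENNReal.tendsto_nhds hc).1 h (ε / 2) hε2
  rw [eventually_probFilter] at h1
  set A : ∀ n, Set (Ω n) := fun n => {ω | ¬ Z n ω ∈ Set.Icc (c - ε / 2) (c + ε / 2)} with hA
  -- On the exceptional event Z is at most M and the constant to be compared is c, so M + c covers
  -- the errors in both directions.
  have h2 : Tendsto (fun n => (M + c) * P n (A n)) atTop (𝓝 0) := by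
    have := ENNReal.Tendsto.const_mul (a := M + c) h1 (Or.inr (by finiteness))
    rwa [mul_zero] at this
  filter_upwards [h2.eventually (ge_mem_nhds hε2)] with n hn
  have hMA : M * P n (A n) ≤ ε / 2 := (mul_le_mul_left (le_add_of_nonneg_right zero_le) _).trans hn
  have hcA : c * P n (A n) ≤ ε / 2 := (mul_le_mul_left (le_add_of_nonneg_left zero_le) _).trans hn
  constructor
  · rw [tsub_le_iff_right]
    calc c ≤ ∫⁻ ω, (Z n ω + ((A n).indicator (fun _ => c) ω + ε / 2)) ∂(P n) := by
          calc c = ∫⁻ _ω, c ∂(P n) := by simp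
            _ ≤ _ := by
              refine lintegral_mono fun ω => ?_
              by_cases hω : ω ∈ A n
              · rw [Set.indicator_of_mem hω]
                exact (le_add_of_nonneg_right zero_le).trans (le_add_of_nonneg_left zero_le)
              · rw [Set.indicator_of_notMem hω, zero_add]
                exact tsub_le_iff_right.1 (not_not.1 hω).1
      _ ≤ ∫⁻ ω, Z n ω ∂(P n) + (ε / 2 + ε / 2) := by
          rw [lintegral_add_left (hZ n), lintegral_add_right _ measurable_const]
          gcongr
          · exact (lintegral_indicator_const_le _ _).trans hcA
          · simp
      _ = _ := by rw [ENNReal.add_halves]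
  · calc ∫⁻ ω, Z n ω ∂(P n) ≤ ∫⁻ ω, ((A n).indicator (fun _ => M) ω + (c + ε / 2)) ∂(P n) := by
          refine lintegral_mono_ae ?_
          filter_upwards [hZM n] with ω hω'
          by_cases hω : ω ∈ A n
          · rw [Set.indicator_of_mem hω]
            exact hω'.trans (le_add_of_nonneg_right zero_le)
          · rw [Set.indicator_of_notMem hω, zero_add]
            exact (not_not.1 hω).2
      _ ≤ ε / 2 + (c + ε / 2) := by
          rw [lintegral_add_right _ measurable_const]
          gcongr
          · exact (lintegral_indicator_const_le _ _).trans hMA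
          · simp
      _ = c + ε := by
          rw [add_comm, add_assoc, ENNReal.add_halves]

/-- A sequence which can be approximated by sequences which converge in probability converges in
probability. -/
lemma tendstoInProb_of_approx {Z : ∀ n, Ω n → ℝ} {c : ℝ}
    (h : ∀ δ : ℝ, 0 < δ → ∃ (Z' : ∀ n, Ω n → ℝ) (c' : ℝ), |c' - c| ≤ δ ∧ TendstoInProb P Z' c' ∧
      ∀ᶠ n in atTop, P n {ω | δ ≤ |Z n ω - Z' n ω|} ≤ ENNReal.ofReal δ) :
    TendstoInProb P Z c := by
  intro ε hε
  rw [ENNReal.tendsto_nhds_zero]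
  intro η hη
  obtain ⟨δ, hδ0, hδε, hδη⟩ : ∃ δ : ℝ, 0 < δ ∧ 3 * δ ≤ ε ∧ ENNReal.ofReal δ ≤ η / 2 := by
    have h1 : ∀ᶠ δ : ℝ in 𝓝[>] 0, ENNReal.ofReal δ ≤ η / 2 := by
      have : Tendsto ENNReal.ofReal (𝓝[>] (0 : ℝ)) (𝓝 0) := by
        have := (ENNReal.continuous_ofReal.tendsto 0).mono_left (nhdsWithin_le_nhds (s := Set.Ioi 0))
        rwa [ENNReal.ofReal_zero] at this
      exact this.eventually (ge_mem_nhds (ENNReal.half_pos hη.ne'))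
    have h2 : ∀ᶠ δ : ℝ in 𝓝[>] 0, δ < ε / 3 :=
      (eventually_lt_nhds (by positivity)).filter_mono nhdsWithin_le_nhds
    obtain ⟨δ, h3, h4, h5⟩ := (h1.and (h2.and self_mem_nhdsWithin)).exists
    exact ⟨δ, h5, by linarith, h3⟩
  obtain ⟨Z', c', hc, hZ', hev⟩ := h δ hδ0
  filter_upwards [hev, (ENNReal.tendsto_nhds_zero.1 (hZ' δ hδ0)) (η / 2) (ENNReal.half_pos hη.ne')]
    with n h1 h2
  calc P n {ω | ε ≤ |Z n ω - c|} ≤ P n ({ω | δ ≤ |Z n ω - Z' n ω|} ∪ {ω | δ ≤ |Z' n ω - c'|}) := by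
        refine measure_mono fun ω hω => ?_
        by_contra hcon
        simp only [Set.mem_union, Set.mem_ofPred_eq, not_or, not_le] at hcon hω
        have h3 := abs_sub_le (Z n ω) (Z' n ω) c
        have h4 := abs_sub_le (Z' n ω) c' c
        linarith [hcon.1, hcon.2]
    _ ≤ ENNReal.ofReal δ + η / 2 := (measure_union_le _ _).trans (add_le_add h1 h2)
    _ ≤ η / 2 + η / 2 := by gcongr
    _ = η := ENNReal.add_halves η

end

/-! ### Weak convergence from convergence of distribution functions -/

/-- The intervals (a, b] with endpoints in a countable dense set D of continuity points form a
π-system containing small neighbourhoods of every point, which determines weak convergence. -/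
lemma tendsto_probabilityMeasure_of_tendsto_cdf {ι : Type*} {l : Filter ι}
    {ν : ι → ProbabilityMeasure ℝ} {μ : ProbabilityMeasure ℝ}
    (h : ∀ x, ContinuousAt (cdf (μ : Measure ℝ)) x →
      Tendsto (fun i => cdf (ν i : Measure ℝ) x) l (𝓝 (cdf (μ : Measure ℝ) x))) :
    Tendsto ν l (𝓝 μ) := by
  have hcount : {x | ¬ ContinuousAt (cdf (μ : Measure ℝ)) x}.Countable :=
    (monotone_cdf (μ : Measure ℝ)).countable_not_continuousAt
  obtain ⟨D, hDsub, hDc, hDd⟩ := (hcount.dense_compl ℝ).exists_countable_dense_subset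
  have hD : ∀ x ∈ D, ContinuousAt (cdf (μ : Measure ℝ)) x := fun x hx => not_not.1 (hDsub hx)
  have : Countable D := hDc
  -- The filter `l` is arbitrary, whereas the π-system criterion is applied along a countably
  -- generated one: `F` is the coarsest filter along which the countably many values at D converge.
  let F : Filter ι := ⨅ x : D, comap (fun i => cdf (ν i : Measure ℝ) x) (𝓝 (cdf (μ : Measure ℝ) x))
  have hlF : l ≤ F := le_iInf fun x => map_le_iff_le_comap.1 (h x (hD x x.2))
  have hF : ∀ x ∈ D, Tendsto (fun i => cdf (ν i : Measure ℝ) x) F (𝓝 (cdf (μ : Measure ℝ) x)) :=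
    fun x hx => (tendsto_iff_comap.2 (iInf_le _ (⟨x, hx⟩ : D)))
  have : F.IsCountablyGenerated := by
    unfold F
    infer_instance
  refine Tendsto.mono_left ?_ hlF
  have hreal : ∀ (ρ : ProbabilityMeasure ℝ) {a b : ℝ}, a < b →
      ((ρ (Set.Ioc a b) : ℝ≥0) : ℝ) = cdf (ρ : Measure ℝ) b - cdf (ρ : Measure ℝ) a := by
    intro ρ a b hab
    rw [cdf_eq_real, cdf_eq_real, ← Set.Iic_sdiff_Iic, ←
        measureReal_sdiff (Set.Iic_subset_Iic.2 hab.le)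
      measurableSet_Iic]
    rfl
  refine (isPiSystem_Ioc_mem D D).tendsto_probabilityMeasure_of_tendsto_of_mem ?_ ?_ ?_
  · rintro s ⟨a, _, b, _, _, rfl⟩
    exact measurableSet_Ioc
  · intro u hu x hx
    obtain ⟨δ, hδ, hball⟩ := Metric.isOpen_iff.1 hu x hx
    obtain ⟨a, haD, ha⟩ := hDd.exists_between (show x - δ < x by linarith)
    obtain ⟨b, hbD, hb⟩ := hDd.exists_between (show x < x + δ by linarith)
    refine ⟨Set.Ioc a b, ⟨a, haD, b, hbD, ha.2.trans hb.1, rfl⟩, Ioc_mem_nhds ha.2 hb.1, ?_⟩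
    refine fun y hy => hball ?_
    rw [Metric.mem_ball, Real.dist_eq, abs_lt]
    exact ⟨by linarith [hy.1, ha.1], by linarith [hy.2, hb.2]⟩
  · rintro s ⟨a, ha, b, hb, hab, rfl⟩
    rw [← NNReal.tendsto_coe]
    simp_rw [hreal _ hab]
    exact (hF b hb).sub (hF a ha)

/-! ### Empirical measures -/

/-- The empirical measure of finitely many reals. -/
def empiricalMeasure {n : ℕ} (w : Fin n → ℝ) : Measure ℝ :=
  (n : ℝ≥0∞)⁻¹ • ∑ i, Measure.dirac (w i)

lemma isProbabilityMeasure_empiricalMeasure {n : ℕ} (hn : n ≠ 0) (w : Fin n → ℝ) :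
    IsProbabilityMeasure (empiricalMeasure w) := by
  refine ⟨?_⟩
  rw [empiricalMeasure, Measure.smul_apply, Measure.finsetSum_apply]
  simp only [measure_univ, Finset.sum_const, Finset.card_univ, Fintype.card_fin, smul_eq_mul,
    nsmul_eq_mul, mul_one]
  exact ENNReal.inv_mul_cancel (by exact_mod_cast hn) (by simp)

instance {n : ℕ} (w : Fin n → ℝ) : IsFiniteMeasure (empiricalMeasure w) := by
  by_cases hn : n = 0
  · subst hn
    simp only [empiricalMeasure, Finset.univ_eq_empty, Finset.sum_empty, smul_zero]
    infer_instance
  · have := isProbabilityMeasure_empiricalMeasure hn w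
    infer_instance

lemma empiricalMeasure_apply {n : ℕ} (w : Fin n → ℝ) {s : Set ℝ} (hs : MeasurableSet s) :
    empiricalMeasure w s = (n : ℝ≥0∞)⁻¹ * ∑ i, s.indicator 1 (w i) := by
  rw [empiricalMeasure, Measure.smul_apply, Measure.finsetSum_apply]
  simp [Measure.dirac_apply' _ hs]

/-- A power of an average of point masses expands into an average over all index maps τ, repetitions
included. -/
lemma pi_empiricalMeasure {n : ℕ} (w : Fin n → ℝ) (J : Type*) [Fintype J] [DecidableEq J] :
    Measure.pi (fun _ : J => empiricalMeasure w) =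
      ((n : ℝ≥0∞)⁻¹ ^ Fintype.card J) • ∑ τ : J → Fin n, Measure.dirac (w ∘ τ) := by
  refine Measure.pi_eq fun s hs => ?_
  simp_rw [empiricalMeasure_apply w (hs _)]
  rw [Finset.prod_mul_distrib, Finset.prod_const, Finset.card_univ, Finset.prod_univ_sum,
    Measure.smul_apply, Measure.finsetSum_apply, smul_eq_mul]
  congr 1
  simp only [Fintype.piFinset_univ]
  refine Finset.sum_congr rfl fun τ _ => ?_
  rw [Measure.dirac_apply' _ (MeasurableSet.univ_pi hs)]
  by_cases h : ∀ j, w (τ j) ∈ s j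
  · rw [Set.indicator_of_mem (by simpa using h)]
    exact (Finset.prod_eq_one fun j _ => Set.indicator_of_mem (h j) _).symm
  · obtain ⟨j, hj⟩ := not_forall.1 h
    rw [Set.indicator_of_notMem (fun h' : w ∘ τ ∈ Set.univ.pi s => hj (h' j (Set.mem_univ j)))]
    exact (Finset.prod_eq_zero (Finset.mem_univ j) (Set.indicator_of_notMem hj _)).symm

lemma lintegral_pi_empiricalMeasure {n : ℕ} (w : Fin n → ℝ) (J : Type*) [Fintype J] [DecidableEq J]
    {f : (J → ℝ) → ℝ≥0∞} (hf : Measurable f) :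
    ∫⁻ v, f v ∂(Measure.pi fun _ : J => empiricalMeasure w) =
      (n : ℝ≥0∞)⁻¹ ^ Fintype.card J * ∑ τ : J → Fin n, f (w ∘ τ) := by
  rw [pi_empiricalMeasure, lintegral_smul_measure, lintegral_finsetSum_measure]
  simp [lintegral_dirac' _ hf]

/-! ### Limits of cluster densities -/

/-- The expected number of clusters at the root of the infinite model. -/
def clusterDensity (α : ℝ≥0∞) {d m : ℕ} (B : Set (EuclideanSpace ℝ (Fin d)))
    (S : Finset (Fin (m + 1) × Fin (m + 1))) (μ : Measure ℝ) : ℝ≥0∞ :=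
  ∫⁻ v, clusterIntegral α B S (∫ x, x ∂μ) v ∂(Measure.pi fun _ => μ)

lemma clusterDensity_le (α : ℝ≥0∞) {d m : ℕ} {B : Set (EuclideanSpace ℝ (Fin d))}
    (hB : MeasurableSet B) (S : Finset (Fin (m + 1) × Fin (m + 1))) (μ : Measure ℝ)
    [IsProbabilityMeasure μ] : clusterDensity α B S μ ≤ volume B ^ m := by
  calc clusterDensity α B S μ ≤ ∫⁻ _v, volume B ^ m ∂(Measure.pi fun _ : Fin (m + 1) => μ) :=
        lintegral_mono fun v => clusterIntegral_le α hB S _ v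
    _ = volume B ^ m := by simp

lemma ae_pi_nonneg {μ : Measure ℝ} [SigmaFinite μ] (hμ : ∀ᵐ x ∂μ, 0 ≤ x) (J : Type*)
    [Fintype J] : ∀ᵐ v ∂(Measure.pi fun _ : J => μ), ∀ a, 0 ≤ v a := by
  rw [ae_all_iff]
  exact fun a => (Measure.quasiMeasurePreserving_eval (fun _ : J => μ) a).ae hμ

/-- Weak convergence of the weights and convergence of the normalisation imply convergence of the
averages of cluster integrals. -/
lemma tendsto_lintegral_clusterIntegral (α : ℝ≥0∞) {d m : ℕ} (hd : 1 ≤ d)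
    {B : Set (EuclideanSpace ℝ (Fin d))} (hB : MeasurableSet B) (hB' : volume B ≠ ∞)
    {S : Finset (Fin (m + 1) × Fin (m + 1))} (hS : S ⊆ potentialEdges m) {ι : Type*} {l : Filter ι}
    {ν : ι → ProbabilityMeasure ℝ} {μ : ProbabilityMeasure ℝ} (hν : Tendsto ν l (𝓝 μ))
    {L : ι → ℝ} {L₀ : ℝ} (hL : Tendsto L l (𝓝 L₀)) (hL₀ : 0 < L₀) :
    Tendsto (fun i => ∫⁻ v, clusterIntegral α B S (L i) v ∂(Measure.pi fun _ => (ν i : Measure ℝ)))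
      l (𝓝 (∫⁻ v, clusterIntegral α B S L₀ v ∂(Measure.pi fun _ => (μ : Measure ℝ)))) := by
  have hfin : ∀ L v, clusterIntegral α B S L v ≠ ∞ := fun L v =>
    ne_top_of_le_ne_top (ENNReal.pow_ne_top hB') (clusterIntegral_le α hB S L v)
  -- Continuity of the cluster integral is known only at normalisations other than 0. The maximum
  -- with L₀ / 2 yields a continuous function on the whole space and changes nothing once L exceeds
  -- L₀ / 2.
  let g : (Fin (m + 1) → ℝ) × ℝ → ℝ≥0 := fun p =>
    (clusterIntegral α B S (max p.2 (L₀ / 2)) p.1).toNNReal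
  have hg : Continuous g := by
    rw [continuous_iff_continuousAt]
    rintro ⟨v, L⟩
    refine (ENNReal.tendsto_toNNReal (hfin _ _)).comp ?_
    exact tendsto_clusterIntegral α hd hB hB' hS
      ((by fun_prop : Continuous fun p : (Fin (m + 1) → ℝ) × ℝ => max p.2 (L₀ / 2)).tendsto _)
      (continuous_fst.tendsto _) (lt_of_lt_of_le (by positivity) (le_max_right _ _)).ne'
  let f : BoundedContinuousFunction ((Fin (m + 1) → ℝ) × ℝ) ℝ≥0 :=
    BoundedContinuousFunction.mkOfBound ⟨g, hg⟩ (volume B ^ m).toReal (by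
      intro p q
      have h1 : ∀ p, (g p : ℝ) ≤ (volume B ^ m).toReal := fun p =>
        ENNReal.toReal_mono (ENNReal.pow_ne_top hB') (clusterIntegral_le α hB S _ _)
      have h2 : ∀ p, (0 : ℝ) ≤ (g p : ℝ) := fun p => (g p).2
      rw [NNReal.dist_eq, abs_le]
      constructor <;> simp only [ContinuousMap.coe_mk] <;>
        linarith [h1 p, h1 q, h2 p, h2 q])
  have hf : ∀ p : (Fin (m + 1) → ℝ) × ℝ, ((f p : ℝ≥0) : ℝ≥0∞) =
      clusterIntegral α B S (max p.2 (L₀ / 2)) p.1 := fun p => ENNReal.coe_toNNReal (hfin _ _)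
  have hmeas : Measurable fun p : (Fin (m + 1) → ℝ) × ℝ =>
      clusterIntegral α B S (max p.2 (L₀ / 2)) p.1 :=
    measurable_clusterIntegral α hB S (by fun_prop) measurable_fst
  have hpi : Tendsto (fun i => ProbabilityMeasure.pi fun _ : Fin (m + 1) => ν i) l
      (𝓝 (ProbabilityMeasure.pi fun _ : Fin (m + 1) => μ)) :=
    (ProbabilityMeasure.continuous_pi.tendsto _).comp (tendsto_pi_nhds.2 fun _ => hν)
  -- The normalisation is treated as a point mass, so that its convergence and that of the weights
  -- combine into weak convergence of one product measure.
  have hdirac : Tendsto (fun i => diracProba (L i)) l (𝓝 (diracProba L₀)) :=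
    (continuous_diracProba.tendsto _).comp hL
  have hprod : Tendsto (fun i => (ProbabilityMeasure.pi fun _ : Fin (m + 1) => ν i).prod
      (diracProba (L i))) l (𝓝 ((ProbabilityMeasure.pi fun _ : Fin (m + 1) => μ).prod
      (diracProba L₀))) :=
    (ProbabilityMeasure.continuous_prod.tendsto (_, _)).comp (hpi.prodMk_nhds hdirac)
  have hlim := (ProbabilityMeasure.tendsto_iff_forall_lintegral_tendsto.1 hprod) f
  have hval : ∀ (ρ : ProbabilityMeasure ℝ) (L : ℝ), L₀ / 2 ≤ L →
      ∫⁻ p, (f p : ℝ≥0∞) ∂(((ProbabilityMeasure.pi fun _ : Fin (m + 1) => ρ).prod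
        (diracProba L) : ProbabilityMeasure ((Fin (m + 1) → ℝ) × ℝ)) :
          Measure ((Fin (m + 1) → ℝ) × ℝ)) =
      ∫⁻ v, clusterIntegral α B S L v ∂(Measure.pi fun _ => (ρ : Measure ℝ)) := by
    intro ρ L hL
    simp_rw [hf]
    rw [ProbabilityMeasure.toMeasure_prod, ProbabilityMeasure.toMeasure_pi,
      lintegral_prod _ hmeas.aemeasurable]
    refine lintegral_congr fun v => ?_
    have : ((diracProba L : ProbabilityMeasure ℝ) : Measure ℝ) = Measure.dirac L := rfl
    rw [this, lintegral_dirac' _ (measurable_clusterIntegral α hB S (by fun_prop) measurable_const)]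
    simp only [max_eq_left hL]
  rw [hval μ L₀ (by linarith)] at hlim
  refine hlim.congr' ?_
  filter_upwards [hL.eventually (lt_mem_nhds (show L₀ / 2 < L₀ by linarith))] with i hi
  exact hval (ν i) (L i) hi.le

/-! ### The limiting weight -/

/-- The mean is the integral of the tail, and z^(1 - β) is integrable at infinity because β > 2. -/
lemma HasPowerLawTail.integrable {μ : Measure ℝ} [IsProbabilityMeasure μ] {β : ℝ} (hβ : 2 < β)
    (h : HasPowerLawTail μ β) (hμ0 : ∀ᵐ x ∂μ, 0 ≤ x) : Integrable (fun x : ℝ => x) μ := by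
  obtain ⟨c, C, t₀, hc, hC, ht₀, htail⟩ := h
  refine ⟨measurable_id.aestronglyMeasurable, ?_⟩
  rw [hasFiniteIntegral_iff_ofReal hμ0,
    lintegral_eq_lintegral_meas_lt μ hμ0 measurable_id.aemeasurable]
  have ht1 : (0 : ℝ) ≤ t₀ + 1 := by linarith
  rw [← Set.Ioc_union_Ioi_eq_Ioi ht1]
  refine (lintegral_union_le _ _ _).trans_lt (ENNReal.add_lt_top.2 ⟨?_, ?_⟩)
  · refine (setLIntegral_mono (g := fun _ => 1) measurable_const fun t _ => prob_le_one).trans_lt ?_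
    simp
  · have hint : IntegrableOn (fun t : ℝ => C * t ^ (1 - β)) (Set.Ioi (t₀ + 1)) :=
      (integrableOn_Ioi_rpow_of_lt (by linarith) (by linarith)).const_mul C
    have hnn : 0 ≤ᵐ[volume.restrict (Set.Ioi (t₀ + 1))] fun t : ℝ => C * t ^ (1 - β) := by
      filter_upwards [ae_restrict_mem measurableSet_Ioi] with t ht
      have : (0 : ℝ) < t := by linarith [Set.mem_Ioi.1 ht]
      exact mul_nonneg hC.le (Real.rpow_nonneg this.le _)
    refine lt_of_le_of_lt ?_ ((hasFiniteIntegral_iff_ofReal hnn).1 hint.2)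
    refine setLIntegral_mono' measurableSet_Ioi fun t ht => ?_
    have h1 := (htail t (by linarith [Set.mem_Ioi.1 ht])).2
    rw [← ofReal_measureReal]
    exact ENNReal.ofReal_le_ofReal h1

/-- The lower tail bound puts mass above t₀ + 1 > 0. -/
lemma HasPowerLawTail.integral_pos {μ : Measure ℝ} [IsProbabilityMeasure μ] {β : ℝ} (hβ : 2 < β)
    (h : HasPowerLawTail μ β) (hμ0 : ∀ᵐ x ∂μ, 0 ≤ x) : 0 < ∫ x, x ∂μ := by
  rw [integral_pos_iff_support_of_nonneg_ae hμ0 (h.integrable hβ hμ0)]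
  obtain ⟨c, C, t₀, hc, hC, ht₀, htail⟩ := h
  have h1 := (htail (t₀ + 1) (by linarith)).1
  have h2 : 0 < μ.real (Set.Ioi (t₀ + 1)) :=
    lt_of_lt_of_le (mul_pos hc (Real.rpow_pos_of_pos (by linarith) _)) h1
  refine lt_of_lt_of_le (ENNReal.toReal_pos_iff.1 h2).1 (measure_mono fun x hx => ?_)
  have : t₀ + 1 < x := hx
  exact (by linarith : (0 : ℝ) < x).ne'

/-! ### Convergence of the empirical weights and of averaged cluster integrals -/

section

/-- The empirical measure of the weights as a probability measure. -/
def empiricalProba {Ω : ℕ → Type*} (W : ∀ n, Ω n → Fin n → ℝ) (p : Σ n, Ω n) :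
    ProbabilityMeasure ℝ :=
  if h : p.1 = 0 then diracProba 0
  else ⟨empiricalMeasure (W p.1 p.2), isProbabilityMeasure_empiricalMeasure h _⟩

lemma coe_empiricalProba {Ω : ℕ → Type*} (W : ∀ n, Ω n → Fin n → ℝ) {p : Σ n, Ω n} (hp : p.1 ≠ 0) :
    (empiricalProba W p : Measure ℝ) = empiricalMeasure (W p.1 p.2) := by
  have : empiricalProba W p =
      ⟨empiricalMeasure (W p.1 p.2), isProbabilityMeasure_empiricalMeasure hp _⟩ := dif_neg hp
  rw [this]
  rfl

variable {Ω : ℕ → Type*} [∀ n, MeasurableSpace (Ω n)] {P : ∀ n, Measure (Ω n)}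

lemma tendsto_empiricalProba {μ : ProbabilityMeasure ℝ} {W : ∀ n, Ω n → Fin n → ℝ}
    (hW : ∀ x : ℝ, ContinuousAt (cdf (μ : Measure ℝ)) x →
      TendstoInProb P (fun n ω => ({i : Fin n | W n ω i ≤ x}.ncard : ℝ) / n)
        (cdf (μ : Measure ℝ) x)) :
    Tendsto (empiricalProba W) (probFilter P) (𝓝 μ) := by
  refine tendsto_probabilityMeasure_of_tendsto_cdf fun x hx => ?_
  refine (tendstoInProb_iff.1 (hW x hx)).congr' ?_
  -- For n = 0 an arbitrary point mass stands for the empirical measure; the filter ignores it.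
  filter_upwards [tendsto_fst_probFilter.eventually (eventually_ne_atTop 0)] with p hp
  rw [coe_empiricalProba W hp]
  have := isProbabilityMeasure_empiricalMeasure hp (W p.1 p.2)
  classical
  rw [cdf_eq_real, measureReal_def, empiricalMeasure_apply _ measurableSet_Iic, ENNReal.toReal_mul,
    ENNReal.toReal_inv, ENNReal.toReal_natCast, div_eq_inv_mul, Set.ncard_eq_toFinset_card']
  congr 1
  simp only [Set.indicator_apply, Set.mem_Iic, Pi.one_apply, Finset.sum_boole]
  rw [ENNReal.toReal_natCast]
  congr 2
  ext i
  simp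

lemma setOf_not_nonneg : {x : ℝ | ¬ 0 ≤ x} = Set.Iio 0 := by ext; simp

lemma ae_empiricalMeasure_nonneg {n : ℕ} {w : Fin n → ℝ} (hw : ∀ i, 0 ≤ w i) :
    ∀ᵐ x ∂(empiricalMeasure w), 0 ≤ x := by
  rw [ae_iff, setOf_not_nonneg, empiricalMeasure_apply _ measurableSet_Iio]
  simp [hw]

lemma eventually_empiricalProba_nonneg {W : ∀ n, Ω n → Fin n → ℝ}
    (hW0 : ∀ n, ∀ᵐ ω ∂(P n), ∀ i, 0 ≤ W n ω i) :
    ∀ᶠ p in probFilter P, ∀ᵐ x ∂(empiricalProba W p : Measure ℝ), 0 ≤ x := by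
  filter_upwards [tendsto_fst_probFilter.eventually (eventually_ne_atTop 0),
    eventually_probFilter_of_ae (p := fun p => ∀ i, 0 ≤ W p.1 p.2 i) hW0] with p hp hp'
  rw [coe_empiricalProba W hp]
  exact ae_empiricalMeasure_nonneg hp'

/-- The portmanteau inequality for the open half-line (-∞, 0), which almost surely carries no
empirical mass. -/
lemma ae_nonneg_of_tendsto_empiricalProba [∀ n, IsProbabilityMeasure (P n)]
    {μ : ProbabilityMeasure ℝ} {W : ∀ n, Ω n → Fin n → ℝ}
    (hW0 : ∀ n, ∀ᵐ ω ∂(P n), ∀ i, 0 ≤ W n ω i)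
    (hW : Tendsto (empiricalProba W) (probFilter P) (𝓝 μ)) : ∀ᵐ x ∂(μ : Measure ℝ), 0 ≤ x := by
  have : (probFilter P).NeBot := neBot_probFilter
  have h1 := ProbabilityMeasure.le_liminf_measure_open_of_tendsto hW (isOpen_Iio (a := (0 : ℝ)))
  have h2 : Tendsto (fun p => (empiricalProba W p : Measure ℝ) (Set.Iio 0)) (probFilter P)
      (𝓝 0) := by
    refine tendsto_const_nhds.congr' ?_
    filter_upwards [eventually_empiricalProba_nonneg hW0] with p hp
    rw [ae_iff, setOf_not_nonneg] at hp
    exact hp.symm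
  rw [h2.liminf_eq] at h1
  rw [ae_iff, setOf_not_nonneg]
  simpa using h1

/-- The average of the cluster integrals over all tuples of vertices. -/
def clusterAverage (α : ℝ≥0∞) {d m : ℕ} (B : Set (EuclideanSpace ℝ (Fin d)))
    (S : Finset (Fin (m + 1) × Fin (m + 1))) {n : ℕ} (w : Fin n → ℝ) : ℝ≥0∞ :=
  (n : ℝ≥0∞)⁻¹ ^ (m + 1) * ∑ τ : Fin (m + 1) → Fin n,
    clusterIntegral α B S ((∑ k, w k) / n) (w ∘ τ)

lemma measurable_clusterAverage (α : ℝ≥0∞) {d m : ℕ} {B : Set (EuclideanSpace ℝ (Fin d))}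
    (hB : MeasurableSet B) (S : Finset (Fin (m + 1) × Fin (m + 1))) {n : ℕ} :
    Measurable fun w : Fin n → ℝ => clusterAverage α B S w := by
  unfold clusterAverage
  refine Measurable.const_mul (Finset.measurable_sum _ fun τ _ => ?_) _
  exact measurable_clusterIntegral α hB S (by fun_prop)
    (measurable_pi_lambda _ fun a => measurable_pi_apply _)

/-- Because all tuples are averaged, also those with repetitions, the average is exactly an integral
against a power of the empirical measure, to which weak convergence applies. -/
lemma clusterAverage_eq (α : ℝ≥0∞) {d m : ℕ} {B : Set (EuclideanSpace ℝ (Fin d))}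
    (hB : MeasurableSet B) (S : Finset (Fin (m + 1) × Fin (m + 1))) {n : ℕ} (w : Fin n → ℝ) :
    clusterAverage α B S w = ∫⁻ v, clusterIntegral α B S ((∑ k, w k) / n) v
      ∂(Measure.pi fun _ => empiricalMeasure w) := by
  rw [lintegral_pi_empiricalMeasure, Fintype.card_fin, clusterAverage]
  exact measurable_clusterIntegral α hB S measurable_const measurable_id

lemma clusterAverage_le (α : ℝ≥0∞) {d m : ℕ} {B : Set (EuclideanSpace ℝ (Fin d))}
    (hB : MeasurableSet B) (S : Finset (Fin (m + 1) × Fin (m + 1))) {n : ℕ} (w : Fin n → ℝ) :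
    clusterAverage α B S w ≤ volume B ^ m := by
  by_cases hn : n = 0
  · subst hn
    unfold clusterAverage
    simp
  · have := isProbabilityMeasure_empiricalMeasure hn w
    rw [clusterAverage_eq α hB]
    refine (lintegral_mono fun v => clusterIntegral_le α hB S _ v).trans ?_
    simp

lemma tendsto_clusterAverage (α : ℝ≥0∞) {d m : ℕ} (hd : 1 ≤ d)
    {B : Set (EuclideanSpace ℝ (Fin d))} (hB : MeasurableSet B) (hB' : volume B ≠ ∞)
    {S : Finset (Fin (m + 1) × Fin (m + 1))} (hS : S ⊆ potentialEdges m)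
    {μ : ProbabilityMeasure ℝ} {W : ∀ n, Ω n → Fin n → ℝ}
    (hW : Tendsto (empiricalProba W) (probFilter P) (𝓝 μ))
    (hmean : TendstoInProb P (fun n ω => (∑ i, W n ω i) / n) (∫ x, x ∂(μ : Measure ℝ)))
    (hpos : 0 < ∫ x, x ∂(μ : Measure ℝ)) :
    Tendsto (fun p : Σ n, Ω n => clusterAverage α B S (W p.1 p.2)) (probFilter P)
      (𝓝 (clusterDensity α B S (μ : Measure ℝ))) := by
  have h := tendsto_lintegral_clusterIntegral α hd hB hB' hS hW
    (tendstoInProb_iff.1 hmean) hpos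
  refine h.congr' ?_
  filter_upwards [tendsto_fst_probFilter.eventually (eventually_ne_atTop 0)] with p hp
  rw [coe_empiricalProba W hp, clusterAverage_eq α hB]

end

/-! ### Integration over the edges of a spatial graph -/

open scoped Classical in
/-- The edges between the values of `t` which are listed in `S` are present. -/
def edgeInd {V J : Type*} (G : SimpleGraph V) (S : Finset (J × J)) (t : J → V) : ℝ≥0∞ :=
  if ∀ e ∈ S, G.Adj (t e.1) (t e.2) then 1 else 0

lemma setOf_edges_eq {Ω ι J : Type*} (G : Ω → SimpleGraph ι) (S : Finset (J × J)) (t : J → ι) :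
    {ω | ∀ e ∈ S, (G ω).Adj (t e.1) (t e.2)} =
      ⋂ e ∈ S, {ω | (G ω).Adj (t e.1) (t e.2)} := by
  ext; simp

lemma IsSIRG.measurableSet_edges {Ω : Type*} [MeasurableSpace Ω] {P : Measure Ω} {d : ℕ}
    {ι J : Type*} [LinearOrder ι] {X : Ω → ι → EuclideanSpace ℝ (Fin d)} {W : Ω → ι → ℝ}
    {κ : Ω → ℝ → ℝ → ℝ → ℝ} {G : Ω → SimpleGraph ι} (h : IsSIRG P X W κ G) (S : Finset (J × J))
    (t : J → ι) : MeasurableSet {ω | ∀ e ∈ S, (G ω).Adj (t e.1) (t e.2)} := by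
  rw [setOf_edges_eq]
  exact Finset.measurableSet_biInter S fun e _ => h.measurableSet_adj _ _

lemma IsSIRG.measurable_edgeInd {Ω : Type*} [MeasurableSpace Ω] {P : Measure Ω} {d : ℕ}
    {ι J : Type*} [LinearOrder ι] {X : Ω → ι → EuclideanSpace ℝ (Fin d)} {W : Ω → ι → ℝ}
    {κ : Ω → ℝ → ℝ → ℝ → ℝ} {G : Ω → SimpleGraph ι} (h : IsSIRG P X W κ G) (S : Finset (J × J))
    (t : J → ι) : Measurable fun ω => edgeInd (G ω) S t :=
  Measurable.ite (h.measurableSet_edges S t) measurable_const measurable_const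

/-- The restriction of P to A and the measure whose density is the conditional probability of A
agree on the σ-algebra m. Comparing measures avoids any integrability of f. -/
lemma lintegral_indicator_mul_of_condExp_eq {Ω : Type*} {m mΩ : MeasurableSpace Ω} (hm : m ≤ mΩ)
    {P : Measure Ω} [IsFiniteMeasure P] {A : Set Ω} (hA : MeasurableSet A) {g : Ω → ℝ}
    (hg : P⟦A | m⟧ =ᵐ[P] g) {f : Ω → ℝ≥0∞} (hf : Measurable[m] f) :
    ∫⁻ ω, f ω * A.indicator 1 ω ∂P = ∫⁻ ω, f ω * ENNReal.ofReal (g ω) ∂P := by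
  obtain ⟨q, hq'⟩ : ∃ q, q = P⟦A | m⟧ := ⟨_, rfl⟩
  have hqm : StronglyMeasurable[m] q := hq' ▸ stronglyMeasurable_condExp
  have hqi : Integrable q P := hq' ▸ integrable_condExp
  have hq : Measurable fun ω => ENNReal.ofReal (q ω) :=
    ENNReal.measurable_ofReal.comp (hqm.measurable.mono hm le_rfl)
  have hnn : 0 ≤ᵐ[P] q :=
    hq' ▸ condExp_nonneg (Eventually.of_forall fun ω =>
        Set.indicator_nonneg (fun _ _ => zero_le_one) ω)
  have hmeas : (P.restrict A).trim hm =
      (P.withDensity fun ω => ENNReal.ofReal (q ω)).trim hm := by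
    refine @Measure.ext _ m _ _ fun s hs => ?_
    rw [trim_measurableSet_eq hm hs, trim_measurableSet_eq hm hs,
      withDensity_apply _ (hm s hs), ← ofReal_integral_eq_lintegral_ofReal
        hqi.integrableOn (ae_restrict_of_ae hnn),
      hq', setIntegral_condExp hm ((integrable_const (1 : ℝ)).indicator hA) hs,
      setIntegral_indicator hA, setIntegral_const, smul_eq_mul, mul_one, ofReal_measureReal,
      Measure.restrict_apply (hm s hs)]
  calc ∫⁻ ω, f ω * A.indicator 1 ω ∂P = ∫⁻ ω in A, f ω ∂P := by
        rw [← lintegral_indicator hA]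
        refine lintegral_congr fun ω => ?_
        by_cases hω : ω ∈ A <;> simp [hω]
    _ = ∫⁻ ω, f ω ∂(P.withDensity fun ω => ENNReal.ofReal (q ω)) := by
        rw [← lintegral_trim hm hf, hmeas, lintegral_trim hm hf]
    _ = ∫⁻ ω, f ω * ENNReal.ofReal (q ω) ∂P := by
        rw [lintegral_withDensity_eq_lintegral_mul _ hq (hf.mono hm le_rfl)]
        exact lintegral_congr fun ω => mul_comm _ _
    _ = ∫⁻ ω, f ω * ENNReal.ofReal (g ω) ∂P := by
        refine lintegral_congr_ae ?_
        filter_upwards [hg] with ω hω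
        rw [hq', hω]

/-- Integration over the edges: the edge indicators may be replaced by connection probabilities. -/
lemma IsSIRG.lintegral_edgeInd {Ω : Type*} [MeasurableSpace Ω] {P : Measure Ω} [IsFiniteMeasure P]
    {d : ℕ} {ι J : Type*} [LinearOrder ι] {X : Ω → ι → EuclideanSpace ℝ (Fin d)} {W : Ω → ι → ℝ}
    {κ : Ω → ℝ → ℝ → ℝ → ℝ} {G : Ω → SimpleGraph ι} (h : IsSIRG P X W κ G)
    (hκ : ∀ᵐ ω ∂P, ∀ i j, 0 ≤ κ ω ‖X ω i - X ω j‖ (W ω i) (W ω j))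
    (hcomm : ∀ ω t x y, κ ω t x y = κ ω t y x) {t : J → ι} (ht : Function.Injective t)
    {S : Finset (J × J)} (hS : ∀ e ∈ S, e.1 ≠ e.2 ∧ e.swap ∉ S)
    {f : (ι → EuclideanSpace ℝ (Fin d)) × (ι → ℝ) → ℝ≥0∞} (hf : Measurable f) :
    ∫⁻ ω, f (X ω, W ω) * edgeInd (G ω) S t ∂P =
      ∫⁻ ω, f (X ω, W ω) * edgeProd (κ ω) S (fun j => X ω (t j)) (fun j => W ω (t j)) ∂P := by
  classical
  -- The product formula lists each edge with its smaller end first, so the pairs along t are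
  -- sorted. As S contains no pair together with its swap, sorting is injective on S and no factor
  -- of the product is lost.
  let σ : J × J → ι × ι := fun e => (min (t e.1) (t e.2), max (t e.1) (t e.2))
  have hσ : ∀ e, σ e = (t e.1, t e.2) ∨ σ e = (t e.2, t e.1) := fun e => by
    rcases le_total (t e.1) (t e.2) with h' | h' <;> simp [σ, h']
  have hinj : Set.InjOn σ S := by
    intro e he e' he' hee
    rcases hσ e with h1 | h1 <;> rcases hσ e' with h2 | h2 <;> rw [h1, h2, Prod.mk.injEq] at hee
    · exact Prod.ext (ht hee.1) (ht hee.2)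
    · exfalso
      have : e.swap = e' := Prod.ext (ht hee.2) (ht hee.1)
      exact (hS e he).2 (this ▸ he')
    · exfalso
      have : e.swap = e' := Prod.ext (ht hee.1) (ht hee.2)
      exact (hS e he).2 (this ▸ he')
    · exact Prod.ext (ht hee.2) (ht hee.1)
  have hT : ∀ e ∈ S.image σ, e.1 < e.2 := by
    intro e he
    obtain ⟨e', he', rfl⟩ := Finset.mem_image.1 he
    exact min_lt_max.2 fun h' => (hS e' he').1 (ht h')
  have hadj : ∀ ω, (∀ e ∈ S.image σ, (G ω).Adj e.1 e.2) ↔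
      ∀ e ∈ S, (G ω).Adj (t e.1) (t e.2) := by
    intro ω
    rw [Finset.forall_mem_image]
    refine forall₂_congr fun e _ => ?_
    rcases hσ e with h1 | h1 <;> rw [h1]
    exact (G ω).adj_comm _ _
  have hcond := h.condProb_edges (S.image σ) hT
  simp_rw [hadj] at hcond
  have hm : MeasurableSpace.comap X inferInstance ⊔ MeasurableSpace.comap W inferInstance ≤
      (inferInstance : MeasurableSpace Ω) :=
    sup_le h.measurable_location.comap_le h.measurable_weight.comap_le
  have hfm : Measurable[MeasurableSpace.comap X inferInstance ⊔
      MeasurableSpace.comap W inferInstance] fun ω => f (X ω, W ω) := by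
    refine hf.comp (Measurable.prodMk ?_ ?_)
    · exact (comap_measurable X).mono le_sup_left le_rfl
    · exact (comap_measurable W).mono le_sup_right le_rfl
  have key := lintegral_indicator_mul_of_condExp_eq hm (h.measurableSet_edges S t) hcond hfm
  have e1 : ∀ ω, edgeInd (G ω) S t =
      {ω | ∀ e ∈ S, (G ω).Adj (t e.1) (t e.2)}.indicator 1 ω := by
    intro ω
    by_cases hω : ∀ e ∈ S, (G ω).Adj (t e.1) (t e.2)
    · rw [Set.indicator_of_mem (by exact hω), edgeInd, if_pos hω]; rfl
    · rw [Set.indicator_of_notMem (by exact hω), edgeInd, if_neg hω]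
  simp_rw [e1]
  rw [key]
  refine lintegral_congr_ae ?_
  filter_upwards [hκ] with ω hω
  rw [Finset.prod_image hinj, ENNReal.ofReal_prod_of_nonneg fun e _ => hω _ _, edgeProd]
  congr 1
  refine Finset.prod_congr rfl fun e _ => ?_
  rcases hσ e with h1 | h1 <;> rw [h1]
  rw [norm_sub_rev, hcomm]

/-! ### Locations and weights of finite GIRGs -/

variable {Ω : Type*} [MeasurableSpace Ω] {P : Measure Ω} {α : ℝ≥0∞}
  {d n : ℕ} {X : Ω → Fin n → EuclideanSpace ℝ (Fin d)} {W : Ω → Fin n → ℝ}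
  {G : Ω → SimpleGraph (Fin n)}

/-- The uniform distribution on the unit box. -/
def boxMeasure (d : ℕ) : Measure (EuclideanSpace ℝ (Fin d)) := volume.restrict (unitBox d)

instance : IsProbabilityMeasure (boxMeasure d) :=
  ⟨by rw [boxMeasure, Measure.restrict_apply_univ, volume_unitBox]⟩

lemma IsGIRG.map_location (h : IsGIRG P α d n X W G) (i : Fin n) :
    P.map (fun ω => X ω i) = boxMeasure d := by
  have := h.uniform_location i
  rw [pdf.IsUniform, ProbabilityTheory.cond, volume_unitBox, inv_one, one_smul] at this
  exact this

/-- Only the locations of the tuple are integrated out. The full weight vector stays, since the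
kernel depends on the total weight. -/
lemma IsGIRG.lintegral_locations [IsProbabilityMeasure P] (h : IsGIRG P α d n X W G) {J : Type*}
    [Fintype J] {t : J → Fin n} (ht : Function.Injective t)
    {f : (J → EuclideanSpace ℝ (Fin d)) → (Fin n → ℝ) → ℝ≥0∞}
        (hf : Measurable (Function.uncurry f)) :
    ∫⁻ ω, f (fun j => X ω (t j)) (W ω) ∂P =
      ∫⁻ ω, ∫⁻ x, f x (W ω) ∂(Measure.pi fun _ => boxMeasure d) ∂P := by
  have hX : ∀ i, Measurable fun ω => X ω i := fun i =>
    (measurable_pi_apply i).comp h.isSIRG.measurable_location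
  have hXt : Measurable fun ω => fun j => X ω (t j) := measurable_pi_lambda _ fun j => hX _
  have hlaw : P.map (fun ω => fun j => X ω (t j)) = Measure.pi fun _ : J => boxMeasure d := by
    have h1 := h.indep_locations.precomp ht
    rw [iIndepFun_iff_map_fun_eq_pi_map fun j => (hX _).aemeasurable] at h1
    rw [h1]
    congr 1
    ext1 j
    exact h.map_location _
  have hind : IndepFun (fun ω => fun j => X ω (t j)) W P :=
    h.indep_location_weight.comp (φ := fun x : Fin n → EuclideanSpace ℝ (Fin d) => fun j => x (t j))
      (ψ := id) (measurable_pi_lambda _ fun j => measurable_pi_apply _) measurable_id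
  rw [indepFun_iff_map_prod_eq_prod_map_map hXt.aemeasurable
    h.isSIRG.measurable_weight.aemeasurable, hlaw] at hind
  have hW := h.isSIRG.measurable_weight
  have hmap : IsProbabilityMeasure (P.map W) := Measure.isProbabilityMeasure_map hW.aemeasurable
  calc ∫⁻ ω, f (fun j => X ω (t j)) (W ω) ∂P
      = ∫⁻ p, Function.uncurry f p ∂(P.map fun ω => (fun j => X ω (t j), W ω)) :=
        (lintegral_map hf (hXt.prodMk hW)).symm
    _ = ∫⁻ w, ∫⁻ x, f x w ∂(Measure.pi fun _ => boxMeasure d) ∂(P.map W) := by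
        rw [hind, lintegral_prod_symm _ hf.aemeasurable]
        rfl
    _ = _ := lintegral_map (hf.lintegral_prod_left') hW

/-! ### Moments of cluster counts in finite GIRGs -/

open scoped Classical in
/-- The vertices in the tuple `τ` are distinct, close to the first one (after scaling by `s`), and
connected by the edges listed in `S`. -/
def clusterInd {V : Type*} {d m : ℕ} (G : SimpleGraph V) (x : V → EuclideanSpace ℝ (Fin d)) (s : ℝ)
    (B : Set (EuclideanSpace ℝ (Fin d))) (S : Finset (Fin (m + 1) × Fin (m + 1)))
    (τ : Fin (m + 1) → V) : ℝ≥0∞ :=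
  if Function.Injective τ ∧ ∀ a : Fin m, s • (x (τ a.succ) - x (τ 0)) ∈ B then edgeInd G S τ else 0

/-- The indicator of the set of close tuples of locations. -/
def closeInd {d m : ℕ} (s : ℝ) (B : Set (EuclideanSpace ℝ (Fin d)))
    (x : Fin (m + 1) → EuclideanSpace ℝ (Fin d)) : ℝ≥0∞ :=
  {x : Fin (m + 1) → EuclideanSpace ℝ (Fin d) | ∀ a : Fin m, s • (x a.succ - x 0) ∈ B}.indicator 1 x

lemma measurable_closeInd {d m : ℕ} {B : Set (EuclideanSpace ℝ (Fin d))} (hB : MeasurableSet B)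
    (s : ℝ) : Measurable (closeInd (m := m) s B) :=
  measurable_one.indicator (measurableSet_close hB s)

lemma clusterInd_eq {V : Type*} {d m : ℕ} (G : SimpleGraph V) (x : V → EuclideanSpace ℝ (Fin d))
    (s : ℝ) (B : Set (EuclideanSpace ℝ (Fin d))) (S : Finset (Fin (m + 1) × Fin (m + 1)))
    {τ : Fin (m + 1) → V} (hτ : Function.Injective τ) :
    clusterInd G x s B S τ = closeInd s B (fun a => x (τ a)) * edgeInd G S τ := by
  unfold clusterInd closeInd
  by_cases h : ∀ a : Fin m, s • (x (τ a.succ) - x (τ 0)) ∈ B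
  · rw [if_pos ⟨hτ, h⟩, Set.indicator_of_mem (by exact h)]
    simp
  · rw [if_neg fun h' => h h'.2, Set.indicator_of_notMem (by exact h)]
    simp

lemma clusterInd_of_not_injective {V : Type*} {d m : ℕ} (G : SimpleGraph V)
    (x : V → EuclideanSpace ℝ (Fin d)) (s : ℝ) (B : Set (EuclideanSpace ℝ (Fin d)))
    (S : Finset (Fin (m + 1) × Fin (m + 1)))
    {τ : Fin (m + 1) → V} (hτ : ¬ Function.Injective τ) : clusterInd G x s B S τ = 0 :=
  if_neg fun h => hτ h.1

lemma boxIntegral_eq_lintegral (α : ℝ≥0∞) {d m : ℕ} (B : Set (EuclideanSpace ℝ (Fin d))) (s : ℝ)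
    (S : Finset (Fin (m + 1) × Fin (m + 1))) (L : ℝ) (v : Fin (m + 1) → ℝ) :
    boxIntegral α B s S L v = ∫⁻ x : Fin (m + 1) → EuclideanSpace ℝ (Fin d),
      closeInd s B x * edgeProd (girgKernel α d L) S x v ∂(Measure.pi fun _ => boxMeasure d) := by
  unfold boxIntegral closeInd
  refine lintegral_congr fun x => ?_
  by_cases h : x ∈ {x : Fin (m + 1) → EuclideanSpace ℝ (Fin d) |
    ∀ a : Fin m, s • (x a.succ - x 0) ∈ B}
  · rw [Set.indicator_of_mem h, Set.indicator_of_mem h]; simp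
  · rw [Set.indicator_of_notMem h, Set.indicator_of_notMem h]; simp

lemma ne_and_swap_notMem_of_subset_potentialEdges {m : ℕ} {S : Finset (Fin (m + 1) × Fin (m + 1))}
    (hS : S ⊆ potentialEdges m) : ∀ e ∈ S, e.1 ≠ e.2 ∧ e.swap ∉ S := by
  intro e he
  have h1 : e.1 < e.2 := (Finset.mem_filter.1 (hS he)).2
  refine ⟨h1.ne, fun h => ?_⟩
  have h2 : e.2 < e.1 := (Finset.mem_filter.1 (hS h)).2
  exact lt_asymm h1 h2

section

variable {Ω : Type*} [MeasurableSpace Ω] {P : Measure Ω} {α : ℝ≥0∞}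
  {d n : ℕ} {X : Ω → Fin n → EuclideanSpace ℝ (Fin d)} {W : Ω → Fin n → ℝ}
  {G : Ω → SimpleGraph (Fin n)}

lemma IsGIRG.girgKernel_nonneg (h : IsGIRG P α d n X W G) :
    ∀ᵐ ω ∂P, ∀ i j, 0 ≤ girgKernel α d (∑ k, W ω k) ‖X ω i - X ω j‖ (W ω i) (W ω j) := by
  filter_upwards [h.weight_nonneg] with ω hω i j
  exact SpatialGraph.girgKernel_nonneg α d
    (div_nonneg (mul_nonneg (hω i) (hω j)) (Finset.sum_nonneg fun k _ => hω k)) (norm_nonneg _)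

lemma IsGIRG.measurable_clusterInd (h : IsGIRG P α d n X W G) {m : ℕ}
    {B : Set (EuclideanSpace ℝ (Fin d))} (hB : MeasurableSet B) (s : ℝ)
    (S : Finset (Fin (m + 1) × Fin (m + 1))) (τ : Fin (m + 1) → Fin n) :
    Measurable fun ω => clusterInd (G ω) (X ω) s B S τ := by
  by_cases hτ : Function.Injective τ
  · simp_rw [clusterInd_eq _ _ _ _ _ hτ]
    refine Measurable.mul ((measurable_closeInd hB s).comp ?_) (h.isSIRG.measurable_edgeInd S τ)
    exact measurable_pi_lambda _ fun a =>
      (measurable_pi_apply (τ a)).comp h.isSIRG.measurable_location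
  · simp_rw [clusterInd_of_not_injective _ _ _ _ _ hτ]
    exact measurable_const

/-- The edges are integrated first, then the locations. The factor ψ(W) leaves room for a truncation
of the mean weight, needed for long edges. -/
lemma IsGIRG.lintegral_clusterInd [IsProbabilityMeasure P] (h : IsGIRG P α d n X W G) {m : ℕ}
    {B : Set (EuclideanSpace ℝ (Fin d))} (hB : MeasurableSet B) (s : ℝ)
    {S : Finset (Fin (m + 1) × Fin (m + 1))} (hS : S ⊆ potentialEdges m)
    {τ : Fin (m + 1) → Fin n} (hτ : Function.Injective τ) {ψ : (Fin n → ℝ) → ℝ≥0∞}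
    (hψ : Measurable ψ) :
    ∫⁻ ω, ψ (W ω) * clusterInd (G ω) (X ω) s B S τ ∂P =
      ∫⁻ ω, ψ (W ω) * boxIntegral α B s S (∑ k, W ω k) (fun a => W ω (τ a)) ∂P := by
  simp_rw [clusterInd_eq _ _ _ _ _ hτ, ← mul_assoc]
  have h1 := h.isSIRG.lintegral_edgeInd h.girgKernel_nonneg
    (fun ω t x y => girgKernel_comm α d _ t x y) hτ
    (ne_and_swap_notMem_of_subset_potentialEdges hS)
    (f := fun p => ψ p.2 * closeInd s B fun a => p.1 (τ a))
    ((hψ.comp measurable_snd).mul ((measurable_closeInd hB s).comp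
      (measurable_pi_lambda _ fun a => (measurable_pi_apply (τ a)).comp measurable_fst)))
  rw [h1]
  have h2 := h.lintegral_locations hτ (f := fun x w => ψ w * closeInd s B x *
      edgeProd (girgKernel α d (∑ k, w k)) S x fun a => w (τ a)) (by
    refine ((hψ.comp measurable_snd).mul ((measurable_closeInd hB s).comp measurable_fst)).mul ?_
    exact measurable_edgeProd α S (by fun_prop) measurable_fst
      (measurable_pi_lambda _ fun a => (measurable_pi_apply (τ a)).comp measurable_snd))
  rw [h2]
  refine lintegral_congr fun ω => ?_
  simp_rw [mul_assoc]
  rw [lintegral_const_mul, boxIntegral_eq_lintegral]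
  exact (measurable_closeInd hB s).mul
    (measurable_edgeProd α S measurable_const measurable_id measurable_const)

/-- Two copies of a set of potential edges. -/
def doubleEdges {J : Type*} (S : Finset (J × J)) : Finset ((J ⊕ J) × (J ⊕ J)) :=
  (S.map (Function.Embedding.prodMap Function.Embedding.inl Function.Embedding.inl)).disjUnion
    (S.map (Function.Embedding.prodMap Function.Embedding.inr Function.Embedding.inr)) (by
      rw [Finset.disjoint_left]
      intro e he he'
      obtain ⟨a, _, rfl⟩ := Finset.mem_map.1 he
      obtain ⟨b, _, hb⟩ := Finset.mem_map.1 he'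
      exact Sum.inr_ne_inl (congrArg Prod.fst hb))

/-- Indexing two clusters by J ⊕ J makes a pair of clusters a single one, to which the same
integration lemmas apply. -/
lemma edgeInd_doubleEdges {V J : Type*} (G : SimpleGraph V) (S : Finset (J × J)) (t t' : J → V) :
    edgeInd G (doubleEdges S) (Sum.elim t t') = edgeInd G S t * edgeInd G S t' := by
  classical
  have : (∀ e ∈ doubleEdges S, G.Adj (Sum.elim t t' e.1) (Sum.elim t t' e.2)) ↔
      (∀ e ∈ S, G.Adj (t e.1) (t e.2)) ∧ ∀ e ∈ S, G.Adj (t' e.1) (t' e.2) := by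
    constructor
    · intro h
      exact ⟨fun e he => h (Sum.inl e.1, Sum.inl e.2) (Finset.mem_disjUnion.2 (Or.inl
        (Finset.mem_map.2 ⟨e, he, rfl⟩))), fun e he => h (Sum.inr e.1, Sum.inr e.2)
        (Finset.mem_disjUnion.2 (Or.inr (Finset.mem_map.2 ⟨e, he, rfl⟩)))⟩
    · rintro ⟨h1, h2⟩ e he
      rcases Finset.mem_disjUnion.1 he with he | he
      · obtain ⟨e', he', rfl⟩ := Finset.mem_map.1 he
        exact h1 e' he'
      · obtain ⟨e', he', rfl⟩ := Finset.mem_map.1 he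
        exact h2 e' he'
  unfold edgeInd
  by_cases h1 : ∀ e ∈ S, G.Adj (t e.1) (t e.2)
  · by_cases h2 : ∀ e ∈ S, G.Adj (t' e.1) (t' e.2)
    · rw [if_pos (this.2 ⟨h1, h2⟩), if_pos h1, if_pos h2, one_mul]
    · rw [if_neg fun h => h2 (this.1 h).2, if_neg h2, mul_zero]
  · rw [if_neg fun h => h1 (this.1 h).1, if_neg h1, zero_mul]

lemma edgeProd_doubleEdges {J : Type*} (κ : ℝ → ℝ → ℝ → ℝ) (S : Finset (J × J))
    (x : J ⊕ J → EuclideanSpace ℝ (Fin d)) (w : J ⊕ J → ℝ) :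
    edgeProd κ (doubleEdges S) x w =
      edgeProd κ S (fun j => x (Sum.inl j)) (fun j => w (Sum.inl j)) *
        edgeProd κ S (fun j => x (Sum.inr j)) (fun j => w (Sum.inr j)) := by
  rw [edgeProd, doubleEdges, Finset.prod_disjUnion, Finset.prod_map, Finset.prod_map]
  rfl

lemma ne_and_swap_notMem_doubleEdges {J : Type*} {S : Finset (J × J)}
    (hS : ∀ e ∈ S, e.1 ≠ e.2 ∧ e.swap ∉ S) :
    ∀ e ∈ doubleEdges S, e.1 ≠ e.2 ∧ e.swap ∉ doubleEdges S := by
  intro e he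
  rcases Finset.mem_disjUnion.1 he with he | he
  · obtain ⟨⟨a, b⟩, hab, rfl⟩ := Finset.mem_map.1 he
    refine ⟨fun h => (hS _ hab).1 (Sum.inl_injective h), fun h => ?_⟩
    rcases Finset.mem_disjUnion.1 h with h | h
    · obtain ⟨⟨a', b'⟩, he', h'⟩ := Finset.mem_map.1 h
      simp only [Function.Embedding.prodMap, Function.Embedding.coeFn_mk, Prod.map_apply,
        Function.Embedding.inl_apply, Prod.swap_prod_mk, Prod.mk.injEq, Sum.inl.injEq] at h'
      obtain ⟨rfl, rfl⟩ := h'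
      exact (hS _ hab).2 he'
    · obtain ⟨⟨a', b'⟩, he', h'⟩ := Finset.mem_map.1 h
      exact absurd (congrArg Prod.fst h') Sum.inr_ne_inl
  · obtain ⟨⟨a, b⟩, hab, rfl⟩ := Finset.mem_map.1 he
    refine ⟨fun h => (hS _ hab).1 (Sum.inr_injective h), fun h => ?_⟩
    rcases Finset.mem_disjUnion.1 h with h | h
    · obtain ⟨⟨a', b'⟩, he', h'⟩ := Finset.mem_map.1 h
      exact absurd (congrArg Prod.fst h') Sum.inl_ne_inr
    · obtain ⟨⟨a', b'⟩, he', h'⟩ := Finset.mem_map.1 h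
      simp only [Function.Embedding.prodMap, Function.Embedding.coeFn_mk, Prod.map_apply,
        Function.Embedding.inr_apply, Prod.swap_prod_mk, Prod.mk.injEq, Sum.inr.injEq] at h'
      obtain ⟨rfl, rfl⟩ := h'
      exact (hS _ hab).2 he'

lemma lintegral_pi_sum_mul {E J : Type*} [MeasurableSpace E] [Fintype J] (ν : Measure E)
    [SigmaFinite ν] {f g : (J → E) → ℝ≥0∞} (hf : Measurable f) (hg : Measurable g) :
    ∫⁻ x : J ⊕ J → E, f (fun j => x (Sum.inl j)) * g (fun j => x (Sum.inr j))
        ∂(Measure.pi fun _ => ν) =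
      (∫⁻ x, f x ∂(Measure.pi fun _ => ν)) * ∫⁻ x, g x ∂(Measure.pi fun _ => ν) := by
  have h := measurePreserving_sumPiEquivProdPi (fun _ : J ⊕ J => ν)
  rw [← lintegral_prod_mul hf.aemeasurable hg.aemeasurable]
  have := h.lintegral_comp (f := fun p : (J → E) × (J → E) => f p.1 * g p.2)
    ((hf.comp measurable_fst).mul (hg.comp measurable_snd))
  exact this

/-- Disjoint tuples have independent locations, and no edge between them is prescribed, so the
conditional expectation given the weights factorises. The outer integral does not factorise: the
weights are shared. -/
lemma IsGIRG.lintegral_clusterInd_mul [IsProbabilityMeasure P] (h : IsGIRG P α d n X W G) {m : ℕ}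
    {B : Set (EuclideanSpace ℝ (Fin d))} (hB : MeasurableSet B) (s : ℝ)
    {S : Finset (Fin (m + 1) × Fin (m + 1))} (hS : S ⊆ potentialEdges m)
    {τ τ' : Fin (m + 1) → Fin n} (hτ : Function.Injective τ) (hτ' : Function.Injective τ')
    (hdisj : ∀ a b, τ a ≠ τ' b) :
    ∫⁻ ω, clusterInd (G ω) (X ω) s B S τ * clusterInd (G ω) (X ω) s B S τ' ∂P =
      ∫⁻ ω, boxIntegral α B s S (∑ k, W ω k) (fun a => W ω (τ a)) *
        boxIntegral α B s S (∑ k, W ω k) (fun a => W ω (τ' a)) ∂P := by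
  have hinj : Function.Injective (Sum.elim τ τ') := hτ.sumElim hτ' hdisj
  have e1 : ∀ ω, clusterInd (G ω) (X ω) s B S τ * clusterInd (G ω) (X ω) s B S τ' =
      closeInd s B (fun a => X ω (τ a)) * closeInd s B (fun a => X ω (τ' a)) *
        edgeInd (G ω) (doubleEdges S) (Sum.elim τ τ') := by
    intro ω
    rw [clusterInd_eq _ _ _ _ _ hτ, clusterInd_eq _ _ _ _ _ hτ', edgeInd_doubleEdges]
    ring
  simp_rw [e1]
  have h1 := h.isSIRG.lintegral_edgeInd h.girgKernel_nonneg
    (fun ω t x y => girgKernel_comm α d _ t x y) hinj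
    (ne_and_swap_notMem_doubleEdges (ne_and_swap_notMem_of_subset_potentialEdges hS))
    (f := fun p => closeInd s B (fun a => p.1 (τ a)) * closeInd s B fun a => p.1 (τ' a))
    (((measurable_closeInd hB s).comp
      (measurable_pi_lambda _ fun a => (measurable_pi_apply (τ a)).comp measurable_fst)).mul
      ((measurable_closeInd hB s).comp
      (measurable_pi_lambda _ fun a => (measurable_pi_apply (τ' a)).comp measurable_fst)))
  rw [h1]
  have h2 := h.lintegral_locations hinj (f := fun x w =>
      closeInd s B (fun a => x (Sum.inl a)) * closeInd s B (fun a => x (Sum.inr a)) *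
      edgeProd (girgKernel α d (∑ k, w k)) (doubleEdges S) x fun a => w (Sum.elim τ τ' a)) (by
    refine (Measurable.mul ?_ ?_).mul ?_
    · exact (measurable_closeInd hB s).comp
        (measurable_pi_lambda _ fun a => (measurable_pi_apply _).comp measurable_fst)
    · exact (measurable_closeInd hB s).comp
        (measurable_pi_lambda _ fun a => (measurable_pi_apply _).comp measurable_fst)
    · exact measurable_edgeProd α _ (by fun_prop) measurable_fst
        (measurable_pi_lambda _ fun a => (measurable_pi_apply _).comp measurable_snd))
  refine h2.trans (lintegral_congr fun ω => ?_)
  rw [boxIntegral_eq_lintegral, boxIntegral_eq_lintegral, ← lintegral_pi_sum_mul]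
  · refine lintegral_congr fun x => ?_
    rw [edgeProd_doubleEdges]
    simp only [Sum.elim_inl, Sum.elim_inr]
    ring
  · exact (measurable_closeInd hB s).mul
      (measurable_edgeProd α S measurable_const measurable_id measurable_const)
  · exact (measurable_closeInd hB s).mul
      (measurable_edgeProd α S measurable_const measurable_id measurable_const)

end

/-! ### Counts per vertex and their first moments -/

/-- The other vertices whose locations are close to that of `i` (after scaling by `s`). -/
def nearSet {V : Type*} {d : ℕ} (x : V → EuclideanSpace ℝ (Fin d)) (s : ℝ)
    (B : Set (EuclideanSpace ℝ (Fin d))) (i : V) : Set V :=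
  {j | j ≠ i ∧ s • (x j - x i) ∈ B}

/-- The average over the vertices of the number of close tuples which are connected by the edges
listed in `S`. -/
def clusterCount {d m n : ℕ} (G : SimpleGraph (Fin n)) (x : Fin n → EuclideanSpace ℝ (Fin d))
    (s : ℝ) (B : Set (EuclideanSpace ℝ (Fin d))) (S : Finset (Fin (m + 1) × Fin (m + 1))) :
    ℝ≥0∞ :=
  (n : ℝ≥0∞)⁻¹ * ∑ τ : Fin (m + 1) → Fin n, clusterInd G x s B S τ

lemma clusterInd_cons {V : Type*} {d m : ℕ} (G : SimpleGraph V) (x : V → EuclideanSpace ℝ (Fin d))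
    (s : ℝ) (B : Set (EuclideanSpace ℝ (Fin d))) (S : Finset (Fin (m + 1) × Fin (m + 1)))
    (i : V) (t : Fin m → V) [Decidable (IsRootedHom G i (nearSet x s B i) S t)] :
    clusterInd G x s B S (Fin.cons i t) =
      if IsRootedHom G i (nearSet x s B i) S t then 1 else 0 := by
  unfold clusterInd edgeInd
  by_cases h1 : Function.Injective (Fin.cons i t : Fin (m + 1) → V)
  · have hne : ∀ a, t a ≠ i := fun a ha => by
      have : (Fin.cons i t : Fin (m + 1) → V) a.succ = (Fin.cons i t : Fin (m + 1) → V) 0 := by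
        simpa using ha
      exact absurd (h1 this) (Fin.succ_ne_zero a)
    by_cases h2 : ∀ a, s • (x (t a) - x i) ∈ B
    · by_cases h3 : ∀ e ∈ S, G.Adj ((Fin.cons i t : Fin (m + 1) → V) e.1)
        ((Fin.cons i t : Fin (m + 1) → V) e.2)
      · rw [if_pos ⟨h1, by simpa using h2⟩, if_pos h3,
          if_pos ⟨h1, fun a => ⟨hne a, h2 a⟩, h3⟩]
      · rw [if_pos ⟨h1, by simpa using h2⟩, if_neg h3, if_neg fun h => h3 h.2.2]
    · rw [if_neg fun h => h2 (by simpa using h.2), if_neg fun h => h2 fun a => (h.2.1 a).2]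
  · rw [if_neg fun h => h1 h.1, if_neg fun h => h1 h.1]

lemma sum_clusterInd_cons {V : Type*} [Fintype V] {d m : ℕ} (G : SimpleGraph V)
    (x : V → EuclideanSpace ℝ (Fin d)) (s : ℝ) (B : Set (EuclideanSpace ℝ (Fin d)))
    (S : Finset (Fin (m + 1) × Fin (m + 1))) (i : V) :
    ∑ t : Fin m → V, clusterInd G x s B S (Fin.cons i t) = homCount G i (nearSet x s B i) S := by
  classical
  rw [homCount, tsum_fintype]
  exact Finset.sum_congr rfl fun t _ => clusterInd_cons G x s B S i t

/-- Links the sum over all tuples, suited to moments, with the counts rooted at a vertex, suited to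
the Möbius expansion. -/
lemma clusterCount_eq_sum_homCount {d m n : ℕ} (G : SimpleGraph (Fin n))
    (x : Fin n → EuclideanSpace ℝ (Fin d)) (s : ℝ) (B : Set (EuclideanSpace ℝ (Fin d)))
    (S : Finset (Fin (m + 1) × Fin (m + 1))) :
    clusterCount G x s B S = (n : ℝ≥0∞)⁻¹ * ∑ i, homCount G i (nearSet x s B i) S := by
  unfold clusterCount
  rw [← (Fin.consEquiv fun _ : Fin (m + 1) => Fin n).sum_comp, Fintype.sum_prod_type]
  simp_rw [← sum_clusterInd_cons]
  rfl

lemma clusterInd_le_one {V : Type*} {d m : ℕ} (G : SimpleGraph V)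
    (x : V → EuclideanSpace ℝ (Fin d)) (s : ℝ) (B : Set (EuclideanSpace ℝ (Fin d)))
    (S : Finset (Fin (m + 1) × Fin (m + 1))) (τ : Fin (m + 1) → V) :
    clusterInd G x s B S τ ≤ 1 := by
  unfold clusterInd edgeInd
  split_ifs <;> simp

lemma clusterCount_ne_top {d m n : ℕ} (hn : n ≠ 0) (G : SimpleGraph (Fin n))
    (x : Fin n → EuclideanSpace ℝ (Fin d)) (s : ℝ) (B : Set (EuclideanSpace ℝ (Fin d)))
    (S : Finset (Fin (m + 1) × Fin (m + 1))) : clusterCount G x s B S ≠ ∞ := by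
  unfold clusterCount
  refine ENNReal.mul_ne_top (by simpa using hn) (ENNReal.sum_ne_top.2 fun τ _ => ?_)
  exact ((clusterInd_le_one G x s B S τ).trans_lt ENNReal.one_lt_top).ne

/-- The exponential moment of the number of points of a unit-rate Poisson process in `B`. -/
def expMoment {d : ℕ} (B : Set (EuclideanSpace ℝ (Fin d))) : ℝ≥0∞ :=
  ∑' m : ℕ, ENNReal.ofReal (4 ^ m / m.factorial) * volume B ^ m

lemma expMoment_ne_top {d : ℕ} {B : Set (EuclideanSpace ℝ (Fin d))} (hB : volume B ≠ ∞) :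
    expMoment B ≠ ∞ := by
  have h : ∀ m : ℕ, ENNReal.ofReal (4 ^ m / m.factorial) * volume B ^ m =
      ENNReal.ofReal ((4 * (volume B).toReal) ^ m / m.factorial) := by
    intro m
    rw [← ENNReal.ofReal_toReal (ENNReal.pow_ne_top hB : volume B ^ m ≠ ∞),
      ← ENNReal.ofReal_mul (by positivity), ENNReal.toReal_pow]
    congr 1
    ring
  unfold expMoment
  simp_rw [h]
  rw [← ENNReal.ofReal_tsum_of_nonneg (fun m => by positivity) (Real.summable_pow_div_factorial _)]
  exact ENNReal.ofReal_ne_top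

/-- Powers of the number of near vertices are absorbed into the exponential moment: x^k / k! ≤ e^x
and e < 5. -/
lemma exists_pow_le_five_pow (k : ℕ) :
    ∃ c : ℝ≥0, ∀ D : ℕ, ((D + 1 : ℕ) : ℝ≥0∞) ^ k ≤ c * 5 ^ D := by
  refine ⟨k.factorial * 3, fun D => ?_⟩
  have h1 := Real.pow_div_factorial_le_exp (x := ((D + 1 : ℕ) : ℝ)) (by positivity) k
  have h2 : Real.exp ((D + 1 : ℕ) : ℝ) ≤ 3 * 5 ^ D := by
    have he : Real.exp 1 ≤ 3 := by linarith [Real.exp_one_lt_d9]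
    have : Real.exp ((D + 1 : ℕ) : ℝ) = Real.exp 1 ^ D * Real.exp 1 := by
      rw [← pow_succ, ← Real.exp_nat_mul, mul_one]
    rw [this, mul_comm]
    have hp : Real.exp 1 ^ D ≤ 5 ^ D :=
      pow_le_pow_left₀ (Real.exp_pos _).le (by linarith) _
    exact mul_le_mul he hp (by positivity) (by norm_num)
  have h3 : ((D + 1 : ℕ) : ℝ) ^ k ≤ k.factorial * 3 * 5 ^ D := by
    rw [div_le_iff₀ (by positivity)] at h1
    calc _ ≤ _ := h1
      _ ≤ 3 * 5 ^ D * k.factorial := by gcongr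
      _ = _ := by ring
  have h4 : (D + 1) ^ k ≤ k.factorial * 3 * 5 ^ D := by exact_mod_cast h3
  have : (((D + 1) ^ k : ℕ) : ℝ≥0∞) ≤ ((k.factorial * 3 * 5 ^ D : ℕ) : ℝ≥0∞) := Nat.cast_le.2 h4
  push_cast at this ⊢
  exact this

section

variable {Ω : Type*} [MeasurableSpace Ω] {P : Measure Ω} {α : ℝ≥0∞}
  {d n : ℕ} {X : Ω → Fin n → EuclideanSpace ℝ (Fin d)} {W : Ω → Fin n → ℝ}
  {G : Ω → SimpleGraph (Fin n)}

lemma IsGIRG.measurable_clusterCount (h : IsGIRG P α d n X W G) {m : ℕ}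
    {B : Set (EuclideanSpace ℝ (Fin d))} (hB : MeasurableSet B) (s : ℝ)
    (S : Finset (Fin (m + 1) × Fin (m + 1))) :
    Measurable fun ω => clusterCount (G ω) (X ω) s B S :=
  (Finset.measurable_sum _ fun τ _ => h.measurable_clusterInd hB s S τ).const_mul _

/-- With s^d = n the Jacobian s^(m d) is n^m, and s^d times the mean weight is the total weight. -/
lemma boxIntegral_le_clusterIntegral (hd : 1 ≤ d) (hn : n ≠ 0) {m : ℕ}
    {B : Set (EuclideanSpace ℝ (Fin d))} (hB : MeasurableSet B) {s : ℝ} (hs : 0 < s)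
    (hsn : s ^ d = n) (S : Finset (Fin (m + 1) × Fin (m + 1))) {w : Fin n → ℝ}
    (hw : ∀ i, 0 ≤ w i) (τ : Fin (m + 1) → Fin n) :
    boxIntegral α B s S (∑ k, w k) (fun a => w (τ a)) ≤
      (n : ℝ≥0∞)⁻¹ ^ m * clusterIntegral α B S ((∑ k, w k) / n) (w ∘ τ) := by
  have h1 := boxIntegral_le α hd hB hs (S := S) (L := (∑ k, w k) / n)
    (div_nonneg (Finset.sum_nonneg fun i _ => hw i) (by positivity)) (v := fun a => w (τ a))
    fun a => hw _
  have hn' : (n : ℝ) ≠ 0 := by exact_mod_cast hn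
  rw [hsn, mul_div_cancel₀ _ hn', mul_comm m d, pow_mul, hsn, ← Nat.cast_pow,
    ENNReal.ofReal_natCast, Nat.cast_pow] at h1
  rw [← ENNReal.inv_pow, ← ENNReal.div_eq_inv_mul,
    ENNReal.le_div_iff_mul_le (Or.inl (by simpa using fun h => absurd h hn)) (Or.inl (by simp)), mul_comm]
  exact h1

lemma clusterIntegral_le_boxIntegral (hd : 1 ≤ d) (hn : n ≠ 0) {m : ℕ}
    {B : Set (EuclideanSpace ℝ (Fin d))} (hB : MeasurableSet B) {K : ℝ} (hK : 0 ≤ K)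
    (hBK : B ⊆ Metric.closedBall 0 K) {s : ℝ} (hs : 0 < s)
    (hsn : s ^ d = n) (S : Finset (Fin (m + 1) × Fin (m + 1))) {w : Fin n → ℝ}
    (hw : ∀ i, 0 ≤ w i) (τ : Fin (m + 1) → Fin n) :
    ENNReal.ofReal (1 - 2 * K / s) ^ d *
        ((n : ℝ≥0∞)⁻¹ ^ m * clusterIntegral α B S ((∑ k, w k) / n) (w ∘ τ)) ≤
      boxIntegral α B s S (∑ k, w k) (fun a => w (τ a)) := by
  have h1 := le_boxIntegral α hd hB hK hBK hs (S := S) (L := (∑ k, w k) / n)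
    (div_nonneg (Finset.sum_nonneg fun i _ => hw i) (by positivity)) (v := fun a => w (τ a))
    fun a => hw _
  have hn' : (n : ℝ) ≠ 0 := by exact_mod_cast hn
  rw [hsn, mul_div_cancel₀ _ hn', mul_comm m d, pow_mul, hsn, ← Nat.cast_pow,
    ENNReal.ofReal_natCast, Nat.cast_pow] at h1
  rw [← ENNReal.inv_pow, mul_left_comm, mul_comm, ← ENNReal.div_eq_inv_mul.trans (mul_comm _ _)]
  exact ENNReal.div_le_of_le_mul' h1

variable [IsProbabilityMeasure P]

/-- Tuples with repetitions contribute 0 on the left and something nonnegative on the right. -/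
lemma IsGIRG.lintegral_mul_clusterCount_le (h : IsGIRG P α d n X W G) (hd : 1 ≤ d) (hn : n ≠ 0)
    {m : ℕ} {B : Set (EuclideanSpace ℝ (Fin d))} (hB : MeasurableSet B) {s : ℝ} (hs : 0 < s)
    (hsn : s ^ d = n) {S : Finset (Fin (m + 1) × Fin (m + 1))} (hS : S ⊆ potentialEdges m)
    {ψ : (Fin n → ℝ) → ℝ≥0∞} (hψ : Measurable ψ) :
    ∫⁻ ω, ψ (W ω) * clusterCount (G ω) (X ω) s B S ∂P ≤
      ∫⁻ ω, ψ (W ω) * clusterAverage α B S (W ω) ∂P := by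
  have hψW : Measurable fun ω => ψ (W ω) := hψ.comp h.isSIRG.measurable_weight
  have hcI : ∀ τ : Fin (m + 1) → Fin n, Measurable fun ω =>
      clusterIntegral α B S ((∑ k, W ω k) / n) (W ω ∘ τ) := fun τ => by
    have hW := h.isSIRG.measurable_weight
    refine measurable_clusterIntegral α hB S ?_ ?_
    · exact (Finset.measurable_sum _ fun k _ => (measurable_pi_apply k).comp hW).div_const _
    · exact measurable_pi_lambda _ fun a => (measurable_pi_apply (τ a)).comp hW
  have e1 : ∀ ω, ψ (W ω) * clusterCount (G ω) (X ω) s B S =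
      (n : ℝ≥0∞)⁻¹ * ∑ τ, ψ (W ω) * clusterInd (G ω) (X ω) s B S τ := fun ω => by
    rw [clusterCount, mul_left_comm, Finset.mul_sum]
  have e2 : ∀ ω, ψ (W ω) * clusterAverage α B S (W ω) = (n : ℝ≥0∞)⁻¹ *
      ∑ τ : Fin (m + 1) → Fin n, ψ (W ω) * ((n : ℝ≥0∞)⁻¹ ^ m *
        clusterIntegral α B S ((∑ k, W ω k) / n) (W ω ∘ τ)) := fun ω => by
    simp only [clusterAverage, pow_succ', Finset.mul_sum]
    exact Finset.sum_congr rfl fun τ _ => by ring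
  simp_rw [e1, e2]
  rw [lintegral_const_mul, lintegral_const_mul, lintegral_finsetSum, lintegral_finsetSum]
  · refine mul_le_mul_right (Finset.sum_le_sum fun τ _ => ?_) _
    by_cases hτ : Function.Injective τ
    · rw [h.lintegral_clusterInd hB s hS hτ hψ]
      refine lintegral_mono_ae ?_
      filter_upwards [h.weight_nonneg] with ω hω
      gcongr
      exact boxIntegral_le_clusterIntegral hd hn hB hs hsn S hω τ
    · simp [clusterInd_of_not_injective _ _ _ _ _ hτ]
  · exact fun τ _ => hψW.mul ((hcI τ).const_mul _)
  · exact fun τ _ => hψW.mul (h.measurable_clusterInd hB s S τ)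
  · exact Finset.measurable_sum _ fun τ _ => hψW.mul ((hcI τ).const_mul _)
  · exact Finset.measurable_sum _ fun τ _ => hψW.mul (h.measurable_clusterInd hB s S τ)

lemma IsGIRG.lintegral_clusterCount_le (h : IsGIRG P α d n X W G) (hd : 1 ≤ d) (hn : n ≠ 0)
    {m : ℕ} {B : Set (EuclideanSpace ℝ (Fin d))} (hB : MeasurableSet B) {s : ℝ} (hs : 0 < s)
    (hsn : s ^ d = n) {S : Finset (Fin (m + 1) × Fin (m + 1))} (hS : S ⊆ potentialEdges m) :
    ∫⁻ ω, clusterCount (G ω) (X ω) s B S ∂P ≤ ∫⁻ ω, clusterAverage α B S (W ω) ∂P := by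
  simpa using h.lintegral_mul_clusterCount_le hd hn hB hs hsn hS (ψ := 1) measurable_one

/-- The proportion of tuples which are not injective. -/
def collisionRate (m n : ℕ) : ℝ≥0∞ :=
  1 - (n : ℝ≥0∞)⁻¹ ^ (m + 1) * (n.descFactorial (m + 1) : ℕ)

open scoped Classical in
lemma collisionRate_eq {m n : ℕ} (hn : n ≠ 0) :
    (n : ℝ≥0∞)⁻¹ ^ (m + 1) * ((Finset.univ.filter
      fun τ : Fin (m + 1) → Fin n => ¬ Function.Injective τ).card : ℕ) = collisionRate m n := by
  have h1 : (Finset.univ.filter fun τ : Fin (m + 1) → Fin n => Function.Injective τ).card =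
      n.descFactorial (m + 1) := by
    rw [← Fintype.card_subtype, Fintype.card_congr (Equiv.subtypeInjectiveEquivEmbedding _ _),
      Fintype.card_embedding_eq, Fintype.card_fin, Fintype.card_fin]
  have h2 := Finset.card_filter_add_card_filter_not (s := Finset.univ)
    fun τ : Fin (m + 1) → Fin n => Function.Injective τ
  rw [h1, Finset.card_univ, Fintype.card_fun, Fintype.card_fin, Fintype.card_fin] at h2
  have h3 : (n : ℝ≥0∞)⁻¹ ^ (m + 1) * (n : ℝ≥0∞) ^ (m + 1) = 1 := by
    rw [← mul_pow, ENNReal.inv_mul_cancel (by simpa using hn) (by simp), one_pow]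
  have h4 := congrArg (fun k : ℕ => (n : ℝ≥0∞)⁻¹ ^ (m + 1) * (k : ℝ≥0∞)) h2
  simp only [Nat.cast_add, Nat.cast_pow, h3, mul_add] at h4
  rw [collisionRate, ← h4, ENNReal.add_sub_cancel_left]
  exact ENNReal.mul_ne_top (ENNReal.pow_ne_top (by simpa using hn)) (ENNReal.natCast_ne_top _)

lemma tendsto_collisionRate (m : ℕ) : Tendsto (collisionRate m) atTop (𝓝 0) := by
  have h1 := isEquivalent_descFactorial (m + 1)
  have h2 := (Asymptotics.isEquivalent_iff_tendsto_one (by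
    filter_upwards [eventually_gt_atTop 0] with n hn
    positivity)).1 h1
  have h3 := ENNReal.tendsto_ofReal h2
  rw [ENNReal.ofReal_one] at h3
  have h4 := ENNReal.Tendsto.sub (tendsto_const_nhds (x := (1 : ℝ≥0∞))) h3 (Or.inl (by simp))
  rw [tsub_self] at h4
  refine h4.congr' ?_
  filter_upwards [eventually_gt_atTop 0] with n hn
  rw [collisionRate]
  congr 1
  rw [Pi.div_apply, ENNReal.ofReal_div_of_pos (by positivity), ENNReal.ofReal_natCast,
    ← Nat.cast_pow, ENNReal.ofReal_natCast, ENNReal.div_eq_inv_mul, Nat.cast_pow, ENNReal.inv_pow]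

/-- The converse bound has two losses: roots close to the faces of the box give the factor, and
tuples with repetitions the additive term. -/
lemma IsGIRG.le_lintegral_clusterCount (h : IsGIRG P α d n X W G) (hd : 1 ≤ d) (hn : n ≠ 0)
    {m : ℕ} {B : Set (EuclideanSpace ℝ (Fin d))} (hB : MeasurableSet B) {K : ℝ} (hK : 0 ≤ K)
    (hBK : B ⊆ Metric.closedBall 0 K) {s : ℝ} (hs : 0 < s)
    (hsn : s ^ d = n) {S : Finset (Fin (m + 1) × Fin (m + 1))} (hS : S ⊆ potentialEdges m) :
    ENNReal.ofReal (1 - 2 * K / s) ^ d * ∫⁻ ω, clusterAverage α B S (W ω) ∂P ≤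
      ∫⁻ ω, clusterCount (G ω) (X ω) s B S ∂P + collisionRate m n * volume B ^ m := by
  classical
  have hW := h.isSIRG.measurable_weight
  have hcI : ∀ τ : Fin (m + 1) → Fin n, Measurable fun ω =>
      clusterIntegral α B S ((∑ k, W ω k) / n) (W ω ∘ τ) := fun τ => by
    refine measurable_clusterIntegral α hB S ?_ ?_
    · exact (Finset.measurable_sum _ fun k _ => (measurable_pi_apply k).comp hW).div_const _
    · exact measurable_pi_lambda _ fun a => (measurable_pi_apply (τ a)).comp hW
  have key : ∀ τ : Fin (m + 1) → Fin n, ENNReal.ofReal (1 - 2 * K / s) ^ d *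
      ((n : ℝ≥0∞)⁻¹ ^ m * ∫⁻ ω, clusterIntegral α B S ((∑ k, W ω k) / n) (W ω ∘ τ) ∂P) ≤
      ∫⁻ ω, clusterInd (G ω) (X ω) s B S τ ∂P +
        if Function.Injective τ then 0 else (n : ℝ≥0∞)⁻¹ ^ m * volume B ^ m := by
    intro τ
    by_cases hτ : Function.Injective τ
    · have h1 := h.lintegral_clusterInd hB s hS hτ (ψ := 1) measurable_one
      simp only [Pi.one_apply, one_mul] at h1
      rw [if_pos hτ, add_zero, h1, ← lintegral_const_mul _ (hcI τ),
        ← lintegral_const_mul _ ((hcI τ).const_mul _)]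
      refine lintegral_mono_ae ?_
      filter_upwards [h.weight_nonneg] with ω hω
      exact clusterIntegral_le_boxIntegral hd hn hB hK hBK hs hsn S hω τ
    · rw [if_neg hτ]
      refine le_add_left ?_
      calc _ ≤ 1 * ((n : ℝ≥0∞)⁻¹ ^ m * ∫⁻ ω, volume B ^ m ∂P) := by
            gcongr with ω
            · refine pow_le_one₀ (zero_le) (ENNReal.ofReal_le_one.2 ?_)
              have : 0 ≤ 2 * K / s := by positivity
              linarith
            · exact clusterIntegral_le α hB S _ _
        _ = _ := by simp
  unfold clusterAverage clusterCount
  rw [lintegral_const_mul, lintegral_const_mul, lintegral_finsetSum, lintegral_finsetSum]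
  · calc _ = (n : ℝ≥0∞)⁻¹ * ∑ τ : Fin (m + 1) → Fin n, ENNReal.ofReal (1 - 2 * K / s) ^ d *
          ((n : ℝ≥0∞)⁻¹ ^ m *
            ∫⁻ ω, clusterIntegral α B S ((∑ k, W ω k) / n) (W ω ∘ τ) ∂P) := by
          rw [pow_succ']
          simp only [Finset.mul_sum]
          exact Finset.sum_congr rfl fun τ _ => by ring
      _ ≤ (n : ℝ≥0∞)⁻¹ * ∑ τ : Fin (m + 1) → Fin n, (∫⁻ ω, clusterInd (G ω) (X ω) s B S τ ∂P +
        if Function.Injective τ then 0 else (n : ℝ≥0∞)⁻¹ ^ m * volume B ^ m) := by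
          gcongr with τ _
          exact key τ
      _ = _ := by
          rw [Finset.sum_add_distrib, mul_add, ← collisionRate_eq hn]
          congr 1
          simp_rw [← ite_not (Function.Injective _)]
          rw [← Finset.sum_filter, Finset.sum_const, nsmul_eq_mul, pow_succ']
          ring
  · exact fun τ _ => h.measurable_clusterInd hB s S τ
  · exact fun τ _ => hcI τ
  · exact Finset.measurable_sum _ fun τ _ => h.measurable_clusterInd hB s S τ
  · exact Finset.measurable_sum _ fun τ _ => hcI τ

end

/-! ### Exponential moments and second moments of the counts -/

lemma self_notMem_nearSet {V : Type*} {d : ℕ} (x : V → EuclideanSpace ℝ (Fin d)) (s : ℝ)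
    (B : Set (EuclideanSpace ℝ (Fin d))) (i : V) : i ∉ nearSet x s B i := fun h => h.1 rfl

lemma five_pow_ncard_eq_tsum {V : Type*} (G : SimpleGraph V) (o : V) {C : Set V} (hC : C.Finite)
    (ho : o ∉ C) :
    (5 : ℝ≥0∞) ^ C.ncard = ∑' m : ℕ, ENNReal.ofReal (4 ^ m / m.factorial) *
      homCount G o C (∅ : Finset (Fin (m + 1) × Fin (m + 1))) := by
  have := five_pow_card_eq_tsum G o hC.toFinset (by simpa using ho)
  rwa [hC.coe_toFinset, ← Set.ncard_eq_toFinset_card C hC] at this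

/-- The average over the vertices of `5` to the number of close vertices. -/
def fivePowAverage {d n : ℕ} (x : Fin n → EuclideanSpace ℝ (Fin d))
    (s : ℝ) (B : Set (EuclideanSpace ℝ (Fin d))) : ℝ≥0∞ :=
  (n : ℝ≥0∞)⁻¹ * ∑ i, 5 ^ (nearSet x s B i).ncard

lemma fivePowAverage_eq {d n : ℕ} (G : SimpleGraph (Fin n)) (x : Fin n → EuclideanSpace ℝ (Fin d))
    (s : ℝ) (B : Set (EuclideanSpace ℝ (Fin d))) :
    fivePowAverage x s B = ∑' m : ℕ, ENNReal.ofReal (4 ^ m / m.factorial) *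
      clusterCount G x s B (∅ : Finset (Fin (m + 1) × Fin (m + 1))) := by
  simp_rw [clusterCount_eq_sum_homCount, mul_left_comm _ (n : ℝ≥0∞)⁻¹]
  rw [ENNReal.tsum_mul_left, fivePowAverage]
  congr 1
  simp_rw [Finset.mul_sum]
  rw [Summable.tsum_finsetSum fun _ _ => ENNReal.summable]
  exact Finset.sum_congr rfl fun i _ => five_pow_ncard_eq_tsum G i (Set.toFinite _)
    (self_notMem_nearSet x s B i)

lemma sum_ite_forall_mem {V J : Type*} [Fintype V] [Fintype J] [DecidableEq J] (T : Finset V)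
    [∀ t : J → V, Decidable (∀ a, t a ∈ T)] :
    ∑ t : J → V, (if ∀ a, t a ∈ T then (1 : ℝ≥0∞) else 0) = (T.card : ℝ≥0∞) ^ Fintype.card J := by
  classical
  rw [Finset.sum_boole]
  have : (Finset.univ.filter fun t : J → V => ∀ a, t a ∈ T) = Fintype.piFinset fun _ => T := by
    ext t
    simp
  rw [this, Fintype.card_piFinset, Finset.prod_const, Finset.card_univ, Nat.cast_pow]

/-- Two clusters of radius K that share a vertex lie within 3K of the first vertex i of the first
one. Given i there are m + (m + 1) further vertices, each i itself or near i. -/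
lemma sum_clusterInd_mul_le {V : Type*} [Fintype V] [DecidableEq V] {d m : ℕ} (G : SimpleGraph V)
    (x : V → EuclideanSpace ℝ (Fin d)) (s : ℝ) {K : ℝ} (hK : 0 ≤ K)
    (S : Finset (Fin (m + 1) × Fin (m + 1))) :
    ∑ τ : Fin (m + 1) → V, ∑ τ' : Fin (m + 1) → V, (if ∀ a b, τ a ≠ τ' b then 0 else
      clusterInd G x s (Metric.closedBall 0 K) S τ *
          clusterInd G x s (Metric.closedBall 0 K) S τ') ≤
    ∑ i, (((nearSet x s (Metric.closedBall 0 (3 * K)) i).ncard + 1 : ℕ) : ℝ≥0∞) ^ (2 * m + 1) := by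
  classical
  set T : V → Finset V := fun i =>
    insert i (nearSet x s (Metric.closedBall 0 (3 * K)) i).toFinset with hT
  have hTcard : ∀ i, (T i).card = (nearSet x s (Metric.closedBall 0 (3 * K)) i).ncard + 1 := by
    intro i
    rw [hT, Finset.card_insert_of_notMem (by simpa using self_notMem_nearSet x s _ i),
      Set.ncard_eq_toFinset_card']
  have hmem : ∀ i j, j ∈ T i ↔ ‖s • (x j - x i)‖ ≤ 3 * K := by
    intro i j
    rw [hT, Finset.mem_insert, Set.mem_toFinset]
    constructor
    · rintro (rfl | h)
      · simpa using hK
      · exact mem_closedBall_zero_iff.1 h.2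
    · intro h
      by_cases hji : j = i
      · exact Or.inl hji
      · exact Or.inr ⟨hji, mem_closedBall_zero_iff.2 h⟩
  have key : ∀ τ τ' : Fin (m + 1) → V, (if ∀ a b, τ a ≠ τ' b then 0 else
      clusterInd G x s (Metric.closedBall 0 K) S τ *
        clusterInd G x s (Metric.closedBall 0 K) S τ') ≤
      (if ∀ a : Fin m, τ a.succ ∈ T (τ 0) then 1 else 0) *
        if ∀ a, τ' a ∈ T (τ 0) then 1 else 0 := by
    intro τ τ'
    by_cases h0 : ∀ a b, τ a ≠ τ' b
    · rw [if_pos h0]; exact zero_le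
    rw [if_neg h0]
    by_cases h1 : Function.Injective τ ∧
        ∀ a : Fin m, s • (x (τ a.succ) - x (τ 0)) ∈ Metric.closedBall 0 K
    swap
    · rw [clusterInd, if_neg h1, zero_mul]; exact zero_le
    by_cases h2 : Function.Injective τ' ∧
        ∀ a : Fin m, s • (x (τ' a.succ) - x (τ' 0)) ∈ Metric.closedBall 0 K
    swap
    · rw [clusterInd, clusterInd, if_neg h2, mul_zero]; exact zero_le
    have close : ∀ {σ : Fin (m + 1) → V}, (∀ a : Fin m, s • (x (σ a.succ) - x (σ 0)) ∈
        Metric.closedBall 0 K) → ∀ a, ‖s • (x (σ a) - x (σ 0))‖ ≤ K := by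
      intro σ h a
      refine Fin.cases ?_ (fun a => ?_) a
      · simpa using hK
      · simpa using h a
    have c1 := close h1.2
    have c2 := close h2.2
    push Not at h0
    obtain ⟨a, b, hab⟩ := h0
    rw [if_pos fun a => (hmem _ _).2 ((c1 _).trans (by linarith)), if_pos, one_mul]
    · calc _ ≤ (1 : ℝ≥0∞) * 1 := by gcongr <;> exact clusterInd_le_one ..
        _ = 1 := one_mul 1
    · intro e
      rw [hmem]
      -- The path from τ' e to τ 0 passes through τ' 0 and the shared vertex τ a = τ' b, at most K
      -- for each leg.
      have : s • (x (τ' e) - x (τ 0)) = s • (x (τ' e) - x (τ' 0)) + (s • (x (τ a) - x (τ 0)) -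
          s • (x (τ' b) - x (τ' 0))) := by
        rw [hab, ← smul_sub, ← smul_add]
        congr 1
        abel
      rw [this]
      calc _ ≤ _ := norm_add_le _ _
        _ ≤ K + (K + K) := add_le_add (c2 e) ((norm_sub_le _ _).trans (add_le_add (c1 a) (c2 b)))
        _ = 3 * K := by ring
  calc _ ≤ ∑ τ : Fin (m + 1) → V, ∑ τ' : Fin (m + 1) → V,
        (if ∀ a : Fin m, τ a.succ ∈ T (τ 0) then (1 : ℝ≥0∞) else 0) *
          if ∀ a, τ' a ∈ T (τ 0) then 1 else 0 :=
        Finset.sum_le_sum fun τ _ => Finset.sum_le_sum fun τ' _ => key τ τ'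
    _ = ∑ i, ∑ t : Fin m → V, (if ∀ a : Fin m, t a ∈ T i then (1 : ℝ≥0∞) else 0) *
          ((T i).card : ℝ≥0∞) ^ (m + 1) := by
        rw [← (Fin.consEquiv fun _ : Fin (m + 1) => V).sum_comp, Fintype.sum_prod_type]
        refine Finset.sum_congr rfl fun i _ => Finset.sum_congr rfl fun t _ => ?_
        rw [← Finset.mul_sum, sum_ite_forall_mem, Fintype.card_fin]
        rfl
    _ = _ := by
        refine Finset.sum_congr rfl fun i _ => ?_
        rw [← Finset.sum_mul, sum_ite_forall_mem, Fintype.card_fin, ← pow_add, hTcard]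
        congr 1
        ring

section

variable {Ω : Type*} [MeasurableSpace Ω] {P : Measure Ω} {α : ℝ≥0∞}
  {d n : ℕ} {X : Ω → Fin n → EuclideanSpace ℝ (Fin d)} {W : Ω → Fin n → ℝ}
  {G : Ω → SimpleGraph (Fin n)}

lemma IsGIRG.measurable_fivePowAverage (h : IsGIRG P α d n X W G)
    {B : Set (EuclideanSpace ℝ (Fin d))} (hB : MeasurableSet B) (s : ℝ) :
    Measurable fun ω => fivePowAverage (X ω) s B := by
  have e : (fun ω => fivePowAverage (X ω) s B) = _ := funext fun ω =>
      fivePowAverage_eq (G ω) (X ω) s B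
  rw [e]
  exact Measurable.tsum fun m => (h.measurable_clusterCount hB s _).const_mul _

variable [IsProbabilityMeasure P]

/-- The factorial moments of the number of near vertices are at most the Poisson ones, |B|^m, and
they are summed with the weights 4^m / m!. -/
lemma IsGIRG.lintegral_fivePowAverage_le (h : IsGIRG P α d n X W G) (hd : 1 ≤ d) (hn : n ≠ 0)
    {B : Set (EuclideanSpace ℝ (Fin d))} (hB : MeasurableSet B) {s : ℝ} (hs : 0 < s)
    (hsn : s ^ d = n) :
    ∫⁻ ω, fivePowAverage (X ω) s B ∂P ≤ expMoment B := by
  have e : (fun ω => fivePowAverage (X ω) s B) = _ := funext fun ω =>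
      fivePowAverage_eq (G ω) (X ω) s B
  rw [e, lintegral_tsum fun m => ((h.measurable_clusterCount hB s _).const_mul _).aemeasurable]
  unfold expMoment
  refine ENNReal.tsum_le_tsum fun m => ?_
  rw [lintegral_const_mul _ (h.measurable_clusterCount hB s _)]
  gcongr
  refine (h.lintegral_clusterCount_le hd hn hB hs hsn (Finset.empty_subset _)).trans ?_
  calc _ ≤ ∫⁻ ω, volume B ^ m ∂P := lintegral_mono fun ω => clusterAverage_le α hB _ _
    _ = _ := by simp

/-- Disjoint pairs are dominated by the square of the average. Intersecting pairs number at most a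
constant times the sum over i of 5^(D i), and the normalisation n^(-2) leaves a factor 1/n. -/
lemma IsGIRG.lintegral_clusterCount_sq_le (h : IsGIRG P α d n X W G) (hd : 1 ≤ d) (hn : n ≠ 0)
    {m : ℕ} {K : ℝ} (hK : 0 ≤ K) {s : ℝ} (hs : 0 < s)
    (hsn : s ^ d = n) {S : Finset (Fin (m + 1) × Fin (m + 1))} (hS : S ⊆ potentialEdges m)
    {c : ℝ≥0} (hc : ∀ D : ℕ, ((D + 1 : ℕ) : ℝ≥0∞) ^ (2 * m + 1) ≤ c * 5 ^ D) :
    ∫⁻ ω, clusterCount (G ω) (X ω) s (Metric.closedBall 0 K) S ^ 2 ∂P ≤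
      ∫⁻ ω, clusterAverage (d := d) α (Metric.closedBall 0 K) S (W ω) ^ 2 ∂P +
        (n : ℝ≥0∞)⁻¹ * (c * expMoment (Metric.closedBall (0 : EuclideanSpace ℝ (Fin d)) (3 * K))) := by
  classical
  set B := Metric.closedBall (0 : EuclideanSpace ℝ (Fin d)) K with hBdef
  have hB : MeasurableSet B := measurableSet_closedBall
  have hW := h.isSIRG.measurable_weight
  have hcI : ∀ τ : Fin (m + 1) → Fin n, Measurable fun ω =>
      clusterIntegral α B S ((∑ k, W ω k) / n) (W ω ∘ τ) := fun τ => by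
    refine measurable_clusterIntegral α hB S ?_ ?_
    · exact (Finset.measurable_sum _ fun k _ => (measurable_pi_apply k).comp hW).div_const _
    · exact measurable_pi_lambda _ fun a => (measurable_pi_apply (τ a)).comp hW
  have hcc := fun τ : Fin (m + 1) → Fin n => h.measurable_clusterInd hB s S τ
  set D : Ω → Fin n → ℕ := fun ω i => (nearSet (X ω) s (Metric.closedBall 0 (3 * K)) i).ncard
  -- the two parts of the double sum
  set A : Ω → ℝ≥0∞ := fun ω => ∑ τ : Fin (m + 1) → Fin n, ∑ τ' : Fin (m + 1) → Fin n,
    if ∀ a b, τ a ≠ τ' b then clusterInd (G ω) (X ω) s B S τ * clusterInd (G ω) (X ω) s B S τ'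
    else 0
  have hle : ∀ ω, clusterCount (G ω) (X ω) s B S ^ 2 ≤ (n : ℝ≥0∞)⁻¹ ^ 2 * A ω +
      (n : ℝ≥0∞)⁻¹ * (c * fivePowAverage (X ω) s (Metric.closedBall 0 (3 * K))) := by
    intro ω
    have h1 : clusterCount (G ω) (X ω) s B S ^ 2 = (n : ℝ≥0∞)⁻¹ ^ 2 * (A ω +
        ∑ τ : Fin (m + 1) → Fin n, ∑ τ' : Fin (m + 1) → Fin n, (if ∀ a b, τ a ≠ τ' b then 0 else
          clusterInd (G ω) (X ω) s B S τ * clusterInd (G ω) (X ω) s B S τ')) := by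
      rw [clusterCount, mul_pow, sq (∑ τ, _), Finset.sum_mul_sum, ← Finset.sum_add_distrib]
      congr 1
      refine Finset.sum_congr rfl fun τ _ => ?_
      rw [← Finset.sum_add_distrib]
      refine Finset.sum_congr rfl fun τ' _ => ?_
      split_ifs <;> simp
    rw [h1, mul_add]
    refine add_le_add_right ?_ _
    calc _ ≤ (n : ℝ≥0∞)⁻¹ ^ 2 * ∑ i, (c : ℝ≥0∞) * 5 ^ D ω i := by
          gcongr
          refine (sum_clusterInd_mul_le (G ω) (X ω) s hK S).trans ?_
          exact Finset.sum_le_sum fun i _ => hc _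
      _ = _ := by
          rw [← Finset.mul_sum, fivePowAverage, sq]
          ring
  have hA : ∫⁻ ω, (n : ℝ≥0∞)⁻¹ ^ 2 * A ω ∂P ≤ ∫⁻ ω, clusterAverage α B S (W ω) ^ 2 ∂P := by
    have e2 : ∀ ω, clusterAverage α B S (W ω) ^ 2 = (n : ℝ≥0∞)⁻¹ ^ 2 *
        ∑ τ : Fin (m + 1) → Fin n, ∑ τ' : Fin (m + 1) → Fin n,
          ((n : ℝ≥0∞)⁻¹ ^ m * clusterIntegral α B S ((∑ k, W ω k) / n) (W ω ∘ τ)) *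
          ((n : ℝ≥0∞)⁻¹ ^ m * clusterIntegral α B S ((∑ k, W ω k) / n) (W ω ∘ τ')) := by
      intro ω
      rw [← Finset.sum_mul_sum, ← sq, ← mul_pow, ← Finset.mul_sum, ← mul_assoc, ← pow_succ']
      rfl
    simp_rw [e2]
    rw [lintegral_const_mul, lintegral_const_mul, lintegral_finsetSum, lintegral_finsetSum]
    · refine mul_le_mul_right (Finset.sum_le_sum fun τ _ => ?_) _
      rw [lintegral_finsetSum, lintegral_finsetSum]
      · refine Finset.sum_le_sum fun τ' _ => ?_
        by_cases h0 : ∀ a b, τ a ≠ τ' b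
        swap
        · simp only [if_neg h0, lintegral_zero]; exact zero_le
        simp only [if_pos h0]
        by_cases hτ : Function.Injective τ
        swap
        · simp [clusterInd_of_not_injective _ _ _ _ _ hτ]
        by_cases hτ' : Function.Injective τ'
        swap
        · simp [clusterInd_of_not_injective _ _ _ _ _ hτ']
        rw [h.lintegral_clusterInd_mul hB s hS hτ hτ' h0]
        refine lintegral_mono_ae ?_
        filter_upwards [h.weight_nonneg] with ω hω
        exact mul_le_mul' (boxIntegral_le_clusterIntegral hd hn hB hs hsn S hω τ)
          (boxIntegral_le_clusterIntegral hd hn hB hs hsn S hω τ')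
      · exact fun τ' _ => ((hcI τ).const_mul _).mul ((hcI τ').const_mul _)
      · intro τ' _
        split_ifs
        · exact (hcc τ).mul (hcc τ')
        · exact measurable_const
    · exact fun τ _ => Finset.measurable_sum _ fun τ' _ =>
        ((hcI τ).const_mul _).mul ((hcI τ').const_mul _)
    · intro τ _
      refine Finset.measurable_sum _ fun τ' _ => ?_
      split_ifs
      · exact (hcc τ).mul (hcc τ')
      · exact measurable_const
    · exact Finset.measurable_sum _ fun τ _ => Finset.measurable_sum _ fun τ' _ =>
        ((hcI τ).const_mul _).mul ((hcI τ').const_mul _)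
    · refine Finset.measurable_sum _ fun τ _ => Finset.measurable_sum _ fun τ' _ => ?_
      split_ifs
      · exact (hcc τ).mul (hcc τ')
      · exact measurable_const
  have hfive := h.measurable_fivePowAverage
    (measurableSet_closedBall (x := (0 : EuclideanSpace ℝ (Fin d))) (ε := 3 * K)) s
  refine (lintegral_mono hle).trans ?_
  rw [lintegral_add_right _ ((hfive.const_mul _).const_mul _),
    lintegral_const_mul _ (hfive.const_mul _), lintegral_const_mul _ hfive]
  gcongr
  exact h.lintegral_fivePowAverage_le hd hn measurableSet_closedBall hs hsn

end

/-! ### Convergence in probability of the counts -/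

/-- The scale at which the locations of `n` points have unit density. -/
def girgScale (d n : ℕ) : ℝ := (n : ℝ) ^ (1 / (d : ℝ))

lemma girgScale_pos {d n : ℕ} (hn : n ≠ 0) : 0 < girgScale d n :=
  Real.rpow_pos_of_pos (by positivity) _

lemma girgScale_pow {d n : ℕ} (hd : 1 ≤ d) : girgScale d n ^ d = n := by
  rw [girgScale, ← Real.rpow_mul_natCast (by positivity), one_div, inv_mul_cancel₀, Real.rpow_one]
  exact_mod_cast (by omega : d ≠ 0)

lemma tendsto_girgScale {d : ℕ} (hd : 1 ≤ d) : Tendsto (girgScale d) atTop atTop :=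
  (tendsto_rpow_atTop (by positivity)).comp tendsto_natCast_atTop_atTop

/-- The square expanded with the mixed term on the left, so that no subtraction in `ℝ≥0∞` occurs. -/
lemma ofReal_sq_sub_add {N c : ℝ≥0∞} (hN : N ≠ ∞) (hc : c ≠ ∞) :
    ENNReal.ofReal ((N.toReal - c.toReal) ^ 2) + 2 * c * N = N ^ 2 + c ^ 2 := by
  lift N to ℝ≥0 using hN
  lift c to ℝ≥0 using hc
  rw [← ENNReal.ofReal_coe_nnreal (p := N), ← ENNReal.ofReal_coe_nnreal (p := c),
    ← ENNReal.ofReal_pow (NNReal.coe_nonneg N), ← ENNReal.ofReal_pow (NNReal.coe_nonneg c), ←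
        ENNReal.ofReal_add (by positivity)
    (by positivity), ENNReal.toReal_ofReal (NNReal.coe_nonneg N),
    ENNReal.toReal_ofReal (NNReal.coe_nonneg c),
    (by norm_num : (2 : ℝ≥0∞) = ENNReal.ofReal 2), ← ENNReal.ofReal_mul (by norm_num),
    ← ENNReal.ofReal_mul (by positivity), ← ENNReal.ofReal_add (by positivity) (by positivity)]
  congr 1
  ring

section

variable {Ω : ℕ → Type*} [∀ n, MeasurableSpace (Ω n)] {P : ∀ n, Measure (Ω n)}
  [∀ n, IsProbabilityMeasure (P n)] {α : ℝ≥0∞} {d : ℕ}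
  {X : ∀ n, Ω n → Fin n → EuclideanSpace ℝ (Fin d)} {W : ∀ n, Ω n → Fin n → ℝ}
  {G : ∀ n, Ω n → SimpleGraph (Fin n)}

/-- Chebyshev's inequality around c: the mean of (N - c)² is at most u + c² - 2c E[N], which tends
to 0. Only an upper bound for the second moment is needed. -/
lemma tendstoInProb_of_tendsto_lintegral {N : ∀ n, Ω n → ℝ≥0∞} (hN : ∀ n, Measurable (N n))
    (hN' : ∀ᶠ n in atTop, ∀ ω, N n ω ≠ ∞) {c : ℝ≥0∞} (hc : c ≠ ∞)
    (h1 : Tendsto (fun n => ∫⁻ ω, N n ω ∂(P n)) atTop (𝓝 c))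
    {u : ℕ → ℝ≥0∞} (hu : Tendsto u atTop (𝓝 (c ^ 2)))
    (h2 : ∀ᶠ n in atTop, ∫⁻ ω, N n ω ^ 2 ∂(P n) ≤ u n) :
    TendstoInProb P (fun n ω => (N n ω).toReal) c.toReal := by
  have hv : Tendsto (fun n => ∫⁻ ω, ENNReal.ofReal (((N n ω).toReal - c.toReal) ^ 2) ∂(P n))
      atTop (𝓝 0) := by
    have hlim : Tendsto (fun n => u n + c ^ 2 - 2 * c * ∫⁻ ω, N n ω ∂(P n)) atTop (𝓝 0) := by
      have := ENNReal.Tendsto.sub (hu.add_const (c ^ 2)) (ENNReal.Tendsto.const_mul h1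
        (a := 2 * c) (Or.inr (ENNReal.mul_ne_top (by simp) hc))) (Or.inl
        (by simp [hc]))
      rwa [show c ^ 2 + c ^ 2 - 2 * c * c = 0 by rw [sq, mul_assoc, two_mul, tsub_self]] at this
    refine tendsto_of_tendsto_of_tendsto_of_le_of_le' tendsto_const_nhds hlim
      (Eventually.of_forall fun n => zero_le) ?_
    have h1' : ∀ᶠ n in atTop, ∫⁻ ω, N n ω ∂(P n) ≠ ∞ :=
      (h1.eventually (gt_mem_nhds hc.lt_top)).mono fun n hn => hn.ne
    filter_upwards [hN', h2, h1'] with n hn hn2 hn1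
    have e := lintegral_congr (μ := P n) fun ω => ofReal_sq_sub_add (hn ω) hc
    rw [lintegral_add_right _ ((hN n).const_mul _), lintegral_const_mul _ (hN n),
      lintegral_add_right _ measurable_const, lintegral_const, measure_univ, mul_one] at e
    refine ENNReal.le_sub_of_add_le_right
        (ENNReal.mul_ne_top (ENNReal.mul_ne_top (by simp) hc) hn1) ?_
    rw [e]
    gcongr
  intro ε hε
  have hlim := ENNReal.Tendsto.div_const hv (b := ENNReal.ofReal (ε ^ 2))
    (Or.inr (by simpa using hε.ne'))
  rw [ENNReal.zero_div] at hlim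
  refine tendsto_of_tendsto_of_tendsto_of_le_of_le tendsto_const_nhds hlim
    (fun n => zero_le) fun n => ?_
  refine (measure_mono fun ω hω => ?_).trans (meas_ge_le_lintegral_div (f := fun ω =>
    ENNReal.ofReal (((N n ω).toReal - c.toReal) ^ 2)) ?_ (by simpa using hε.ne')
    ENNReal.ofReal_ne_top)
  · refine ENNReal.ofReal_le_ofReal ?_
    rw [← sq_abs (_ - _)]
    exact pow_le_pow_left₀ hε.le hω 2
  · exact (((hN n).ennreal_toReal.sub_const _).pow_const 2).ennreal_ofReal.aemeasurable

variable {μ : ProbabilityMeasure ℝ}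

/-- Sandwiched between the two first moment bounds: the boundary factor tends to 1, the collision
term to 0, and the averages converge boundedly. -/
theorem tendsto_lintegral_clusterCount (hG : ∀ n, IsGIRG (P n) α d n (X n) (W n) (G n))
    (hd : 1 ≤ d) (hW : Tendsto (empiricalProba W) (probFilter P) (𝓝 μ))
    (hmean : TendstoInProb P (fun n ω => (∑ i, W n ω i) / n) (∫ x, x ∂(μ : Measure ℝ)))
    (hpos : 0 < ∫ x, x ∂(μ : Measure ℝ)) {m : ℕ} {K : ℝ} (hK : 0 ≤ K)
    {S : Finset (Fin (m + 1) × Fin (m + 1))} (hS : S ⊆ potentialEdges m) :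
    Tendsto (fun n => ∫⁻ ω, clusterCount (G n ω) (X n ω) (girgScale d n)
      (Metric.closedBall 0 K) S ∂(P n)) atTop
      (𝓝 (clusterDensity α (Metric.closedBall (0 : EuclideanSpace ℝ (Fin d)) K) S μ)) := by
  set B := Metric.closedBall (0 : EuclideanSpace ℝ (Fin d)) K with hBdef
  have hB : MeasurableSet B := measurableSet_closedBall
  have hB' : volume B ≠ ∞ := measure_closedBall_lt_top.ne
  have hc : clusterDensity α B S μ ≠ ∞ :=
    ((clusterDensity_le α hB S μ).trans_lt (ENNReal.pow_lt_top hB'.lt_top)).ne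
  have hA := tendsto_clusterAverage α hd hB hB' hS hW hmean hpos
  have hAm : ∀ n, Measurable fun ω => clusterAverage α B S (W n ω) := fun n =>
    (measurable_clusterAverage α hB S).comp (hG n).isSIRG.measurable_weight
  have hA1 := tendsto_lintegral_of_tendsto_probFilter hAm (ENNReal.pow_ne_top hB' (n := m))
    (fun n => Eventually.of_forall fun ω => clusterAverage_le α hB S _) hc hA
  have hlow : Tendsto (fun n => ENNReal.ofReal (1 - 2 * K / girgScale d n) ^ d *
      ∫⁻ ω, clusterAverage α B S (W n ω) ∂(P n) - collisionRate m n * volume B ^ m) atTop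
      (𝓝 (clusterDensity α B S μ)) := by
    have t1 : Tendsto (fun n => ENNReal.ofReal (1 - 2 * K / girgScale d n) ^ d) atTop (𝓝 1) := by
      have := ENNReal.Tendsto.pow (n := d) (ENNReal.tendsto_ofReal
        ((tendsto_const_nhds (x := (1 : ℝ))).sub
          ((tendsto_girgScale hd).const_div_atTop (2 * K))))
      simpa using this
    have t2 : Tendsto (fun n => collisionRate m n * volume B ^ m) atTop (𝓝 0) := by
      have := ENNReal.Tendsto.mul_const (tendsto_collisionRate m) (b := volume B ^ m)
        (Or.inr (ENNReal.pow_ne_top hB'))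
      simpa using this
    have t3 := ENNReal.Tendsto.sub (ENNReal.Tendsto.mul t1 (Or.inl one_ne_zero) hA1
      (Or.inr (by simp))) t2 (Or.inr (by simp))
    simpa using t3
  refine tendsto_of_tendsto_of_tendsto_of_le_of_le' hlow hA1 ?_ ?_
  · filter_upwards [eventually_ne_atTop 0] with n hn
    exact tsub_le_iff_right.2 ((hG n).le_lintegral_clusterCount hd hn hB hK le_rfl
      (girgScale_pos hn) (girgScale_pow hd) hS)
  · filter_upwards [eventually_ne_atTop 0] with n hn
    exact (hG n).lintegral_clusterCount_le hd hn hB (girgScale_pos hn) (girgScale_pow hd) hS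

theorem tendstoInProb_clusterCount (hG : ∀ n, IsGIRG (P n) α d n (X n) (W n) (G n))
    (hd : 1 ≤ d) (hW : Tendsto (empiricalProba W) (probFilter P) (𝓝 μ))
    (hmean : TendstoInProb P (fun n ω => (∑ i, W n ω i) / n) (∫ x, x ∂(μ : Measure ℝ)))
    (hpos : 0 < ∫ x, x ∂(μ : Measure ℝ)) {m : ℕ} {K : ℝ} (hK : 0 ≤ K)
    {S : Finset (Fin (m + 1) × Fin (m + 1))} (hS : S ⊆ potentialEdges m) :
    TendstoInProb P (fun n ω => (clusterCount (G n ω) (X n ω) (girgScale d n)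
      (Metric.closedBall 0 K) S).toReal)
      (clusterDensity α (Metric.closedBall (0 : EuclideanSpace ℝ (Fin d)) K) S μ).toReal := by
  set B := Metric.closedBall (0 : EuclideanSpace ℝ (Fin d)) K with hBdef
  have hB : MeasurableSet B := measurableSet_closedBall
  have hB' : volume B ≠ ∞ := measure_closedBall_lt_top.ne
  have hc : clusterDensity α B S μ ≠ ∞ :=
    ((clusterDensity_le α hB S μ).trans_lt (ENNReal.pow_lt_top hB'.lt_top)).ne
  have hA := tendsto_clusterAverage α hd hB hB' hS hW hmean hpos
  have hAm : ∀ n, Measurable fun ω => clusterAverage α B S (W n ω) := fun n =>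
    (measurable_clusterAverage α hB S).comp (hG n).isSIRG.measurable_weight
  have hA2 : Tendsto (fun n => ∫⁻ ω, clusterAverage α B S (W n ω) ^ 2 ∂(P n)) atTop
      (𝓝 (clusterDensity α B S μ ^ 2)) :=
    tendsto_lintegral_of_tendsto_probFilter (M := (volume B ^ m) ^ 2)
      (fun n => (hAm n).pow_const 2) (ENNReal.pow_ne_top (ENNReal.pow_ne_top hB'))
      (fun n => Eventually.of_forall fun ω =>
        pow_le_pow_left₀ zero_le (clusterAverage_le α hB S _) 2)
      (ENNReal.pow_ne_top hc) (ENNReal.Tendsto.pow hA)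
  obtain ⟨c, hcD⟩ := exists_pow_le_five_pow (2 * m + 1)
  have hu : Tendsto (fun n : ℕ => ∫⁻ ω, clusterAverage α B S (W n ω) ^ 2 ∂(P n) +
      (n : ℝ≥0∞)⁻¹ * (c * expMoment (Metric.closedBall (0 : EuclideanSpace ℝ (Fin d)) (3 * K))))
      atTop (𝓝 (clusterDensity α B S μ ^ 2)) := by
    have t := ENNReal.Tendsto.mul_const ENNReal.tendsto_inv_nat_nhds_zero
      (b := c * expMoment (Metric.closedBall (0 : EuclideanSpace ℝ (Fin d)) (3 * K)))
      (Or.inr (ENNReal.mul_ne_top ENNReal.coe_ne_top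
        (expMoment_ne_top measure_closedBall_lt_top.ne)))
    rw [zero_mul] at t
    simpa using hA2.add t
  refine tendstoInProb_of_tendsto_lintegral (fun n => (hG n).measurable_clusterCount hB _ S) ?_ hc
    (tendsto_lintegral_clusterCount hG hd hW hmean hpos hK hS) hu ?_
  · filter_upwards [eventually_ne_atTop 0] with n hn ω
    exact clusterCount_ne_top hn _ _ _ _ _
  · filter_upwards [eventually_ne_atTop 0] with n hn
    exact (hG n).lintegral_clusterCount_sq_le hd hn hK (girgScale_pos hn) (girgScale_pow hd) hS hcD

end

/-! ### Factorial moment measures of the Poisson process -/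

/-- The falling factorial `x (x - 1) ⋯ (x - k + 1)`. -/
def fallingPow (x : ℝ≥0∞) (k : ℕ) : ℝ≥0∞ := ∏ l ∈ Finset.range k, (x - l)

lemma fallingPow_succ (x : ℝ≥0∞) (k : ℕ) : fallingPow x (k + 1) = fallingPow x k * (x - k) :=
  Finset.prod_range_succ _ _

lemma fallingPow_natCast (n k : ℕ) : fallingPow n k = (n.descFactorial k : ℕ) := by
  rw [Nat.descFactorial_eq_prod_range, fallingPow, Nat.cast_prod]
  exact Finset.prod_congr rfl fun l _ => by rw [ENNReal.natCast_sub]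

lemma measurable_fallingPow (k : ℕ) : Measurable fun x => fallingPow x k :=
  Finset.measurable_prod _ fun _ _ => measurable_id.sub_const _

-- Of the values of t, exactly those with f a = j lie in C j, because the sets are disjoint; they
-- are the points to be removed from the count.
open scoped Classical in
lemma tsum_mem_and_notMem_range {V J : Type*} {C : J → Set V}
    (hC : Pairwise fun j k => Disjoint (C j) (C k)) {m : ℕ} {f : Fin m → J} {t : Fin m → V}
    (ht : Function.Injective t) (htC : ∀ a, t a ∈ C (f a)) (j : J) :
    ∑' i, (if i ∈ C j ∧ i ∉ Set.range t then (1 : ℝ≥0∞) else 0) =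
      ∑' i, (C j).indicator 1 i - ((Finset.univ.filter fun a => f a = j).card : ℕ) := by
  set F : Finset V := (Finset.univ.filter fun a => f a = j).image t with hF
  have hcard : F.card = (Finset.univ.filter fun a => f a = j).card :=
    Finset.card_image_of_injective _ ht
  have hmem : ∀ i ∈ C j, i ∈ Set.range t ↔ i ∈ F := by
    intro i hi
    simp only [hF, Finset.mem_image, Finset.mem_filter, Finset.mem_univ, true_and, Set.mem_range]
    constructor
    · rintro ⟨a, rfl⟩
      refine ⟨a, ?_, rfl⟩
      by_contra hne
      exact Set.disjoint_left.1 (hC hne) (htC a) hi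
    · rintro ⟨a, _, rfl⟩
      exact ⟨a, rfl⟩
  have hFC : ∀ i ∈ F, i ∈ C j := by
    intro i hi
    obtain ⟨a, ha, rfl⟩ := Finset.mem_image.1 hi
    rw [← (Finset.mem_filter.1 ha).2]
    exact htC a
  have hsplit : ∀ i, (C j).indicator (1 : V → ℝ≥0∞) i =
      (if i ∈ C j ∧ i ∉ Set.range t then 1 else 0) + if i ∈ F then 1 else 0 := by
    intro i
    by_cases h1 : i ∈ C j
    · rw [Set.indicator_of_mem h1]
      by_cases h2 : i ∈ F
      · rw [if_neg fun h => h.2 ((hmem i h1).2 h2), if_pos h2]; simp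
      · rw [if_pos ⟨h1, fun h => h2 ((hmem i h1).1 h)⟩, if_neg h2]; simp
    · rw [Set.indicator_of_notMem h1, if_neg fun h => h1 h.1, if_neg fun h => h1 (hFC i h)]; simp
  simp_rw [hsplit]
  rw [ENNReal.tsum_add, ← hcard]
  have : ∑' i, (if i ∈ F then (1 : ℝ≥0∞) else 0) = (F.card : ℕ) := by
    rw [tsum_eq_sum (s := F) fun i hi => if_neg hi, Finset.sum_congr rfl fun i hi => if_pos hi]
    simp
  rw [this, ENNReal.add_sub_cancel_right (ENNReal.natCast_ne_top _)]

-- Induction on the length: with the other coordinates fixed, the first one has as many choices as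
-- there are unused points in its set, which extends one falling factorial by one factor.
open scoped Classical in
lemma tsum_injective_and_mem {V J : Type*} [Fintype J] {C : J → Set V}
    (hC : Pairwise fun j k => Disjoint (C j) (C k)) : ∀ {m : ℕ} (f : Fin m → J),
    ∑' t : Fin m → V, (if Function.Injective t ∧ ∀ a, t a ∈ C (f a) then (1 : ℝ≥0∞) else 0) =
      ∏ j, fallingPow (∑' i, (C j).indicator 1 i) (Finset.univ.filter fun a => f a = j).card := by
  intro m
  induction m with
  | zero =>
    intro f
    rw [tsum_fintype]
    simp [fallingPow, Function.injective_of_subsingleton]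
  | succ m ih =>
    intro f
    rw [← (Fin.consEquiv fun _ : Fin (m + 1) => V).tsum_eq, ENNReal.tsum_prod', ENNReal.tsum_comm]
    have h1 : ∀ t : Fin m → V, ∑' i : V, (if Function.Injective
        ((Fin.consEquiv fun _ : Fin (m + 1) => V) (i, t)) ∧
        ∀ a, (Fin.consEquiv fun _ : Fin (m + 1) => V) (i, t) a ∈ C (f a) then (1 : ℝ≥0∞) else 0) =
        (if Function.Injective t ∧ ∀ a, t a ∈ C (f a.succ) then 1 else 0) *
          (∑' i, (C (f 0)).indicator 1 i -
            ((Finset.univ.filter fun a : Fin m => f a.succ = f 0).card : ℕ)) := by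
      intro t
      have h2 : ∀ i, (Function.Injective ((Fin.consEquiv fun _ : Fin (m + 1) => V) (i, t)) ∧
          ∀ a, (Fin.consEquiv fun _ : Fin (m + 1) => V) (i, t) a ∈ C (f a)) ↔
          (Function.Injective t ∧ ∀ a, t a ∈ C (f a.succ)) ∧ (i ∈ C (f 0) ∧ i ∉ Set.range t) := by
        intro i
        have h0 : (Fin.consEquiv fun _ : Fin (m + 1) => V) (i, t) = Fin.cons i t := rfl
        rw [h0, Fin.cons_injective_iff, Fin.forall_fin_succ]
        simp only [Fin.cons_zero, Fin.cons_succ]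
        tauto
      simp_rw [h2]
      by_cases h3 : Function.Injective t ∧ ∀ a, t a ∈ C (f a.succ)
      · rw [if_pos h3, one_mul,
          ← tsum_mem_and_notMem_range hC (f := fun a => f a.succ) h3.1 h3.2 (f 0)]
        simp only [h3, true_and, implies_true]
      · simp only [h3, false_and, if_false, tsum_zero, zero_mul]
    simp_rw [h1]
    rw [ENNReal.tsum_mul_right, ih fun a => f a.succ,
      ← Finset.mul_prod_erase _ _ (Finset.mem_univ (f 0)),
      ← Finset.mul_prod_erase _ _ (Finset.mem_univ (f 0)), Fin.card_filter_univ_succ,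
      if_pos rfl, fallingPow_succ, mul_right_comm]
    congr 1
    refine Finset.prod_congr rfl fun j hj => ?_
    rw [Fin.card_filter_univ_succ, if_neg (Finset.ne_of_mem_erase hj).symm]

lemma fallingPow_mul_poissonMeasure (r : ℝ≥0) (n k : ℕ) :
    fallingPow (n + k : ℕ) k * poissonMeasure r {n + k} =
      (r : ℝ≥0∞) ^ k * ENNReal.ofReal (Real.exp (-r) * r ^ n / n.factorial) := by
  have h1 : ((n + k).factorial : ℝ) = n.factorial * (n + k).descFactorial k := by
    rw [← Nat.cast_mul, Nat.add_descFactorial_eq_ascFactorial, Nat.factorial_mul_ascFactorial]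
  have h0 : ((n + k).descFactorial k : ℝ) ≠ 0 := by
    rw [Nat.cast_ne_zero, Ne, Nat.descFactorial_eq_zero_iff_lt]
    omega
  have h2 : (r : ℝ≥0∞) ^ k = ENNReal.ofReal ((r : ℝ) ^ k) := by
    rw [ENNReal.ofReal_pow (NNReal.coe_nonneg r), ENNReal.ofReal_coe_nnreal]
  rw [fallingPow_natCast, poissonMeasure_singleton, h2, ← ENNReal.ofReal_natCast,
    ← ENNReal.ofReal_mul (by positivity), ← ENNReal.ofReal_mul (by positivity), h1]
  congr 1
  field_simp
  ring

/-- The factorial moment of a Poisson variable: terms with n < k vanish, and the shifted series is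
r^k times the Poisson probabilities. -/
lemma lintegral_fallingPow_poissonMeasure (r : ℝ≥0) (k : ℕ) :
    ∑' n : ℕ, fallingPow n k * poissonMeasure r {n} = (r : ℝ≥0∞) ^ k := by
  have h2 : ∀ n < k, fallingPow n k * poissonMeasure r {n} = 0 := by
    intro n hn
    rw [fallingPow_natCast, Nat.descFactorial_of_lt hn]
    simp
  have h3 := Summable.sum_add_tsum_nat_add' (k := k)
    (f := fun n : ℕ => fallingPow n k * poissonMeasure r {n}) ENNReal.summable
  rw [Finset.sum_eq_zero fun n hn => h2 n (Finset.mem_range.1 hn), zero_add] at h3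
  rw [← h3]
  simp_rw [fallingPow_mul_poissonMeasure]
  rw [ENNReal.tsum_mul_left, ← ENNReal.ofReal_tsum_of_nonneg (fun n => by positivity)
    (hasSum_one_poissonMeasure r).summable, (hasSum_one_poissonMeasure r).tsum_eq,
    ENNReal.ofReal_one, mul_one]

section

variable {Ω : Type*} [MeasurableSpace Ω] {P : Measure Ω} {d : ℕ}
  {Γ : Ω → Measure (EuclideanSpace ℝ (Fin d))}

/-- The prescribed probabilities of natural values add up to 1, so the count, a priori any element
of `ℝ≥0∞`, is almost surely a natural number. -/
lemma IsUnitPoissonProcess.lintegral_comp [IsProbabilityMeasure P] (h : IsUnitPoissonProcess P Γ)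
    {A : Set (EuclideanSpace ℝ (Fin d))} (hA : MeasurableSet A) (hA' : volume A ≠ ∞)
    (hΓ : Measurable fun ω => Γ ω A) (g : ℝ≥0∞ → ℝ≥0∞) :
    ∫⁻ ω, g (Γ ω A) ∂P = ∑' n : ℕ, g n * poissonMeasure (volume A).toNNReal {n} := by
  have hms : ∀ k : ℕ, MeasurableSet {ω | Γ ω A = k} := fun k => hΓ (measurableSet_singleton _)
  have hdisj : Pairwise fun k l : ℕ => Disjoint {ω | Γ ω A = k} {ω | Γ ω A = l} := by
    intro k l hkl
    refine Set.disjoint_left.2 fun ω h1 h2 => hkl ?_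
    have : (k : ℝ≥0∞) = l := (show Γ ω A = k from h1).symm.trans h2
    exact_mod_cast this
  have hfull : ∀ᵐ ω ∂P, ω ∈ ⋃ k : ℕ, {ω | Γ ω A = k} := by
    refine (mem_ae_iff_prob_eq_one (MeasurableSet.iUnion hms)).2 ?_
    rw [measure_iUnion hdisj hms]
    simp_rw [h.count_law A hA hA', poissonMeasure_singleton]
    rw [← ENNReal.ofReal_tsum_of_nonneg (fun n => by positivity)
      (hasSum_one_poissonMeasure _).summable, (hasSum_one_poissonMeasure _).tsum_eq,
      ENNReal.ofReal_one]
  have hr : ∫⁻ ω, g (Γ ω A) ∂P = ∫⁻ ω in ⋃ k : ℕ, {ω | Γ ω A = k}, g (Γ ω A) ∂P := by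
    rw [Measure.restrict_eq_self_of_ae_mem hfull]
  rw [hr, lintegral_iUnion hms hdisj]
  refine tsum_congr fun k => ?_
  rw [← h.count_law A hA hA', setLIntegral_congr_fun (hms k) (g := fun _ => g k)
    fun ω hω => by rw [show Γ ω A = k from hω]]
  simp

lemma IsUnitPoissonProcess.lintegral_prod_fallingPow [IsProbabilityMeasure P]
    (h : IsUnitPoissonProcess P Γ) {J : Type*} [Fintype J]
    {B : J → Set (EuclideanSpace ℝ (Fin d))} (hB : ∀ j, MeasurableSet (B j))
    (hdisj : Pairwise fun j k => Disjoint (B j) (B k))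
    (hΓ : ∀ A, MeasurableSet A → Measurable fun ω => Γ ω A) (k : J → ℕ)
    (hk : ∀ j, k j ≠ 0 → volume (B j) ≠ ∞) :
    ∫⁻ ω, ∏ j, fallingPow (Γ ω (B j)) (k j) ∂P = ∏ j, volume (B j) ^ k j := by
  have hind : iIndepFun (fun j ω => Γ ω (B j)) P := by
    have := h.count_indep _ (fun a => B ((Fintype.equivFin J).symm a)) (fun a => hB _)
      fun a b hab => hdisj ((Fintype.equivFin J).symm.injective.ne hab)
    have := this.precomp (Fintype.equivFin J).injective
    simpa using this
  have hind' := hind.comp (fun j x => fallingPow x (k j)) fun j => measurable_fallingPow _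
  have := lintegral_prod_eq_prod_lintegral_of_indepFun Finset.univ _ hind'
    fun j => (measurable_fallingPow _).comp (hΓ _ (hB j))
  simp only [Function.comp_def] at this
  rw [this]
  refine Finset.prod_congr rfl fun j _ => ?_
  -- Sets of infinite volume, on which the count law is silent, can occur only with exponent 0.
  by_cases hkj : k j = 0
  · simp [hkj, fallingPow]
  · rw [h.lintegral_comp (hB j) (hk j hkj) (hΓ _ (hB j)) fun x => fallingPow x (k j),
      lintegral_fallingPow_poissonMeasure, ENNReal.coe_toNNReal (hk j hkj)]

end

section

variable {Ω : Type*} [MeasurableSpace Ω] {P : Measure Ω} {d : ℕ}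
  {y : Ω → ℕ → EuclideanSpace ℝ (Fin d)}

lemma sum_dirac_apply (z : ℕ → EuclideanSpace ℝ (Fin d)) {A : Set (EuclideanSpace ℝ (Fin d))}
    (hA : MeasurableSet A) :
    Measure.sum (fun i => Measure.dirac (z i)) A = ∑' i, (z ⁻¹' A).indicator 1 i := by
  rw [Measure.sum_apply _ hA]
  refine tsum_congr fun i => ?_
  rw [Measure.dirac_apply' _ hA]
  rfl

lemma measurable_sum_dirac_apply (hy : Measurable y) {A : Set (EuclideanSpace ℝ (Fin d))}
    (hA : MeasurableSet A) :
    Measurable fun ω => Measure.sum (fun i => Measure.dirac (y ω i)) A := by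
  have : ∀ ω, Measure.sum (fun i => Measure.dirac (y ω i)) A =
      ∑' i, A.indicator (1 : EuclideanSpace ℝ (Fin d) → ℝ≥0∞) (y ω i) := fun ω =>
          sum_dirac_apply _ hA
  simp_rw [this]
  exact Measurable.tsum fun i =>
    (measurable_one.indicator hA).comp ((measurable_pi_apply i).comp hy)

/-- The intensity measure of the tuples of distinct points. -/
def factorialMeasure (P : Measure Ω) (y : Ω → ℕ → EuclideanSpace ℝ (Fin d)) (m : ℕ) :
    Measure (Fin m → EuclideanSpace ℝ (Fin d)) :=
  Measure.sum fun t : {t : Fin m → ℕ // Function.Injective t} => P.map fun ω a => y ω (t.1 a)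

lemma lintegral_factorialMeasure (hy : Measurable y) {m : ℕ}
    {H : (Fin m → EuclideanSpace ℝ (Fin d)) → ℝ≥0∞} (hH : Measurable H) :
    ∫⁻ x, H x ∂(factorialMeasure P y m) = ∑' t : {t : Fin m → ℕ // Function.Injective t},
      ∫⁻ ω, H (fun a => y ω (t.1 a)) ∂P := by
  rw [factorialMeasure, lintegral_sum_measure]
  refine tsum_congr fun t => lintegral_map hH ?_
  exact measurable_pi_lambda _ fun a => (measurable_pi_apply _).comp hy

lemma lintegral_factorialMeasure' (hy : Measurable y) {m : ℕ}
    {H : (Fin m → EuclideanSpace ℝ (Fin d)) → ℝ≥0∞} (hH : Measurable H) :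
    ∫⁻ x, H x ∂(factorialMeasure P y m) = ∫⁻ ω, ∑' t : {t : Fin m → ℕ // Function.Injective t},
      H (fun a => y ω (t.1 a)) ∂P := by
  rw [lintegral_factorialMeasure hy hH, lintegral_tsum fun t => Measurable.aemeasurable ?_]
  exact hH.comp (measurable_pi_lambda _ fun a => (measurable_pi_apply _).comp hy)

/-- When sides are equal or disjoint, the number of tuples of distinct points in the rectangle is a
product of falling factorials of independent Poisson counts. -/
lemma factorialMeasure_pi_comp [IsProbabilityMeasure P] (hy : Measurable y)
    (h : IsUnitPoissonProcess P fun ω => Measure.sum fun i => Measure.dirac (y ω i)) {m : ℕ}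
    {J : Type*} [Fintype J] {B : J → Set (EuclideanSpace ℝ (Fin d))} (hB : ∀ j, MeasurableSet (B j))
    (hdisj : Pairwise fun j k => Disjoint (B j) (B k)) (f : Fin m → J)
    (hf : ∀ a, volume (B (f a)) ≠ ∞) :
    factorialMeasure P y m (Set.univ.pi fun a => B (f a)) = ∏ a, volume (B (f a)) := by
  classical
  have hms : MeasurableSet (Set.univ.pi fun a => B (f a)) :=
    MeasurableSet.univ_pi fun a => hB (f a)
  rw [← lintegral_indicator_one hms, lintegral_factorialMeasure' hy (measurable_one.indicator hms)]
  have h1 : ∀ ω, ∑' t : {t : Fin m → ℕ // Function.Injective t},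
      (Set.univ.pi fun a => B (f a)).indicator
        (1 : (Fin m → EuclideanSpace ℝ (Fin d)) → ℝ≥0∞) (fun a => y ω (t.1 a)) =
      ∏ j, fallingPow (Measure.sum (fun i => Measure.dirac (y ω i)) (B j))
        (Finset.univ.filter fun a => f a = j).card := by
    intro ω
    have h2 := tsum_injective_and_mem (C := fun j => y ω ⁻¹' (B j))
      (fun j k hjk => (hdisj hjk).preimage _) f
    simp_rw [sum_dirac_apply _ (hB _)]
    rw [← h2]
    refine (tsum_subtype {t : Fin m → ℕ | Function.Injective t} fun t =>
      (Set.univ.pi fun a => B (f a)).indicator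
        (1 : (Fin m → EuclideanSpace ℝ (Fin d)) → ℝ≥0∞) (fun a => y ω (t a))).trans
      (tsum_congr fun t => ?_)
    by_cases h3 : Function.Injective t
    · rw [Set.indicator_of_mem (by exact h3)]
      by_cases h4 : ∀ a, y ω (t a) ∈ B (f a)
      · rw [Set.indicator_of_mem (by simpa using h4), if_pos ⟨h3, h4⟩]; rfl
      · rw [Set.indicator_of_notMem (by simpa using h4), if_neg fun h => h4 h.2]
    · rw [Set.indicator_of_notMem (by exact h3), if_neg fun h => h3 h.1]
  simp_rw [h1]
  rw [h.lintegral_prod_fallingPow hB hdisj (fun A hA => measurable_sum_dirac_apply hy hA)]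
  · have := Finset.prod_fiberwise' Finset.univ f fun j => volume (B j)
    rw [← this]
    exact Finset.prod_congr rfl fun j _ => by rw [Finset.prod_const]
  · intro j hj
    obtain ⟨a, ha⟩ := Finset.card_pos.1 (Nat.pos_of_ne_zero hj)
    rw [← (Finset.mem_filter.1 ha).2]
    exact hf a

/-- A general rectangle splits into disjoint rectangles whose sides are atoms, hence pairwise equal
or disjoint, and both measures are additive. -/
lemma factorialMeasure_pi [IsProbabilityMeasure P] (hy : Measurable y)
    (h : IsUnitPoissonProcess P fun ω => Measure.sum fun i => Measure.dirac (y ω i)) {m : ℕ}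
    {s : Fin m → Set (EuclideanSpace ℝ (Fin d))} (hs : ∀ a, MeasurableSet (s a))
    (hs' : ∀ a, volume (s a) ≠ ∞) :
    factorialMeasure P y m (Set.univ.pi s) = ∏ a, volume (s a) := by
  classical
  -- the atoms of the algebra generated by the sides of the rectangle
  set B : Finset (Fin m) → Set (EuclideanSpace ℝ (Fin d)) := fun σ => {x | ∀ a, x ∈ s a ↔ a ∈ σ}
    with hBdef
  have hB : ∀ σ, MeasurableSet (B σ) := by
    intro σ
    have : B σ = ⋂ a, {x | x ∈ s a ↔ a ∈ σ} := by ext; simp [hBdef]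
    rw [this]
    refine MeasurableSet.iInter fun a => ?_
    by_cases ha : a ∈ σ
    · simp only [ha, iff_true]; exact hs a
    · simp only [ha, iff_false]; exact (hs a).compl
  have hdisj : Pairwise fun σ σ' => Disjoint (B σ) (B σ') := by
    intro σ σ' hne
    refine Set.disjoint_left.2 fun x h1 h2 => hne ?_
    ext a
    exact (h1 a).symm.trans (h2 a)
  have hunion : ∀ a, s a = ⋃ σ ∈ Finset.univ.filter (fun σ : Finset (Fin m) => a ∈ σ), B σ := by
    intro a
    ext x
    simp only [Set.mem_iUnion, Finset.mem_filter, Finset.mem_univ, true_and, exists_prop]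
    constructor
    · intro hx
      exact ⟨Finset.univ.filter fun a => x ∈ s a, by simpa using hx, fun b => by simp⟩
    · rintro ⟨σ, hσ, hx⟩
      exact (hx a).2 hσ
  have hBs : ∀ a σ, a ∈ σ → B σ ⊆ s a := fun a σ ha x hx => (hx a).2 ha
  set T : Finset (Fin m → Finset (Fin m)) :=
    Fintype.piFinset fun a => Finset.univ.filter (fun σ : Finset (Fin m) => a ∈ σ)
  have hT : ∀ f ∈ T, ∀ a, a ∈ f a := fun f hf a =>
    (Finset.mem_filter.1 (Fintype.mem_piFinset.1 hf a)).2
  have hpi : Set.univ.pi s = ⋃ f ∈ T, Set.univ.pi fun a => B (f a) := by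
    ext x
    simp only [Set.mem_univ_pi, Set.mem_iUnion, exists_prop]
    constructor
    · intro hx
      refine ⟨fun a => Finset.univ.filter fun b => x a ∈ s b, Fintype.mem_piFinset.2 fun a => ?_,
        fun a b => by simp⟩
      simpa using hx a
    · rintro ⟨f, hf, hx⟩ a
      exact hBs a _ (hT f hf a) (hx a)
  rw [hpi, measure_biUnion_finset]
  · have h1 : ∀ f ∈ T, factorialMeasure P y m (Set.univ.pi fun a => B (f a)) =
        ∏ a, volume (B (f a)) := fun f hf => factorialMeasure_pi_comp hy h hB hdisj f fun a =>
      ne_top_of_le_ne_top (hs' a) (measure_mono (hBs a _ (hT f hf a)))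
    rw [Finset.sum_congr rfl h1]
    have h2 : ∀ a, volume (s a) =
        ∑ σ ∈ Finset.univ.filter (fun σ : Finset (Fin m) => a ∈ σ), volume (B σ) := by
      intro a
      rw [hunion a, measure_biUnion_finset (fun σ _ σ' _ hne => hdisj hne) fun σ _ => hB σ]
    rw [Finset.prod_congr rfl fun a _ => h2 a, Finset.prod_univ_sum]
  · intro f _ g _ hne
    obtain ⟨a, ha⟩ := Function.ne_iff.1 hne
    refine Set.disjoint_left.2 fun x h1 h2 => ?_
    exact Set.disjoint_left.1 (hdisj ha) (h1 a (Set.mem_univ a)) (h2 a (Set.mem_univ a))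
  · exact fun f _ => MeasurableSet.univ_pi fun a => hB _

/-- Rectangles with sides of finite volume determine the measure. This yields the Campbell formula:
expected sums over tuples of distinct points are Lebesgue integrals. -/
theorem factorialMeasure_eq_volume [IsProbabilityMeasure P] (hy : Measurable y)
    (h : IsUnitPoissonProcess P fun ω => Measure.sum fun i => Measure.dirac (y ω i)) (m : ℕ) :
    factorialMeasure P y m = volume := by
  symm
  rw [volume_pi]
  refine Measure.pi_eq_generateFrom
    (C := fun _ => {s : Set (EuclideanSpace ℝ (Fin d)) | MeasurableSet s ∧ volume s ≠ ∞})
    (fun _ => ?_) (fun _ => ?_) (fun _ => ?_) ?_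
  · refine le_antisymm (MeasurableSpace.generateFrom_le fun s hs => hs.1) fun s hs => ?_
    have : s = ⋃ k : ℕ, s ∩ Metric.closedBall 0 k := by
      rw [← Set.inter_iUnion, Metric.iUnion_closedBall_nat, Set.inter_univ]
    rw [this]
    refine MeasurableSet.iUnion fun k => MeasurableSpace.measurableSet_generateFrom
      ⟨hs.inter measurableSet_closedBall, ?_⟩
    exact ne_top_of_le_ne_top measure_closedBall_lt_top.ne (measure_mono Set.inter_subset_right)
  · rintro s hs t ht -
    exact ⟨hs.1.inter ht.1, ne_top_of_le_ne_top hs.2 (measure_mono Set.inter_subset_left)⟩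
  · exact ⟨fun k : ℕ => Metric.closedBall 0 k, fun k => ⟨measurableSet_closedBall,
      measure_closedBall_lt_top.ne⟩, fun k => measure_closedBall_lt_top,
      Metric.iUnion_closedBall_nat 0⟩
  · exact fun s hs => factorialMeasure_pi hy h (fun a => (hs a).1) fun a => (hs a).2

end

/-! ### Moments of cluster counts in the infinite GIRG -/

lemma finite_of_tsum_indicator_ne_top {V : Type*} {C : Set V}
    (h : ∑' i, C.indicator (1 : V → ℝ≥0∞) i ≠ ∞) : C.Finite := by
  rw [← tsum_subtype] at h
  by_contra hC
  have : Infinite C := Set.infinite_coe_iff.2 hC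
  exact h (ENNReal.tsum_const_eq_top_of_ne_zero one_ne_zero)

/-- The single edge from the root. -/
def rootEdge : Finset (Fin (1 + 1) × Fin (1 + 1)) := {(0, 1)}

lemma rootEdge_subset : rootEdge ⊆ potentialEdges 1 := by
  intro e he
  rw [rootEdge, Finset.mem_singleton] at he
  subst he
  exact Finset.mem_filter.2 ⟨Finset.mem_univ _, by decide⟩

lemma edgeProd_rootEdge {d : ℕ} (κ : ℝ → ℝ → ℝ → ℝ) (x : Fin (1 + 1) → EuclideanSpace ℝ (Fin d))
    (w : Fin (1 + 1) → ℝ) :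
    edgeProd κ rootEdge x w = ENNReal.ofReal (κ ‖x 0 - x 1‖ (w 0) (w 1)) :=
  Finset.prod_singleton _ _

open scoped Classical in
lemma edgeInd_rootEdge {V : Type*} (G : SimpleGraph V) (t : Fin (1 + 1) → V) :
    edgeInd G rootEdge t = if G.Adj (t 0) (t 1) then 1 else 0 := by
  simp [edgeInd, rootEdge]

lemma lintegral_fin_one {E : Type*} [MeasureSpace E] [SigmaFinite (volume : Measure E)]
    {f : E → ℝ≥0∞} (hf : Measurable f) : ∫⁻ y : Fin 1 → E, f (y 0) = ∫⁻ y, f y :=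
  (volume_preserving_funUnique (Fin 1) E).lintegral_comp hf

lemma lintegral_edgeProd_rootEdge {α : ℝ≥0∞} (hα : 1 < α) {d : ℕ} (hd : 1 ≤ d) {L : ℝ}
    {v : Fin (1 + 1) → ℝ} (h : 0 ≤ v 0 * v 1 / L) (x₀ : EuclideanSpace ℝ (Fin d)) :
    ∫⁻ y : Fin 1 → EuclideanSpace ℝ (Fin d),
      edgeProd (girgKernel α d L) rootEdge (Fin.cons x₀ y) v =
      kernelMass α d * ENNReal.ofReal (v 0 * v 1 / L) := by
  simp_rw [edgeProd_rootEdge]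
  rw [← lintegral_girgKernel hα hd h]
  have hm : Measurable fun z : EuclideanSpace ℝ (Fin d) =>
      ENNReal.ofReal (girgKernel α d L ‖z‖ (v 0) (v 1)) :=
    (measurable_girgKernel α d measurable_const measurable_norm measurable_const
      measurable_const).ennreal_ofReal
  refine (lintegral_fin_one (f := fun z : EuclideanSpace ℝ (Fin d) =>
    ENNReal.ofReal (girgKernel α d L ‖x₀ - z‖ (v 0) (v 1))) ?_).trans ?_
  · exact hm.comp (measurable_const.sub measurable_id)
  · exact lintegral_sub_left_eq_self (fun z => ENNReal.ofReal (girgKernel α d L ‖z‖ (v 0) (v 1))) x₀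

lemma clusterIntegral_rootEdge {α : ℝ≥0∞} (hα : 1 < α) {d : ℕ} (hd : 1 ≤ d) {L : ℝ}
    {v : Fin (1 + 1) → ℝ} (h : 0 ≤ v 0 * v 1 / L) :
    clusterIntegral α (Set.univ : Set (EuclideanSpace ℝ (Fin d))) rootEdge L v =
      kernelMass α d * ENNReal.ofReal (v 0 * v 1 / L) := by
  rw [← lintegral_edgeProd_rootEdge hα hd h 0, clusterIntegral]
  simp

/-- Two independent weights give E[W]² / E[W] = E[W]. -/
lemma lintegral_pi_mul {μ : Measure ℝ} [IsProbabilityMeasure μ] (hμ0 : ∀ᵐ x ∂μ, 0 ≤ x)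
    (hμ : Integrable (fun x : ℝ => x) μ) :
    ∫⁻ v : Fin (1 + 1) → ℝ, ENNReal.ofReal (v 0 * v 1 / ∫ x, x ∂μ) ∂(Measure.pi fun _ => μ) =
      ENNReal.ofReal (∫ x, x ∂μ) := by
  set L := ∫ x, x ∂μ with hL
  have hL0 : 0 ≤ L := integral_nonneg_of_ae hμ0
  have h1 := lintegral_prod_mul (μ := μ) (ν := μ) (f := fun x => ENNReal.ofReal x)
    (g := fun x => ENNReal.ofReal x) ENNReal.measurable_ofReal.aemeasurable
    ENNReal.measurable_ofReal.aemeasurable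
  rw [← ofReal_integral_eq_lintegral_ofReal hμ hμ0, ← hL] at h1
  have h2 := (measurePreserving_finTwoArrow μ).lintegral_comp
    (f := fun p : ℝ × ℝ => ENNReal.ofReal p.1 * ENNReal.ofReal p.2) (by fun_prop)
  rw [h1] at h2
  have h3 : ∀ᵐ v ∂(Measure.pi fun _ : Fin (1 + 1) => μ), ENNReal.ofReal (v 0 * v 1 / L) =
      ENNReal.ofReal L⁻¹ * (ENNReal.ofReal (v 0) * ENNReal.ofReal (v 1)) := by
    filter_upwards [ae_pi_nonneg hμ0 (Fin (1 + 1))] with v hv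
    rw [← ENNReal.ofReal_mul (hv 0), ← ENNReal.ofReal_mul (inv_nonneg.2 hL0), div_eq_inv_mul]
  rw [lintegral_congr_ae h3, lintegral_const_mul _ (by fun_prop)]
  refine (congrArg (ENNReal.ofReal L⁻¹ * ·) h2).trans ?_
  rw [← ENNReal.ofReal_mul hL0, ← ENNReal.ofReal_mul (inv_nonneg.2 hL0)]
  congr 1
  -- The mean may be 0, since the identity is also used for empirical measures; with division by 0
  -- equal to 0 both sides vanish.
  by_cases h0 : L = 0
  · simp [h0]
  · field_simp

/-- The expected degree of the root. It is finite, and it depends on the weight law through the mean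
alone. -/
lemma clusterDensity_rootEdge {α : ℝ≥0∞} (hα : 1 < α) {d : ℕ} (hd : 1 ≤ d) {μ : Measure ℝ}
    [IsProbabilityMeasure μ] (hμ0 : ∀ᵐ x ∂μ, 0 ≤ x) (hμ : Integrable (fun x : ℝ => x) μ) :
    clusterDensity α (Set.univ : Set (EuclideanSpace ℝ (Fin d))) rootEdge μ =
      kernelMass α d * ENNReal.ofReal (∫ x, x ∂μ) := by
  rw [clusterDensity, ← lintegral_pi_mul hμ0 hμ, ← lintegral_const_mul _ (by fun_prop)]
  refine lintegral_congr_ae ?_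
  filter_upwards [ae_pi_nonneg hμ0 (Fin (1 + 1))] with v hv
  exact clusterIntegral_rootEdge hα hd
    (div_nonneg (mul_nonneg (hv 0) (hv 1)) (integral_nonneg_of_ae hμ0))

section

variable {Ω : Type*} [MeasurableSpace Ω] {P : Measure Ω} {α : ℝ≥0∞} {d : ℕ} {μ : Measure ℝ}
  {Y : Ω → ℕ → EuclideanSpace ℝ (Fin d)} {W : Ω → ℕ → ℝ} {G : Ω → SimpleGraph ℕ}

lemma IsInfiniteGIRG.ae_weight_nonneg (h : IsInfiniteGIRG P α d μ Y W G)
    (hμ0 : ∀ᵐ x ∂μ, 0 ≤ x) : ∀ᵐ ω ∂P, ∀ i, 0 ≤ W ω i := by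
  rw [ae_all_iff]
  intro i
  rw [← h.weight_law i] at hμ0
  exact ae_of_ae_map ((measurable_pi_apply i).comp h.isSIRG.measurable_weight).aemeasurable hμ0

lemma IsInfiniteGIRG.lintegral_edgeInd [IsProbabilityMeasure P] [IsProbabilityMeasure μ]
    (h : IsInfiniteGIRG P α d μ Y W G) (hμ0 : ∀ᵐ x ∂μ, 0 ≤ x) {J : Type*} [Fintype J] {t : J → ℕ}
    (ht : Function.Injective t) {S : Finset (J × J)} (hS : ∀ e ∈ S, e.1 ≠ e.2 ∧ e.swap ∉ S)
    {f : (ℕ → EuclideanSpace ℝ (Fin d)) → ℝ≥0∞} (hf : Measurable f) :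
    ∫⁻ ω, f (Y ω) * edgeInd (G ω) S t ∂P = ∫⁻ ω, f (Y ω) * ∫⁻ v,
      edgeProd (girgKernel α d (∫ x, x ∂μ)) S (fun j => Y ω (t j)) v
          ∂(Measure.pi fun _ => μ) ∂P := by
  have hY := h.isSIRG.measurable_location
  have hW : ∀ i, Measurable fun ω => W ω i := fun i =>
    (measurable_pi_apply i).comp h.isSIRG.measurable_weight
  have hnonneg : ∀ᵐ ω ∂P, ∀ i j,
      0 ≤ girgKernel α d (∫ x, x ∂μ) ‖Y ω i - Y ω j‖ (W ω i) (W ω j) := by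
    filter_upwards [h.ae_weight_nonneg hμ0] with ω hω i j
    exact SpatialGraph.girgKernel_nonneg α d
      (div_nonneg (mul_nonneg (hω i) (hω j)) (integral_nonneg_of_ae hμ0)) (norm_nonneg _)
  rw [h.isSIRG.lintegral_edgeInd hnonneg (fun _ t x y => girgKernel_comm α d _ t x y) ht hS
    (f := fun p => f p.1) (hf.comp measurable_fst)]
  have hWt : Measurable fun ω => fun j => W ω (t j) := measurable_pi_lambda _ fun j => hW _
  have hlaw : P.map (fun ω => fun j => W ω (t j)) = Measure.pi fun _ : J => μ := by
    have h1 := h.indep_weights.precomp ht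
    rw [iIndepFun_iff_map_fun_eq_pi_map fun j => (hW _).aemeasurable] at h1
    rw [h1]
    congr 1
    ext1 j
    exact h.weight_law _
  have hind : IndepFun Y (fun ω => fun j => W ω (t j)) P :=
    h.indep_location_weight.comp (φ := id) (ψ := fun w : ℕ → ℝ => fun j => w (t j))
      measurable_id (measurable_pi_lambda _ fun j => measurable_pi_apply _)
  rw [indepFun_iff_map_prod_eq_prod_map_map hY.aemeasurable hWt.aemeasurable, hlaw] at hind
  have hmap : IsProbabilityMeasure (P.map Y) := Measure.isProbabilityMeasure_map hY.aemeasurable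
  set F : (ℕ → EuclideanSpace ℝ (Fin d)) × (J → ℝ) → ℝ≥0∞ := fun p =>
    f p.1 * edgeProd (girgKernel α d (∫ x, x ∂μ)) S (fun j => p.1 (t j)) p.2 with hF
  have hE : Measurable fun p : (ℕ → EuclideanSpace ℝ (Fin d)) × (J → ℝ) =>
      edgeProd (girgKernel α d (∫ x, x ∂μ)) S (fun j => p.1 (t j)) p.2 :=
    measurable_edgeProd α S measurable_const (measurable_pi_lambda _ fun j =>
      (measurable_pi_apply _).comp measurable_fst) measurable_snd
  have hFm : Measurable F := (hf.comp measurable_fst).mul hE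
  calc _ = ∫⁻ p, F p ∂(P.map fun ω => (Y ω, fun j => W ω (t j))) :=
        (lintegral_map hFm (hY.prodMk hWt)).symm
    _ = ∫⁻ y, ∫⁻ v, F (y, v) ∂(Measure.pi fun _ => μ) ∂(P.map Y) := by
        rw [hind, lintegral_prod _ hFm.aemeasurable]
    _ = ∫⁻ ω, ∫⁻ v, F (Y ω, v) ∂(Measure.pi fun _ => μ) ∂P :=
        lintegral_map hFm.lintegral_prod_right' hY
    _ = _ := by
        refine lintegral_congr fun ω => ?_
        have hEω : Measurable fun v => edgeProd (girgKernel α d (∫ x, x ∂μ)) S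
            (fun j => Y ω (t j)) v :=
          measurable_edgeProd α S measurable_const measurable_const measurable_id
        exact lintegral_const_mul (f (Y ω)) hEω

/-- A tuple of vertices other than the root, preceded by the root. -/
def rootedTuple {m : ℕ} (t : Fin m → ℕ) : Fin (m + 1) → ℕ := Fin.cons 0 fun a => t a + 1

lemma rootedTuple_injective {m : ℕ} {t : Fin m → ℕ} (ht : Function.Injective t) :
    Function.Injective (rootedTuple t) := by
  rw [rootedTuple, Fin.cons_injective_iff]
  refine ⟨by simp, fun a b hab => ht (by simpa using hab)⟩

/-- Tuples avoiding the root are shifted by one, since the Poisson points are numbered 1, 2, … as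
vertices. -/
lemma homCount_eq_tsum_rootedTuple (g : SimpleGraph ℕ) (x : ℕ → EuclideanSpace ℝ (Fin d)) {m : ℕ}
    (B : Set (EuclideanSpace ℝ (Fin d))) (S : Finset (Fin (m + 1) × Fin (m + 1))) :
    homCount g 0 (nearSet x 1 B 0) S = ∑' t : {t : Fin m → ℕ // Function.Injective t},
      clusterInd g x 1 B S (rootedTuple t.1) := by
  classical
  have h1 : homCount g 0 (nearSet x 1 B 0) S =
      ∑' t : Fin m → ℕ, clusterInd g x 1 B S (Fin.cons 0 t) :=
    tsum_congr fun t => (clusterInd_cons g x 1 B S 0 t).symm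
  have hinj : Function.Injective fun t : {t : Fin m → ℕ // Function.Injective t} =>
      fun a => t.1 a + 1 := by
    intro t t' h
    refine Subtype.ext (funext fun a => ?_)
    simpa using congrFun h a
  rw [h1, ← hinj.tsum_eq]
  · rfl
  · intro t ht
    have hi : Function.Injective (Fin.cons 0 t : Fin (m + 1) → ℕ) := by
      by_contra hi
      exact ht (clusterInd_of_not_injective g x 1 B S hi)
    rw [Fin.cons_injective_iff] at hi
    have h0 : ∀ a, t a ≠ 0 := fun a h => hi.1 ⟨a, h⟩
    refine ⟨⟨fun a => t a - 1, fun a b hab => hi.2 ?_⟩, funext fun a => ?_⟩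
    · have := h0 a
      have := h0 b
      simp only at hab
      omega
    · have := h0 a
      simp only
      omega

lemma IsInfiniteGIRG.measurable_clusterInd (h : IsInfiniteGIRG P α d μ Y W G) {m : ℕ}
    {B : Set (EuclideanSpace ℝ (Fin d))} (hB : MeasurableSet B) (s : ℝ)
    (S : Finset (Fin (m + 1) × Fin (m + 1))) (τ : Fin (m + 1) → ℕ) :
    Measurable fun ω => clusterInd (G ω) (Y ω) s B S τ := by
  by_cases hτ : Function.Injective τ
  · simp_rw [clusterInd_eq _ _ _ _ _ hτ]
    refine Measurable.mul ((measurable_closeInd hB s).comp ?_) (h.isSIRG.measurable_edgeInd S τ)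
    exact measurable_pi_lambda _ fun a =>
      (measurable_pi_apply (τ a)).comp h.isSIRG.measurable_location
  · simp_rw [clusterInd_of_not_injective _ _ _ _ _ hτ]
    exact measurable_const

lemma IsInfiniteGIRG.measurable_homCount (h : IsInfiniteGIRG P α d μ Y W G) {m : ℕ}
    {B : Set (EuclideanSpace ℝ (Fin d))} (hB : MeasurableSet B)
    (S : Finset (Fin (m + 1) × Fin (m + 1))) :
    Measurable fun ω => homCount (G ω) 0 (nearSet (Y ω) 1 B 0) S := by
  simp_rw [homCount_eq_tsum_rootedTuple]
  exact Measurable.tsum fun t => h.measurable_clusterInd hB 1 S _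

lemma IsInfiniteGIRG.lintegral_tsum_injective [IsProbabilityMeasure P]
    (h : IsInfiniteGIRG P α d μ Y W G) {m : ℕ}
    {H : (Fin m → EuclideanSpace ℝ (Fin d)) → ℝ≥0∞} (hH : Measurable H) :
    ∑' t : {t : Fin m → ℕ // Function.Injective t}, ∫⁻ ω, H (fun a => Y ω (t.1 a + 1)) ∂P =
      ∫⁻ y, H y := by
  have hy : Measurable fun ω => fun i => Y ω (i + 1) :=
    measurable_pi_lambda _ fun i => (measurable_pi_apply _).comp h.isSIRG.measurable_location
  rw [← factorialMeasure_eq_volume hy h.poisson_location m, lintegral_factorialMeasure hy hH]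

variable [IsProbabilityMeasure P] [IsProbabilityMeasure μ]

/-- For each tuple the edges and then the weights are integrated out; the sum over tuples becomes a
Lebesgue integral by the Campbell formula, and Fubini restores the order in `clusterDensity`. B may
have infinite volume. -/
theorem IsInfiniteGIRG.lintegral_homCount (h : IsInfiniteGIRG P α d μ Y W G)
    (hμ0 : ∀ᵐ x ∂μ, 0 ≤ x) {m : ℕ} {B : Set (EuclideanSpace ℝ (Fin d))} (hB : MeasurableSet B)
    {S : Finset (Fin (m + 1) × Fin (m + 1))} (hS : S ⊆ potentialEdges m) :
    ∫⁻ ω, homCount (G ω) 0 (nearSet (Y ω) 1 B 0) S ∂P = clusterDensity α B S μ := by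
  simp_rw [homCount_eq_tsum_rootedTuple]
  rw [lintegral_tsum fun t => (h.measurable_clusterInd hB 1 S _).aemeasurable]
  set κ := girgKernel α d (∫ x, x ∂μ) with hκ
  set H : (Fin m → EuclideanSpace ℝ (Fin d)) → ℝ≥0∞ := fun y =>
    closeInd 1 B (Fin.cons 0 y : Fin (m + 1) → EuclideanSpace ℝ (Fin d)) *
      ∫⁻ v, edgeProd κ S (Fin.cons 0 y) v ∂(Measure.pi fun _ => μ) with hH
  have hE : Measurable fun p : (Fin m → EuclideanSpace ℝ (Fin d)) × (Fin (m + 1) → ℝ) =>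
      edgeProd κ S (Fin.cons 0 p.1) p.2 :=
    measurable_edgeProd α S measurable_const (measurable_cons_zero.comp measurable_fst)
      measurable_snd
  have hC : Measurable fun y : Fin m → EuclideanSpace ℝ (Fin d) =>
      closeInd 1 B (Fin.cons 0 y : Fin (m + 1) → EuclideanSpace ℝ (Fin d)) :=
    (measurable_closeInd hB 1).comp measurable_cons_zero
  have hHm : Measurable H := hC.mul hE.lintegral_prod_right'
  have h1 : ∀ t : {t : Fin m → ℕ // Function.Injective t},
      ∫⁻ ω, clusterInd (G ω) (Y ω) 1 B S (rootedTuple t.1) ∂P =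
        ∫⁻ ω, H (fun a => Y ω (t.1 a + 1)) ∂P := by
    intro t
    have hinj := rootedTuple_injective t.2
    simp_rw [clusterInd_eq _ _ _ _ _ hinj]
    rw [h.lintegral_edgeInd hμ0 hinj (ne_and_swap_notMem_of_subset_potentialEdges hS)
      (f := fun y => closeInd 1 B fun a => y (rootedTuple t.1 a)) ((measurable_closeInd hB 1).comp
        (measurable_pi_lambda _ fun a => measurable_pi_apply _))]
    refine lintegral_congr fun ω => ?_
    have e : (fun a => Y ω (rootedTuple t.1 a)) = Fin.cons 0 fun a => Y ω (t.1 a + 1) := by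
      funext a
      refine Fin.cases ?_ (fun a => ?_) a
      · exact h.location_zero ω
      · rfl
    rw [e]
  rw [tsum_congr h1, h.lintegral_tsum_injective hHm, clusterDensity]
  have h2 : ∀ y, H y = ∫⁻ v, (Set.univ.pi fun _ => B).indicator
      (fun y => edgeProd κ S (Fin.cons 0 y) v) y ∂(Measure.pi fun _ => μ) := by
    intro y
    by_cases hy : ∀ a, y a ∈ B
    · have hy' : y ∈ Set.univ.pi fun _ : Fin m => B := by simpa using hy
      simp_rw [Set.indicator_of_mem hy']
      have hc : closeInd 1 B (Fin.cons 0 y : Fin (m + 1) → EuclideanSpace ℝ (Fin d)) = 1 :=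
        Set.indicator_of_mem (by simpa using hy) _
      simp only [hH, hc, one_mul]
    · have hy' : y ∉ Set.univ.pi fun _ : Fin m => B := by simpa using hy
      simp_rw [Set.indicator_of_notMem hy']
      have hc : closeInd 1 B (Fin.cons 0 y : Fin (m + 1) → EuclideanSpace ℝ (Fin d)) = 0 :=
        Set.indicator_of_notMem (by simpa using hy) _
      simp only [hH, hc, zero_mul, lintegral_zero]
  simp_rw [h2]
  refine lintegral_lintegral_swap ?_
  refine Measurable.aemeasurable ?_
  have : (Function.uncurry fun (y : Fin m → EuclideanSpace ℝ (Fin d)) (v : Fin (m + 1) → ℝ) =>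
      (Set.univ.pi fun _ => B).indicator (fun y => edgeProd κ S (Fin.cons 0 y) v) y) =
      (Prod.fst ⁻¹' Set.univ.pi fun _ => B).indicator fun p =>
          edgeProd κ S (Fin.cons 0 p.1) p.2 := by
    ext p
    rfl
  rw [this]
  exact hE.indicator (measurable_fst (MeasurableSet.univ_pi fun _ => hB))

/-- For m = 1 and no prescribed edge the count is the number of near points, of mean |B|. -/
lemma IsInfiniteGIRG.ae_finite_nearSet (h : IsInfiniteGIRG P α d μ Y W G)
    (hμ0 : ∀ᵐ x ∂μ, 0 ≤ x) {B : Set (EuclideanSpace ℝ (Fin d))} (hB : MeasurableSet B)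
    (hB' : volume B ≠ ∞) : ∀ᵐ ω ∂P, (nearSet (Y ω) 1 B 0).Finite := by
  have h1 := h.lintegral_homCount hμ0 (m := 1) hB (Finset.empty_subset _)
  have h2 : ∫⁻ ω, homCount (G ω) 0 (nearSet (Y ω) 1 B 0) (∅ : Finset (Fin (1 + 1) × Fin (1 + 1)))
      ∂P ≠ ∞ := by
    rw [h1]
    exact ((clusterDensity_le α hB _ μ).trans_lt (ENNReal.pow_lt_top hB'.lt_top)).ne
  filter_upwards [ae_lt_top (h.measurable_homCount hB _) h2] with ω hω
  refine finite_of_tsum_indicator_ne_top (ne_top_of_le_ne_top hω.ne ?_)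
  rw [homCount, ← (Equiv.funUnique (Fin 1) ℕ).symm.tsum_eq]
  refine ENNReal.tsum_le_tsum fun i => ?_
  by_cases hi : i ∈ nearSet (Y ω) 1 B 0
  · rw [Set.indicator_of_mem hi, if_pos]
    · rfl
    · refine ⟨?_, fun _ => hi, by simp⟩
      rw [Fin.cons_injective_iff]
      exact ⟨by rintro ⟨a, ha⟩; exact hi.1 ha, Function.injective_of_subsingleton _⟩
  · rw [Set.indicator_of_notMem hi]
    exact zero_le

lemma IsInfiniteGIRG.lintegral_five_pow_le (h : IsInfiniteGIRG P α d μ Y W G)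
    (hμ0 : ∀ᵐ x ∂μ, 0 ≤ x) {B : Set (EuclideanSpace ℝ (Fin d))} (hB : MeasurableSet B)
    (hB' : volume B ≠ ∞) :
    ∫⁻ ω, 5 ^ (nearSet (Y ω) 1 B 0).ncard ∂P ≤ expMoment B := by
  have h1 : ∀ᵐ ω ∂P, (5 : ℝ≥0∞) ^ (nearSet (Y ω) 1 B 0).ncard = ∑' m : ℕ,
      ENNReal.ofReal (4 ^ m / m.factorial) * homCount (G ω) 0 (nearSet (Y ω) 1 B 0)
        (∅ : Finset (Fin (m + 1) × Fin (m + 1))) := by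
    filter_upwards [h.ae_finite_nearSet hμ0 hB hB'] with ω hω
    exact five_pow_ncard_eq_tsum (G ω) 0 hω (self_notMem_nearSet _ _ _ _)
  rw [lintegral_congr_ae h1,
    lintegral_tsum fun m => ((h.measurable_homCount hB _).const_mul _).aemeasurable]
  refine ENNReal.tsum_le_tsum fun m => ?_
  rw [lintegral_const_mul _ (h.measurable_homCount hB _),
    h.lintegral_homCount hμ0 hB (Finset.empty_subset _)]
  gcongr
  exact clusterDensity_le α hB _ μ

end

/-! ### Local finiteness of the infinite GIRG -/

lemma measurable_cons_const {d m : ℕ} {β : Type*} [MeasurableSpace β]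
    {f : β → Fin m → EuclideanSpace ℝ (Fin d)} (hf : Measurable f) (x₀ : EuclideanSpace ℝ (Fin d)) :
    Measurable fun b => (Fin.cons x₀ (f b) : Fin (m + 1) → EuclideanSpace ℝ (Fin d)) := by
  refine measurable_pi_lambda _ fun a => ?_
  refine Fin.cases ?_ (fun a => ?_) a
  · exact measurable_const
  · exact (measurable_pi_apply a).comp hf

lemma lintegral_lintegral_edgeProd_rootEdge {α : ℝ≥0∞} (hα : 1 < α) {d : ℕ} (hd : 1 ≤ d)
    {μ : Measure ℝ} [IsProbabilityMeasure μ] (hμ0 : ∀ᵐ x ∂μ, 0 ≤ x)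
    (hμ : Integrable (fun x : ℝ => x) μ) (x₀ : EuclideanSpace ℝ (Fin d)) :
    ∫⁻ y : Fin 1 → EuclideanSpace ℝ (Fin d), ∫⁻ v, edgeProd (girgKernel α d (∫ x, x ∂μ)) rootEdge
      (Fin.cons x₀ y) v ∂(Measure.pi fun _ => μ) =
      kernelMass α d * ENNReal.ofReal (∫ x, x ∂μ) := by
  have hE : Measurable fun p : (Fin 1 → EuclideanSpace ℝ (Fin d)) × (Fin (1 + 1) → ℝ) =>
      edgeProd (girgKernel α d (∫ x, x ∂μ)) rootEdge (Fin.cons x₀ p.1) p.2 :=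
    measurable_edgeProd α rootEdge measurable_const (measurable_cons_const measurable_fst x₀)
      measurable_snd
  rw [lintegral_lintegral_swap (f := fun (y : Fin 1 → EuclideanSpace ℝ (Fin d))
    (v : Fin (1 + 1) → ℝ) => edgeProd (girgKernel α d (∫ x, x ∂μ)) rootEdge (Fin.cons x₀ y) v)
    hE.aemeasurable, ← lintegral_pi_mul hμ0 hμ, ← lintegral_const_mul _ (by fun_prop)]
  refine lintegral_congr_ae ?_
  filter_upwards [ae_pi_nonneg hμ0 (Fin (1 + 1))] with v hv
  exact lintegral_edgeProd_rootEdge hα hd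
    (div_nonneg (mul_nonneg (hv 0) (hv 1)) (integral_nonneg_of_ae hμ0)) x₀

section

variable {Ω : Type*} [MeasurableSpace Ω] {P : Measure Ω} {α : ℝ≥0∞} {d : ℕ} {μ : Measure ℝ}
  {Y : Ω → ℕ → EuclideanSpace ℝ (Fin d)} {W : Ω → ℕ → ℝ} {G : Ω → SimpleGraph ℕ}
  [IsProbabilityMeasure P] [IsProbabilityMeasure μ]

lemma IsInfiniteGIRG.ae_finite_neighborSet_zero (h : IsInfiniteGIRG P α d μ Y W G)
    (hα : 1 < α) (hd : 1 ≤ d) (hμ0 : ∀ᵐ x ∂μ, 0 ≤ x) (hμ : Integrable (fun x : ℝ => x) μ) :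
    ∀ᵐ ω ∂P, ((G ω).neighborSet 0).Finite := by
  have h2 : ∫⁻ ω, homCount (G ω) 0 (nearSet (Y ω) 1 Set.univ 0) rootEdge ∂P ≠ ∞ := by
    rw [h.lintegral_homCount hμ0 MeasurableSet.univ rootEdge_subset,
      clusterDensity_rootEdge hα hd hμ0 hμ]
    exact ENNReal.mul_ne_top (kernelMass_ne_top hα hd) ENNReal.ofReal_ne_top
  filter_upwards [ae_lt_top (h.measurable_homCount MeasurableSet.univ _) h2] with ω hω
  refine finite_of_tsum_indicator_ne_top (ne_top_of_le_ne_top hω.ne ?_)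
  rw [homCount, ← (Equiv.funUnique (Fin 1) ℕ).symm.tsum_eq]
  refine ENNReal.tsum_le_tsum fun i => ?_
  by_cases hi : i ∈ (G ω).neighborSet 0
  · have hi0 : i ≠ 0 := (G ω).ne_of_adj hi |>.symm
    rw [Set.indicator_of_mem hi, if_pos]
    · rfl
    · refine ⟨?_, fun _ => ⟨hi0, trivial⟩, ?_⟩
      · rw [Fin.cons_injective_iff]
        exact ⟨by rintro ⟨a, ha⟩; exact hi0 ha, Function.injective_of_subsingleton _⟩
      · intro e he
        rw [rootEdge, Finset.mem_singleton] at he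
        subst he
        exact hi
  · rw [Set.indicator_of_notMem hi]
    exact zero_le

/-- A vertex other than the root has a random location, so pairs consisting of a Poisson point in a
ball and a neighbour among the Poisson points are counted; their expected number is the volume of
the ball times the expected degree. -/
lemma IsInfiniteGIRG.lintegral_degrees_ne_top (h : IsInfiniteGIRG P α d μ Y W G)
    (hα : 1 < α) (hd : 1 ≤ d) (hμ0 : ∀ᵐ x ∂μ, 0 ≤ x) (hμ : Integrable (fun x : ℝ => x) μ) (R : ℝ) :
    ∫⁻ ω, ∑' t : {t : Fin (1 + 1) → ℕ // Function.Injective t},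
      (Metric.closedBall 0 R).indicator 1 (Y ω (t.1 0 + 1)) *
        edgeInd (G ω) rootEdge (fun a => t.1 a + 1) ∂P ≠ ∞ := by
  have hY : ∀ i, Measurable fun ω => Y ω i := fun i =>
    (measurable_pi_apply i).comp h.isSIRG.measurable_location
  have hI : Measurable ((Metric.closedBall (0 : EuclideanSpace ℝ (Fin d)) R).indicator
      (1 : EuclideanSpace ℝ (Fin d) → ℝ≥0∞)) := measurable_one.indicator measurableSet_closedBall
  set κ := girgKernel α d (∫ x, x ∂μ) with hκ
  have hE : Measurable fun p : (Fin (1 + 1) → EuclideanSpace ℝ (Fin d)) × (Fin (1 + 1) → ℝ) =>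
      edgeProd κ rootEdge p.1 p.2 :=
    measurable_edgeProd α rootEdge measurable_const measurable_fst measurable_snd
  set H : (Fin (1 + 1) → EuclideanSpace ℝ (Fin d)) → ℝ≥0∞ := fun y =>
    (Metric.closedBall 0 R).indicator 1 (y 0) *
      ∫⁻ v, edgeProd κ rootEdge y v ∂(Measure.pi fun _ => μ) with hH
  have hHm : Measurable H := (hI.comp (measurable_pi_apply 0)).mul hE.lintegral_prod_right'
  have hm : ∀ t : {t : Fin (1 + 1) → ℕ // Function.Injective t}, Measurable fun ω =>
      (Metric.closedBall 0 R).indicator (1 : EuclideanSpace ℝ (Fin d) → ℝ≥0∞) (Y ω (t.1 0 + 1)) *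
        edgeInd (G ω) rootEdge (fun a => t.1 a + 1) := fun t =>
    (hI.comp (hY _)).mul (h.isSIRG.measurable_edgeInd rootEdge _)
  rw [lintegral_tsum fun t => (hm t).aemeasurable]
  have h1 : ∀ t : {t : Fin (1 + 1) → ℕ // Function.Injective t},
      ∫⁻ ω, (Metric.closedBall 0 R).indicator 1 (Y ω (t.1 0 + 1)) *
        edgeInd (G ω) rootEdge (fun a => t.1 a + 1) ∂P =
      ∫⁻ ω, H (fun a => Y ω (t.1 a + 1)) ∂P := by
    intro t
    exact h.lintegral_edgeInd hμ0 (t := fun a => t.1 a + 1)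
      (fun a b hab => t.2 (by simpa using hab))
      (ne_and_swap_notMem_of_subset_potentialEdges rootEdge_subset)
      (f := fun y => (Metric.closedBall 0 R).indicator 1 (y (t.1 0 + 1)))
      (hI.comp (measurable_pi_apply _))
  rw [tsum_congr h1, h.lintegral_tsum_injective hHm]
  have h2 : ∫⁻ y, H y = ∫⁻ x₀, (Metric.closedBall (0 : EuclideanSpace ℝ (Fin d)) R).indicator
      (fun _ => kernelMass α d * ENNReal.ofReal (∫ x, x ∂μ)) x₀ := by
    rw [volume_pi, lintegral_pi_cons _ hHm]
    refine lintegral_congr fun x₀ => ?_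
    simp only [hH, Fin.cons_zero]
    by_cases hx : x₀ ∈ Metric.closedBall (0 : EuclideanSpace ℝ (Fin d)) R
    swap
    · simp only [Set.indicator_of_notMem hx, zero_mul, lintegral_zero]
    simp only [Set.indicator_of_mem hx, Pi.one_apply, one_mul]
    exact lintegral_lintegral_edgeProd_rootEdge hα hd hμ0 hμ x₀
  rw [h2, lintegral_indicator_const measurableSet_closedBall]
  exact ENNReal.mul_ne_top (ENNReal.mul_ne_top (kernelMass_ne_top hα hd) ENNReal.ofReal_ne_top)
    measure_closedBall_lt_top.ne

theorem IsInfiniteGIRG.ae_isLocallyFinite (h : IsInfiniteGIRG P α d μ Y W G)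
    (hα : 1 < α) (hd : 1 ≤ d) (hμ0 : ∀ᵐ x ∂μ, 0 ≤ x) (hμ : Integrable (fun x : ℝ => x) μ) :
    ∀ᵐ ω ∂P, IsLocallyFinite (G ω) := by
  have hY : ∀ i, Measurable fun ω => Y ω i := fun i =>
    (measurable_pi_apply i).comp h.isSIRG.measurable_location
  have hI : ∀ R, Measurable ((Metric.closedBall (0 : EuclideanSpace ℝ (Fin d)) R).indicator
      (1 : EuclideanSpace ℝ (Fin d) → ℝ≥0∞)) := fun R =>
    measurable_one.indicator measurableSet_closedBall
  have h1 : ∀ᵐ ω ∂P, ∀ R : ℕ, ∑' t : {t : Fin (1 + 1) → ℕ // Function.Injective t},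
      (Metric.closedBall 0 (R : ℝ)).indicator 1 (Y ω (t.1 0 + 1)) *
        edgeInd (G ω) rootEdge (fun a => t.1 a + 1) < ∞ := by
    rw [ae_all_iff]
    intro R
    refine ae_lt_top ?_ (h.lintegral_degrees_ne_top hα hd hμ0 hμ R)
    exact Measurable.tsum fun t => ((hI R).comp (hY _)).mul
      (h.isSIRG.measurable_edgeInd rootEdge _)
  filter_upwards [h1, h.ae_finite_neighborSet_zero hα hd hμ0 hμ] with ω hω h0 i
  cases i with
  | zero => exact h0
  | succ i =>
    -- Every location is in a ball of integer radius, so countably many almost sure events suffice.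
    obtain ⟨R, hR⟩ := exists_nat_ge ‖Y ω (i + 1)‖
    have hfin : {j : ℕ | (G ω).Adj (i + 1) (j + 1)}.Finite := by
      refine finite_of_tsum_indicator_ne_top (ne_top_of_le_ne_top (hω R).ne ?_)
      set C := {j : ℕ | (G ω).Adj (i + 1) (j + 1)} with hC
      rw [← tsum_subtype]
      have hne : ∀ j : C, i ≠ j := fun j hij => (G ω).loopless.irrefl (i + 1) (by
        have := j.2
        rwa [← hij] at this)
      set φ : C → {t : Fin (1 + 1) → ℕ // Function.Injective t} := fun j =>
        ⟨![i, j], by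
          intro a b hab
          fin_cases a <;> fin_cases b
          · rfl
          · exact absurd hab (hne j)
          · exact absurd hab (hne j).symm
          · rfl⟩ with hφ
      have hφi : Function.Injective φ := fun j j' hjj => by
        have := congrFun (congrArg Subtype.val hjj) 1
        exact Subtype.ext this
      refine le_trans (ENNReal.tsum_le_tsum fun j => ?_)
          (ENNReal.tsum_comp_le_tsum_of_injective hφi _)
      have hm : Y ω ((φ j).1 0 + 1) ∈ Metric.closedBall (0 : EuclideanSpace ℝ (Fin d)) R := by
        rw [mem_closedBall_zero_iff]
        exact hR
      rw [Set.indicator_of_mem hm, edgeInd_rootEdge, if_pos]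
      · simp
      · exact j.2
    -- The root, not among the Poisson points, adds at most one neighbour.
    refine ((hfin.image Nat.succ).union (Set.finite_singleton 0)).subset fun j hj => ?_
    cases j with
    | zero => exact Or.inr rfl
    | succ j => exact Or.inl ⟨j, hj, rfl⟩

end

/-! ### Vertices with long edges nearby -/

/-- The vertices from which an edge of scaled length more than `R` is reached in fewer than `r`
steps. -/
def farSet {V : Type*} {d : ℕ} (G : SimpleGraph V) (x : V → EuclideanSpace ℝ (Fin d)) (s R : ℝ) :
    ℕ → Set V
  | 0 => ∅
  | r + 1 => {i | ∃ j, G.Adj i j ∧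
    (s • (x j - x i) ∈ (Metric.closedBall 0 R)ᶜ ∨ j ∈ farSet G x s R r)}

/-- Outside `farSet` every edge met within r steps has scaled length at most R, and the triangle
inequality adds them up. -/
lemma norm_le_of_notMem_farSet {V : Type*} {d : ℕ} {G : SimpleGraph V}
    {x : V → EuclideanSpace ℝ (Fin d)} {s R : ℝ} (hR : 0 ≤ R) : ∀ {r : ℕ} {i v : V},
    i ∉ farSet G x s R r → v ∈ ballSet G i r → ‖s • (x v - x i)‖ ≤ r * R := by
  intro r
  induction r with
  | zero =>
    intro i v _ hv
    rw [mem_ballSet_zero] at hv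
    subst hv
    simp
  | succ r ih =>
    intro i v hi hv
    rcases (mem_ballSet_succ ..).1 hv with rfl | ⟨j, hij, hj⟩
    · simp only [sub_self, smul_zero, norm_zero]
      positivity
    · have h1 : ¬ (s • (x j - x i) ∈ (Metric.closedBall 0 R)ᶜ ∨ j ∈ farSet G x s R r) :=
        fun h => hi ⟨j, hij, h⟩
      push Not at h1
      have h2 : ‖s • (x j - x i)‖ ≤ R := by simpa using h1.1
      have h3 := ih h1.2 hj
      have h4 : s • (x v - x i) = s • (x v - x j) + s • (x j - x i) := by
        rw [← smul_add]
        congr 1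
        abel
      rw [h4]
      push_cast
      linarith [norm_add_le (s • (x v - x j)) (s • (x j - x i))]

/-- The proportion of vertices in `farSet`. -/
def farAverage {n d : ℕ} (G : SimpleGraph (Fin n)) (x : Fin n → EuclideanSpace ℝ (Fin d))
    (s R : ℝ) (r : ℕ) : ℝ≥0∞ :=
  (n : ℝ≥0∞)⁻¹ * ∑ i, (farSet G x s R r).indicator 1 i

open scoped Classical in
lemma clusterCount_rootEdge {n d : ℕ} (G : SimpleGraph (Fin n))
    (x : Fin n → EuclideanSpace ℝ (Fin d)) (s : ℝ) (B : Set (EuclideanSpace ℝ (Fin d))) :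
    clusterCount G x s B rootEdge = (n : ℝ≥0∞)⁻¹ *
      ∑ i, ∑ j, if G.Adj i j ∧ s • (x j - x i) ∈ B then 1 else 0 := by
  unfold clusterCount
  rw [← (Fin.consEquiv fun _ : Fin (1 + 1) => Fin n).sum_comp, Fintype.sum_prod_type]
  congr 1
  refine Finset.sum_congr rfl fun i _ => ?_
  rw [← (Equiv.funUnique (Fin 1) (Fin n)).symm.sum_comp]
  refine Finset.sum_congr rfl fun j _ => ?_
  change clusterInd G x s B rootEdge (Fin.cons i fun _ => j) = _
  rw [clusterInd, edgeInd_rootEdge]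
  have h1 : Function.Injective (Fin.cons i fun _ => j : Fin (1 + 1) → Fin n) ↔ i ≠ j := by
    rw [Fin.cons_injective_iff]
    constructor
    · rintro ⟨h, -⟩ rfl
      exact h ⟨0, rfl⟩
    · intro h
      exact ⟨by rintro ⟨a, ha⟩; exact h ha.symm, Function.injective_of_subsingleton _⟩
  have h3 : (Fin.cons i fun _ => j : Fin (1 + 1) → Fin n) 0 = i := rfl
  have h4 : (Fin.cons i fun _ => j : Fin (1 + 1) → Fin n) 1 = j := rfl
  simp only [h1, h3, h4]
  by_cases h5 : G.Adj i j
  · simp [h5, h5.ne]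
  · simp [h5]

/-- Either D ≤ A, or D ≤ D² / A and the square is absorbed into 5^D. -/
lemma le_mul_add_five_pow {c : ℝ≥0} (hc : ∀ D : ℕ, ((D + 1 : ℕ) : ℝ≥0∞) ^ 2 ≤ c * 5 ^ D) {A : ℕ}
    (hA : A ≠ 0) (D : ℕ) {V : Type*} (T : Set V) (j : V) :
    T.indicator 1 j * (D : ℝ≥0∞) ≤ A * T.indicator 1 j + (A : ℝ≥0∞)⁻¹ * (c * 5 ^ D) := by
  by_cases hD : D ≤ A
  · refine le_add_right ?_
    rw [mul_comm]
    gcongr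
  · refine le_add_left ?_
    have h1 : T.indicator (1 : V → ℝ≥0∞) j ≤ 1 := Set.indicator_le_self' (by simp) j
    calc T.indicator 1 j * (D : ℝ≥0∞) ≤ 1 * D := by gcongr
      _ = (A : ℝ≥0∞)⁻¹ * (A * D) := by
          rw [← mul_assoc, ENNReal.inv_mul_cancel (by simpa using hA) (by simp)]
      _ ≤ (A : ℝ≥0∞)⁻¹ * ((D + 1 : ℕ) : ℝ≥0∞) ^ 2 := by
          gcongr
          have : A * D ≤ (D + 1) ^ 2 := by nlinarith
          exact_mod_cast this
      _ ≤ _ := by gcongr; exact hc D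

/-- A vertex enters the next set through a long edge of its own or a neighbour j in the previous
set. The second kind is counted from j, with its degree as weight. The degree is at most the number
of edges longer than R' plus the number of near points, and the latter is cut off at A. -/
lemma farAverage_succ_le {n d : ℕ} (G : SimpleGraph (Fin n))
    (x : Fin n → EuclideanSpace ℝ (Fin d)) (s R R' : ℝ) (r : ℕ)
    {c : ℝ≥0} (hc : ∀ D : ℕ, ((D + 1 : ℕ) : ℝ≥0∞) ^ 2 ≤ c * 5 ^ D) {A : ℕ} (hA : A ≠ 0) :
    farAverage G x s R (r + 1) ≤ clusterCount G x s (Metric.closedBall 0 R)ᶜ rootEdge +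
      (clusterCount G x s (Metric.closedBall 0 R')ᶜ rootEdge + (A * farAverage G x s R r +
        (A : ℝ≥0∞)⁻¹ * (c * fivePowAverage x s (Metric.closedBall 0 R')))) := by
  classical
  set T := farSet G x s R r with hT
  set ℓ : ℝ → Fin n → Fin n → ℝ≥0∞ := fun R i j =>
    if G.Adj i j ∧ s • (x j - x i) ∈ (Metric.closedBall 0 R)ᶜ then 1 else 0 with hℓ
  set a : Fin n → Fin n → ℝ≥0∞ := fun i j => if G.Adj i j then 1 else 0 with ha
  have h1 : ∀ i, (farSet G x s R (r + 1)).indicator (1 : Fin n → ℝ≥0∞) i ≤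
      ∑ j, ℓ R i j + ∑ j, a i j * T.indicator 1 j := by
    intro i
    by_cases hi : i ∈ farSet G x s R (r + 1)
    swap
    · rw [Set.indicator_of_notMem hi]; exact zero_le
    rw [Set.indicator_of_mem hi, Pi.one_apply]
    obtain ⟨j, hij, hj | hj⟩ := hi
    · refine le_add_right ?_
      refine le_trans ?_ (Finset.single_le_sum (fun _ _ => zero_le) (Finset.mem_univ j))
      rw [hℓ]
      simp only
      rw [if_pos ⟨hij, hj⟩]
    · refine le_add_left ?_
      refine le_trans ?_ (Finset.single_le_sum (fun _ _ => zero_le) (Finset.mem_univ j))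
      rw [ha]
      simp only
      rw [if_pos hij, Set.indicator_of_mem hj, one_mul, Pi.one_apply]
  have h2 : ∀ j, ∑ i, a i j ≤ ∑ i, ℓ R' j i + (nearSet x s (Metric.closedBall 0 R') j).ncard := by
    intro j
    have h3 : ∀ i, a i j ≤ ℓ R' j i +
        if i ∈ (nearSet x s (Metric.closedBall 0 R') j).toFinset then 1 else 0 := by
      intro i
      simp only [ha, hℓ]
      by_cases hij : G.Adj i j
      · by_cases hf : s • (x i - x j) ∈ Metric.closedBall (0 : EuclideanSpace ℝ (Fin d)) R'
        · have hm : i ∈ (nearSet x s (Metric.closedBall 0 R') j).toFinset :=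
            Set.mem_toFinset.2 ⟨hij.ne, hf⟩
          rw [if_pos hij, if_pos hm]
          exact le_add_left le_rfl
        · rw [if_pos hij, if_pos ⟨hij.symm, hf⟩]
          exact le_add_right le_rfl
      · rw [if_neg hij]; exact zero_le
    refine (Finset.sum_le_sum fun i _ => h3 i).trans ?_
    rw [Finset.sum_add_distrib, Set.ncard_eq_toFinset_card']
    refine add_le_add_right ?_ _
    simp
  have h4 : ∑ i, ∑ j, a i j * T.indicator 1 j ≤ ∑ j, ∑ i, ℓ R' j i + ∑ j,
      (A * T.indicator 1 j + (A : ℝ≥0∞)⁻¹ *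
        (c * 5 ^ (nearSet x s (Metric.closedBall 0 R') j).ncard)) := by
    -- The exchange of the two ends of an edge, a mass transport argument.
    rw [Finset.sum_comm, ← Finset.sum_add_distrib]
    refine Finset.sum_le_sum fun j _ => ?_
    rw [← Finset.sum_mul]
    refine (mul_le_mul_left (h2 j) _).trans ?_
    rw [add_mul]
    refine add_le_add ?_ ?_
    · have h5 : T.indicator (1 : Fin n → ℝ≥0∞) j ≤ 1 := Set.indicator_le_self' (by simp) j
      exact (mul_le_mul_right h5 _).trans (mul_one _).le
    · rw [mul_comm]
      exact le_mul_add_five_pow hc hA _ T j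
  rw [clusterCount_rootEdge, clusterCount_rootEdge, farAverage, farAverage, fivePowAverage]
  calc _ ≤ (n : ℝ≥0∞)⁻¹ * (∑ i, ∑ j, ℓ R i j + (∑ j, ∑ i, ℓ R' j i + ∑ j,
      (A * T.indicator 1 j + (A : ℝ≥0∞)⁻¹ *
        (c * 5 ^ (nearSet x s (Metric.closedBall 0 R') j).ncard)))) := by
        refine mul_le_mul_right ((Finset.sum_le_sum fun i _ => h1 i).trans ?_) _
        rw [Finset.sum_add_distrib]
        exact add_le_add_right h4 _
    _ = _ := by
        rw [Finset.sum_add_distrib, ← Finset.mul_sum, ← Finset.mul_sum, ← Finset.mul_sum]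
        simp only [hℓ, hT]
        ring_nf

lemma IsGIRG.measurable_farAverage {Ω : Type*} [MeasurableSpace Ω] {P : Measure Ω} {α : ℝ≥0∞}
    {d n : ℕ} {X : Ω → Fin n → EuclideanSpace ℝ (Fin d)} {W : Ω → Fin n → ℝ}
    {G : Ω → SimpleGraph (Fin n)} (h : IsGIRG P α d n X W G) (s R : ℝ) (r : ℕ) :
    Measurable fun ω => farAverage (G ω) (X ω) s R r := by
  have hX : ∀ i, Measurable fun ω => X ω i := fun i =>
    (measurable_pi_apply i).comp h.isSIRG.measurable_location
  have hm : ∀ (r : ℕ) (i : Fin n), MeasurableSet {ω | i ∈ farSet (G ω) (X ω) s R r} := by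
    intro r
    induction r with
    | zero => intro i; simp [farSet]
    | succ r ih =>
      intro i
      have e : {ω | i ∈ farSet (G ω) (X ω) s R (r + 1)} = ⋃ j, {ω | (G ω).Adj i j} ∩
          ((fun ω => s • (X ω j - X ω i)) ⁻¹' (Metric.closedBall 0 R)ᶜ ∪
            {ω | j ∈ farSet (G ω) (X ω) s R r}) := by
        ext ω
        simp [farSet]
      rw [e]
      refine MeasurableSet.iUnion fun j => (h.isSIRG.measurableSet_adj i j).inter
        (MeasurableSet.union ?_ (ih j))
      exact (((hX j).sub (hX i)).const_smul s) measurableSet_closedBall.compl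
  refine (Finset.measurable_sum _ fun i _ => ?_).const_mul _
  have e : (fun ω => (farSet (G ω) (X ω) s R r).indicator (1 : Fin n → ℝ≥0∞) i) =
      {ω | i ∈ farSet (G ω) (X ω) s R r}.indicator 1 := by
    ext ω
    by_cases hω : i ∈ farSet (G ω) (X ω) s R r
    · rw [Set.indicator_of_mem hω, Set.indicator_of_mem (by exact hω)]; rfl
    · rw [Set.indicator_of_notMem hω, Set.indicator_of_notMem (by exact hω)]
  rw [e]
  exact measurable_one.indicator (hm r i)

/-! ### The mass of long edges -/

lemma integrable_empiricalMeasure {n : ℕ} (hn : n ≠ 0) (w : Fin n → ℝ) (f : ℝ → ℝ) :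
    Integrable f (empiricalMeasure w) := by
  refine Integrable.smul_measure ?_ (by simpa using hn)
  exact integrable_finsetSum_measure.2 fun i _ => integrable_dirac (by simp)

lemma integral_empiricalMeasure {n : ℕ} (w : Fin n → ℝ) :
    ∫ x, x ∂(empiricalMeasure w) = (∑ i, w i) / n := by
  rw [empiricalMeasure, integral_smul_measure, integral_finsetSum_measure fun i _ =>
    integrable_dirac (by simp)]
  simp only [integral_dirac, ENNReal.toReal_inv, ENNReal.toReal_natCast, smul_eq_mul]
  rw [div_eq_inv_mul]

lemma clusterAverage_eq_clusterDensity (α : ℝ≥0∞) {d m : ℕ} {B : Set (EuclideanSpace ℝ (Fin d))}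
    (hB : MeasurableSet B) (S : Finset (Fin (m + 1) × Fin (m + 1))) {n : ℕ} (w : Fin n → ℝ) :
    clusterAverage α B S w = clusterDensity α B S (empiricalMeasure w) := by
  rw [clusterAverage_eq α hB, clusterDensity, integral_empiricalMeasure]

/-- The formula for the expected degree, with the empirical measure itself as weight law. -/
lemma clusterAverage_rootEdge {α : ℝ≥0∞} (hα : 1 < α) {d : ℕ} (hd : 1 ≤ d) {n : ℕ} (hn : n ≠ 0)
    {w : Fin n → ℝ} (hw : ∀ i, 0 ≤ w i) :
    clusterAverage α (Set.univ : Set (EuclideanSpace ℝ (Fin d))) rootEdge w =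
      kernelMass α d * ENNReal.ofReal ((∑ i, w i) / n) := by
  have := isProbabilityMeasure_empiricalMeasure hn w
  rw [clusterAverage_eq_clusterDensity α MeasurableSet.univ, clusterDensity_rootEdge hα hd
    (ae_empiricalMeasure_nonneg hw) (integrable_empiricalMeasure hn w _), integral_empiricalMeasure]

/-- Restricted to m = 1, where complements commute with the product of sets. -/
lemma clusterIntegral_add_compl (α : ℝ≥0∞) {d : ℕ} {B : Set (EuclideanSpace ℝ (Fin d))}
    (hB : MeasurableSet B) (S : Finset (Fin (1 + 1) × Fin (1 + 1))) (L : ℝ) (v : Fin (1 + 1) → ℝ) :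
    clusterIntegral α B S L v + clusterIntegral α Bᶜ S L v =
        clusterIntegral (d := d) α Set.univ S L v := by
  have hE : Measurable fun y : Fin 1 → EuclideanSpace ℝ (Fin d) =>
      edgeProd (girgKernel α d L) S (Fin.cons 0 y) v :=
    measurable_edgeProd α S measurable_const measurable_cons_zero measurable_const
  have hpi : (Set.univ.pi fun _ : Fin 1 => Bᶜ) = (Set.univ.pi fun _ : Fin 1 => B)ᶜ := by
    ext y
    simp
  have hm : MeasurableSet (Set.univ.pi fun _ : Fin 1 => B) := MeasurableSet.univ_pi fun _ => hB
  rw [clusterIntegral, clusterIntegral, clusterIntegral, hpi, lintegral_indicator hm,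
    lintegral_indicator hm.compl, lintegral_add_compl _ hm]
  simp

lemma clusterAverage_add_compl (α : ℝ≥0∞) {d : ℕ} {B : Set (EuclideanSpace ℝ (Fin d))}
    (hB : MeasurableSet B) (S : Finset (Fin (1 + 1) × Fin (1 + 1))) {n : ℕ} (w : Fin n → ℝ) :
    clusterAverage α B S w + clusterAverage α Bᶜ S w = clusterAverage (d := d) α Set.univ S w := by
  rw [clusterAverage, clusterAverage, clusterAverage, ← mul_add, ← Finset.sum_add_distrib]
  simp_rw [clusterIntegral_add_compl α hB]

lemma clusterDensity_add_compl (α : ℝ≥0∞) {d : ℕ} {B : Set (EuclideanSpace ℝ (Fin d))}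
    (hB : MeasurableSet B) (S : Finset (Fin (1 + 1) × Fin (1 + 1))) (μ : Measure ℝ) :
    clusterDensity α B S μ + clusterDensity α Bᶜ S μ = clusterDensity (d := d) α Set.univ S μ := by
  rw [clusterDensity, clusterDensity, clusterDensity, ← lintegral_add_left]
  · simp_rw [clusterIntegral_add_compl α hB]
  · exact measurable_clusterIntegral α hB S measurable_const measurable_id

/-- Dominated convergence, over the location and then over the weights, with the integrand over the
whole space as majorant. -/
lemma tendsto_clusterDensity_compl {α : ℝ≥0∞} (hα : 1 < α) {d : ℕ} (hd : 1 ≤ d) {μ : Measure ℝ}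
    [IsProbabilityMeasure μ] (hμ0 : ∀ᵐ x ∂μ, 0 ≤ x) (hμ : Integrable (fun x : ℝ => x) μ) :
    Tendsto (fun R : ℕ => clusterDensity α
      (Metric.closedBall (0 : EuclideanSpace ℝ (Fin d)) R)ᶜ rootEdge μ) atTop (𝓝 0) := by
  have hB : ∀ R : ℕ, MeasurableSet (Metric.closedBall (0 : EuclideanSpace ℝ (Fin d)) R)ᶜ :=
    fun R => measurableSet_closedBall.compl
  have h0 : ∫⁻ _ : Fin (1 + 1) → ℝ, (0 : ℝ≥0∞) ∂(Measure.pi fun _ => μ) = 0 := lintegral_zero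
  rw [← h0]
  unfold clusterDensity
  have hle : ∀ (R : ℕ) v, clusterIntegral α
      (Metric.closedBall (0 : EuclideanSpace ℝ (Fin d)) R)ᶜ rootEdge (∫ x, x ∂μ) v ≤
      clusterIntegral α (Set.univ : Set (EuclideanSpace ℝ (Fin d))) rootEdge (∫ x, x ∂μ) v := by
    intro R v
    rw [← clusterIntegral_add_compl α measurableSet_closedBall]
    exact le_add_left le_rfl
  refine tendsto_lintegral_of_dominated_convergence
    (fun v => clusterIntegral α (Set.univ : Set (EuclideanSpace ℝ (Fin d))) rootEdge (∫ x, x ∂μ) v)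
    (fun R => measurable_clusterIntegral α (hB R) rootEdge measurable_const measurable_id)
    (fun R => Eventually.of_forall (hle R)) ?_ ?_
  · have := clusterDensity_rootEdge hα hd hμ0 hμ
    rw [clusterDensity] at this
    rw [this]
    exact ENNReal.mul_ne_top (kernelMass_ne_top hα hd) ENNReal.ofReal_ne_top
  · filter_upwards [ae_pi_nonneg hμ0 (Fin (1 + 1))] with v hv
    have h1 : ∫⁻ _ : Fin 1 → EuclideanSpace ℝ (Fin d), (0 : ℝ≥0∞) = 0 := lintegral_zero
    rw [← h1]
    unfold clusterIntegral
    have hE : Measurable fun y : Fin 1 → EuclideanSpace ℝ (Fin d) =>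
        edgeProd (girgKernel α d (∫ x, x ∂μ)) rootEdge (Fin.cons 0 y) v :=
      measurable_edgeProd α rootEdge measurable_const measurable_cons_zero measurable_const
    refine tendsto_lintegral_of_dominated_convergence
      (fun y => edgeProd (girgKernel α d (∫ x, x ∂μ)) rootEdge (Fin.cons 0 y) v)
      (fun R => hE.indicator (MeasurableSet.univ_pi fun _ => hB R))
      (fun R => Eventually.of_forall fun y => Set.indicator_le_self _ _ _) ?_ ?_
    · rw [lintegral_edgeProd_rootEdge hα hd
        (div_nonneg (mul_nonneg (hv 0) (hv 1)) (integral_nonneg_of_ae hμ0)) 0]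
      exact ENNReal.mul_ne_top (kernelMass_ne_top hα hd) ENNReal.ofReal_ne_top
    · refine Eventually.of_forall fun y => tendsto_const_nhds.congr' ?_
      obtain ⟨R₀, hR₀⟩ := exists_nat_ge ‖y 0‖
      filter_upwards [eventually_ge_atTop R₀] with R hR
      rw [Set.indicator_of_notMem]
      intro hy
      have h2 := hy 0 (Set.mem_univ _)
      refine h2 ?_
      rw [mem_closedBall_zero_iff]
      exact hR₀.trans (by exact_mod_cast hR)

/-- The indicator that the mean of the weights is at most `M`. -/
def meanInd (M : ℝ) {n : ℕ} (w : Fin n → ℝ) : ℝ≥0∞ :=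
  {w : Fin n → ℝ | (∑ i, w i) / n ≤ M}.indicator 1 w

lemma measurable_meanInd (M : ℝ) {n : ℕ} : Measurable fun w : Fin n → ℝ => meanInd M w :=
  measurable_one.indicator (measurableSet_le (by fun_prop) measurable_const)

lemma meanInd_le_one (M : ℝ) {n : ℕ} (w : Fin n → ℝ) : meanInd M w ≤ 1 :=
  Set.indicator_le_self' (by simp) w

section

variable {Ω : ℕ → Type*} [∀ n, MeasurableSpace (Ω n)] {P : ∀ n, Measure (Ω n)}
  [∀ n, IsProbabilityMeasure (P n)] {α : ℝ≥0∞} {d : ℕ}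
  {X : ∀ n, Ω n → Fin n → EuclideanSpace ℝ (Fin d)} {W : ∀ n, Ω n → Fin n → ℝ}
  {G : ∀ n, Ω n → SimpleGraph (Fin n)} {μ : ProbabilityMeasure ℝ}

/-- Weak convergence alone does not control an unbounded region, so the mass outside the ball is
obtained as total mass minus mass inside; the total is a constant times the mean weight, which
converges by hypothesis. As the mean converges only in probability, `meanInd` supplies the bound
needed to pass to expectations. -/
lemma tendsto_lintegral_clusterAverage_compl
    (hG : ∀ n, IsGIRG (P n) α d n (X n) (W n) (G n)) (hα : 1 < α)
    (hd : 1 ≤ d) (hW : Tendsto (empiricalProba W) (probFilter P) (𝓝 μ))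
    (hmean : TendstoInProb P (fun n ω => (∑ i, W n ω i) / n) (∫ x, x ∂(μ : Measure ℝ)))
    (hpos : 0 < ∫ x, x ∂(μ : Measure ℝ)) (hμ0 : ∀ᵐ x ∂(μ : Measure ℝ), 0 ≤ x)
    (hμ : Integrable (fun x : ℝ => x) (μ : Measure ℝ)) (R : ℝ) :
    Tendsto (fun n => ∫⁻ ω, meanInd ((∫ x, x ∂(μ : Measure ℝ)) + 1) (W n ω) *
      clusterAverage α (Metric.closedBall (0 : EuclideanSpace ℝ (Fin d)) R)ᶜ rootEdge (W n ω) ∂(P n))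
      atTop (𝓝 (clusterDensity α
        (Metric.closedBall (0 : EuclideanSpace ℝ (Fin d)) R)ᶜ rootEdge μ)) := by
  set ℓ := ∫ x, x ∂(μ : Measure ℝ) with hℓ
  set B := Metric.closedBall (0 : EuclideanSpace ℝ (Fin d)) R with hBdef
  have hB : MeasurableSet B := measurableSet_closedBall
  have hB' : volume B ≠ ∞ := measure_closedBall_lt_top.ne
  have hB1 : clusterDensity α B rootEdge μ ≠ ∞ :=
    ((clusterDensity_le α hB _ μ).trans_lt (ENNReal.pow_lt_top hB'.lt_top)).ne
  have huniv := clusterDensity_rootEdge hα hd hμ0 hμ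
  rw [← hℓ] at huniv
  have hsum := clusterDensity_add_compl α hB rootEdge (μ : Measure ℝ)
  have htop : clusterDensity α (Set.univ : Set (EuclideanSpace ℝ (Fin d))) rootEdge μ ≠ ∞ := by
    rw [huniv]
    exact ENNReal.mul_ne_top (kernelMass_ne_top hα hd) ENNReal.ofReal_ne_top
  have hc : clusterDensity α Bᶜ rootEdge μ ≠ ∞ :=
    ne_top_of_le_ne_top htop (hsum ▸ le_add_left le_rfl)
  have hWn : ∀ n, Measurable (W n) := fun n => (hG n).isSIRG.measurable_weight
  have hmean' := tendstoInProb_iff.1 hmean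
  have hnonneg : ∀ᶠ p : Σ n, Ω n in probFilter P, ∀ i, 0 ≤ W p.1 p.2 i :=
    eventually_probFilter_of_ae fun n => (hG n).weight_nonneg
  have hne : ∀ᶠ p : Σ n, Ω n in probFilter P, p.1 ≠ 0 :=
    tendsto_fst_probFilter.eventually (eventually_ne_atTop 0)
  refine tendsto_lintegral_of_tendsto_probFilter (Z := fun n ω => meanInd (ℓ + 1) (W n ω) *
      clusterAverage α Bᶜ rootEdge (W n ω))
    (fun n => ((measurable_meanInd _).comp (hWn n)).mul
      ((measurable_clusterAverage α hB.compl rootEdge).comp (hWn n)))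
    (M := kernelMass α d * ENNReal.ofReal (ℓ + 1))
    (ENNReal.mul_ne_top (kernelMass_ne_top hα hd) ENNReal.ofReal_ne_top) (fun n => ?_) hc ?_
  · filter_upwards [(hG n).weight_nonneg] with ω hω
    by_cases hn : n = 0
    · subst hn
      refine le_trans (mul_le_mul_left (meanInd_le_one _ _) _) ?_
      simp [clusterAverage]
    by_cases hM : (∑ i, W n ω i) / n ≤ ℓ + 1
    · calc _ ≤ 1 * clusterAverage α Set.univ rootEdge (W n ω) := by
            refine mul_le_mul' (meanInd_le_one _ _) ?_
            rw [← clusterAverage_add_compl α hB]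
            exact le_add_left le_rfl
        _ ≤ _ := by
            rw [one_mul, clusterAverage_rootEdge hα hd hn hω]
            gcongr
    · have h0 : meanInd (ℓ + 1) (W n ω) = 0 := Set.indicator_of_notMem (by exact hM) _
      rw [h0, zero_mul]
      exact zero_le
  · have h1 : Tendsto (fun p : Σ n, Ω n => kernelMass α d *
        ENNReal.ofReal ((∑ i, W p.1 p.2 i) / p.1) - clusterAverage α B rootEdge (W p.1 p.2))
        (probFilter P) (𝓝 (clusterDensity α Bᶜ rootEdge μ)) := by
      have h2 := ENNReal.Tendsto.sub (ENNReal.Tendsto.const_mul (ENNReal.tendsto_ofReal hmean')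
        (Or.inr (kernelMass_ne_top hα hd))) (tendsto_clusterAverage α hd hB hB' rootEdge_subset hW
          hmean hpos) (Or.inr hB1)
      rwa [← huniv, ← hsum, ENNReal.add_sub_cancel_left hB1] at h2
    refine h1.congr' ?_
    filter_upwards [hnonneg, hne, hmean'.eventually (gt_mem_nhds (show ℓ < ℓ + 1 by linarith))]
      with p hp hn hM
    have h3 : meanInd (ℓ + 1) (W p.1 p.2) = 1 := Set.indicator_of_mem (by exact hM.le) _
    rw [h3, one_mul, ← clusterAverage_rootEdge hα hd hn hp, ← clusterAverage_add_compl α hB,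
      ENNReal.add_sub_cancel_left]
    exact ((clusterAverage_le α hB rootEdge _).trans_lt (ENNReal.pow_lt_top hB'.lt_top)).ne

lemma eventually_lintegral_longEdges_le
    (hG : ∀ n, IsGIRG (P n) α d n (X n) (W n) (G n)) (hα : 1 < α)
    (hd : 1 ≤ d) (hW : Tendsto (empiricalProba W) (probFilter P) (𝓝 μ))
    (hmean : TendstoInProb P (fun n ω => (∑ i, W n ω i) / n) (∫ x, x ∂(μ : Measure ℝ)))
    (hpos : 0 < ∫ x, x ∂(μ : Measure ℝ)) (hμ0 : ∀ᵐ x ∂(μ : Measure ℝ), 0 ≤ x)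
    (hμ : Integrable (fun x : ℝ => x) (μ : Measure ℝ)) {ε : ℝ≥0∞} (hε : ε ≠ 0) :
    ∀ᶠ R : ℕ in atTop, ∀ᶠ n in atTop, ∫⁻ ω, meanInd ((∫ x, x ∂(μ : Measure ℝ)) + 1) (W n ω) *
      clusterCount (G n ω) (X n ω) (girgScale d n) (Metric.closedBall 0 R)ᶜ rootEdge ∂(P n) ≤ ε := by
  filter_upwards [(tendsto_clusterDensity_compl hα hd hμ0 hμ).eventually
    (gt_mem_nhds (pos_iff_ne_zero.2 hε))] with R hR
  filter_upwards [(tendsto_lintegral_clusterAverage_compl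
      hG hα hd hW hmean hpos hμ0 hμ R).eventually
    (gt_mem_nhds hR), eventually_ne_atTop 0] with n h1 hn
  exact ((hG n).lintegral_mul_clusterCount_le hd hn measurableSet_closedBall.compl
    (girgScale_pos hn) (girgScale_pow hd) rootEdge_subset (measurable_meanInd _)).trans h1.le

/-- Induction on r with the order of choices R', A, R: R' makes the edges longer than R' rare, A
makes the cutoff error small, and R serves the induction hypothesis with error ε / (4A). The claim
is for all large R so that both conditions on R hold together. -/
lemma eventually_lintegral_farAverage_le
    (hG : ∀ n, IsGIRG (P n) α d n (X n) (W n) (G n)) (hα : 1 < α)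
    (hd : 1 ≤ d) (hW : Tendsto (empiricalProba W) (probFilter P) (𝓝 μ))
    (hmean : TendstoInProb P (fun n ω => (∑ i, W n ω i) / n) (∫ x, x ∂(μ : Measure ℝ)))
    (hpos : 0 < ∫ x, x ∂(μ : Measure ℝ)) (hμ0 : ∀ᵐ x ∂(μ : Measure ℝ), 0 ≤ x)
    (hμ : Integrable (fun x : ℝ => x) (μ : Measure ℝ)) (r : ℕ) : ∀ {ε : ℝ≥0∞}, ε ≠ 0 →
    ∀ᶠ R : ℕ in atTop, ∀ᶠ n in atTop, ∫⁻ ω, meanInd ((∫ x, x ∂(μ : Measure ℝ)) + 1) (W n ω) *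
      farAverage (G n ω) (X n ω) (girgScale d n) R r ∂(P n) ≤ ε := by
  induction r with
  | zero =>
    intro ε _
    refine Eventually.of_forall fun R => Eventually.of_forall fun n => ?_
    simp [farAverage, farSet]
  | succ r ih =>
    intro ε hε
    have hε4 : ε / 4 ≠ 0 := ENNReal.div_ne_zero.2 ⟨hε, by norm_num⟩
    have hlong := eventually_lintegral_longEdges_le hG hα hd hW hmean hpos hμ0 hμ hε4
    obtain ⟨R', hR'⟩ := hlong.exists
    obtain ⟨c, hc⟩ := exists_pow_le_five_pow 2
    set e := expMoment (Metric.closedBall (0 : EuclideanSpace ℝ (Fin d)) R')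
    have he : e ≠ ∞ := expMoment_ne_top measure_closedBall_lt_top.ne
    obtain ⟨A, hA, hA0⟩ : ∃ A : ℕ, (A : ℝ≥0∞)⁻¹ * (c * e) ≤ ε / 4 ∧ A ≠ 0 := by
      have t := ENNReal.Tendsto.mul_const ENNReal.tendsto_inv_nat_nhds_zero (b := c * e)
        (Or.inr (ENNReal.mul_ne_top ENNReal.coe_ne_top he))
      rw [zero_mul] at t
      obtain ⟨A, h1, h2⟩ := ((t.eventually (gt_mem_nhds (pos_iff_ne_zero.2 hε4))).and
        (eventually_ne_atTop 0)).exists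
      exact ⟨A, h1.le, h2⟩
    have hεA : ε / 4 / A ≠ 0 := ENNReal.div_ne_zero.2 ⟨hε4, ENNReal.natCast_ne_top A⟩
    filter_upwards [hlong, ih hεA] with R h1 h2
    filter_upwards [h1, h2, hR', eventually_ne_atTop 0] with n h1 h2 h3 hn
    set s := girgScale d n
    have hψ : Measurable fun ω => meanInd ((∫ x, x ∂(μ : Measure ℝ)) + 1) (W n ω) :=
      (measurable_meanInd _).comp (hG n).isSIRG.measurable_weight
    have hl : ∀ R : ℕ, Measurable fun ω => clusterCount (G n ω) (X n ω) s
        (Metric.closedBall 0 (R : ℝ))ᶜ rootEdge := fun R =>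
      (hG n).measurable_clusterCount measurableSet_closedBall.compl s rootEdge
    have hf : Measurable fun ω => farAverage (G n ω) (X n ω) s R r :=
      (hG n).measurable_farAverage s R r
    have hF : Measurable fun ω => fivePowAverage (X n ω) s (Metric.closedBall 0 (R' : ℝ)) :=
      (hG n).measurable_fivePowAverage measurableSet_closedBall s
    have h4 : ∫⁻ ω, meanInd ((∫ x, x ∂(μ : Measure ℝ)) + 1) (W n ω) *
        farAverage (G n ω) (X n ω) s R (r + 1) ∂(P n) ≤
        ∫⁻ ω, (meanInd ((∫ x, x ∂(μ : Measure ℝ)) + 1) (W n ω) *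
          clusterCount (G n ω) (X n ω) s (Metric.closedBall 0 (R : ℝ))ᶜ rootEdge +
          (meanInd ((∫ x, x ∂(μ : Measure ℝ)) + 1) (W n ω) *
          clusterCount (G n ω) (X n ω) s (Metric.closedBall 0 (R' : ℝ))ᶜ rootEdge +
          (A * (meanInd ((∫ x, x ∂(μ : Measure ℝ)) + 1) (W n ω) *
            farAverage (G n ω) (X n ω) s R r) + (A : ℝ≥0∞)⁻¹ * (c *
            fivePowAverage (X n ω) s (Metric.closedBall 0 (R' : ℝ)))))) ∂(P n) := by
      refine lintegral_mono fun ω => ?_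
      refine (mul_le_mul_right (farAverage_succ_le (G n ω) (X n ω) s R R' r hc hA0) _).trans ?_
      rw [mul_add, mul_add, mul_add, mul_left_comm _ (A : ℝ≥0∞)]
      exact add_le_add le_rfl (add_le_add le_rfl (add_le_add le_rfl
        (mul_le_of_le_one_left zero_le (meanInd_le_one _ _))))
    refine h4.trans ?_
    have hψl : ∀ R : ℕ, Measurable fun ω => meanInd ((∫ x, x ∂(μ : Measure ℝ)) + 1) (W n ω) *
        clusterCount (G n ω) (X n ω) s (Metric.closedBall 0 (R : ℝ))ᶜ rootEdge := fun R =>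
      hψ.mul (hl R)
    have hψf : Measurable fun ω => meanInd ((∫ x, x ∂(μ : Measure ℝ)) + 1) (W n ω) *
        farAverage (G n ω) (X n ω) s R r := hψ.mul hf
    rw [lintegral_add_left (hψl R), lintegral_add_left (hψl R'),
      lintegral_add_left (hψf.const_mul _), lintegral_const_mul _ hψf,
      lintegral_const_mul _ (hF.const_mul _), lintegral_const_mul _ hF]
    have h5 : (A : ℝ≥0∞) * ∫⁻ ω, meanInd ((∫ x, x ∂(μ : Measure ℝ)) + 1) (W n ω) *
        farAverage (G n ω) (X n ω) s R r ∂(P n) ≤ ε / 4 := by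
      calc _ ≤ (A : ℝ≥0∞) * (ε / 4 / A) := by gcongr
        _ ≤ _ := ENNReal.mul_div_le
    have h6 : (A : ℝ≥0∞)⁻¹ * (c * ∫⁻ ω, fivePowAverage (X n ω) s (Metric.closedBall 0 (R' : ℝ))
        ∂(P n)) ≤ ε / 4 := by
      refine le_trans ?_ hA
      gcongr
      exact (hG n).lintegral_fivePowAverage_le hd hn measurableSet_closedBall (girgScale_pos hn)
        (girgScale_pow hd)
    calc _ ≤ ε / 4 + (ε / 4 + (ε / 4 + ε / 4)) :=
          add_le_add h1 (add_le_add h3 (add_le_add h5 h6))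
      _ = ε := by
          have h7 : ε / 4 + (ε / 4 + (ε / 4 + ε / 4)) = 4 * (ε / 4) := by ring
          rw [h7, ENNReal.mul_div_cancel (by norm_num) (by norm_num)]

/-- Markov's inequality, once the event that the mean weight exceeds its limit by 1 is discarded. -/
theorem exists_measure_farAverage_le
    (hG : ∀ n, IsGIRG (P n) α d n (X n) (W n) (G n)) (hα : 1 < α)
    (hd : 1 ≤ d) (hW : Tendsto (empiricalProba W) (probFilter P) (𝓝 μ))
    (hmean : TendstoInProb P (fun n ω => (∑ i, W n ω i) / n) (∫ x, x ∂(μ : Measure ℝ)))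
    (hpos : 0 < ∫ x, x ∂(μ : Measure ℝ)) (hμ0 : ∀ᵐ x ∂(μ : Measure ℝ), 0 ≤ x)
    (hμ : Integrable (fun x : ℝ => x) (μ : Measure ℝ)) (r : ℕ) {δ : ℝ} (hδ : 0 < δ) :
    ∃ R : ℕ, ∀ᶠ n in atTop, P n {ω | ENNReal.ofReal δ ≤
      farAverage (G n ω) (X n ω) (girgScale d n) R r} ≤ ENNReal.ofReal δ := by
  have hδ2 : ENNReal.ofReal δ * ENNReal.ofReal (δ / 2) ≠ 0 := by
    simp [hδ]
  obtain ⟨R, hR⟩ := (eventually_lintegral_farAverage_le hG hα hd hW hmean hpos hμ0 hμ r hδ2).exists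
  refine ⟨R, ?_⟩
  have h1 := hmean 1 one_pos
  filter_upwards [hR, h1.eventually (gt_mem_nhds (ENNReal.ofReal_pos.2 (half_pos hδ)))] with n h2 h3
  have hψ : Measurable fun ω => meanInd ((∫ x, x ∂(μ : Measure ℝ)) + 1) (W n ω) :=
    (measurable_meanInd _).comp (hG n).isSIRG.measurable_weight
  have hf := (hG n).measurable_farAverage (girgScale d n) R r
  calc _ ≤ P n ({ω | 1 ≤ |(∑ i, W n ω i) / n - ∫ x, x ∂(μ : Measure ℝ)|} ∪
        {ω | ENNReal.ofReal δ ≤ meanInd ((∫ x, x ∂(μ : Measure ℝ)) + 1) (W n ω) *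
          farAverage (G n ω) (X n ω) (girgScale d n) R r}) := by
        refine measure_mono fun ω hω => ?_
        by_cases hM : (∑ i, W n ω i) / n ≤ (∫ x, x ∂(μ : Measure ℝ)) + 1
        · refine Or.inr ?_
          have h4 : meanInd ((∫ x, x ∂(μ : Measure ℝ)) + 1) (W n ω) = 1 :=
            Set.indicator_of_mem (by exact hM) _
          rw [Set.mem_ofPred_eq, h4, one_mul]
          exact hω
        · refine Or.inl ?_
          rw [Set.mem_ofPred_eq]
          refine le_trans ?_ (le_abs_self _)
          linarith [not_le.1 hM]
    _ ≤ ENNReal.ofReal (δ / 2) + ENNReal.ofReal (δ / 2) := by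
        refine (measure_union_le _ _).trans (add_le_add h3.le ?_)
        refine (meas_ge_le_lintegral_div (hψ.mul hf).aemeasurable (by simpa using hδ)
          ENNReal.ofReal_ne_top).trans ?_
        exact ENNReal.div_le_of_le_mul' h2
    _ = _ := by
        rw [← ENNReal.ofReal_add (by positivity) (by positivity), add_halves]

end

/-! ### Local convergence -/

/-- The truncated expansion of the indicator of a local event in the counts `N m S`. -/
def countExpansion {U : Type*} (r : ℕ) (H : SimpleGraph U) (h : U) (M : ℕ)
    (N : ∀ m : ℕ, Finset (Fin (m + 1) × Fin (m + 1)) → ℝ≥0∞) : ℝ :=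
  ∑ m ∈ Finset.range M, ∑ S ∈ (potentialEdges m).powerset, ballCoeff r H h m S * (N m S).toReal

lemma abs_ballInd_sub_countExpansion_le {V U : Type*} (r : ℕ) (H : SimpleGraph U) (h : U)
    (G : SimpleGraph V) (o : V) {C : Set V} (hC : C.Finite) (ho : o ∉ C) (M : ℕ) :
    |ballInd r H h G o C - countExpansion r H h M fun _ S => homCount G o C S| ≤
      (1 / 2) ^ M * 5 ^ C.ncard := by
  have := abs_ballInd_sub_sum_homCount_le r H h G o hC.toFinset (by simpa using ho) M
  rw [hC.coe_toFinset, ← Set.ncard_eq_toFinset_card C hC] at this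
  exact this

open scoped Classical in
lemma ballInd_eq_of_ballSet_subset {V U : Type*} {r : ℕ} {H : SimpleGraph U} {h : U}
    {G : SimpleGraph V} {o : V} {C : Set V} (hC : ballSet G o r ⊆ insert o C) :
    ballInd r H h G o C = if BallIso G o r H h then 1 else 0 := by
  unfold ballInd
  rw [ballIso_induce_iff_of_ballSet_subset _ hC]

/-! ### Truncation errors in the finite graphs -/

section Finite

variable {d n : ℕ} {U : Type*} (r : ℕ) (H : SimpleGraph U) (h : U) (G : SimpleGraph (Fin n))
  (x : Fin n → EuclideanSpace ℝ (Fin d)) (s : ℝ)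

/-- Outside `farSet` the r-ball reaches at most r R ≤ K, so restricting to near vertices changes
nothing; on `farSet` two indicators differ by at most 1. -/
lemma abs_ballIso_proportion_sub_le (hn : n ≠ 0) {R K : ℝ} (hR : 0 ≤ R) (hK : r * R ≤ K) :
    |({i : Fin n | BallIso G i r H h}.ncard : ℝ) / n -
      (n : ℝ)⁻¹ * ∑ i, ballInd r H h G i (nearSet x s (Metric.closedBall 0 K) i)| ≤
      (farAverage G x s R r).toReal := by
  classical
  have e1 : ({i : Fin n | BallIso G i r H h}.ncard : ℝ) = ∑ i : Fin n,
      if BallIso G i r H h then 1 else 0 := by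
    rw [Finset.sum_boole, Set.ncard_eq_toFinset_card']
    simp
  have e2 : (farAverage G x s R r).toReal =
      (n : ℝ)⁻¹ * ∑ i, (farSet G x s R r).indicator (1 : Fin n → ℝ) i := by
    rw [farAverage, ENNReal.toReal_mul, ENNReal.toReal_sum]
    · simp only [ENNReal.toReal_inv, ENNReal.toReal_natCast]
      congr 1
      refine Finset.sum_congr rfl fun i _ => ?_
      by_cases hi : i ∈ farSet G x s R r <;> simp [hi]
    · intro i _
      by_cases hi : i ∈ farSet G x s R r <;> simp [hi]
  rw [e1, e2, div_eq_inv_mul, ← mul_sub, ← Finset.sum_sub_distrib, abs_mul,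
    abs_of_nonneg (by positivity : (0 : ℝ) ≤ (n : ℝ)⁻¹)]
  refine mul_le_mul_of_nonneg_left ((Finset.abs_sum_le_sum_abs _ _).trans
    (Finset.sum_le_sum fun i _ => ?_)) (by positivity)
  by_cases hi : i ∈ farSet G x s R r
  · rw [Set.indicator_of_mem hi, Pi.one_apply, ballInd]
    split_ifs <;> simp
  · rw [Set.indicator_of_notMem hi, ballInd_eq_of_ballSet_subset]
    · simp
    · intro v hv
      by_cases hvi : v = i
      · exact Or.inl hvi
      · refine Or.inr ⟨hvi, ?_⟩
        rw [mem_closedBall_zero_iff]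
        exact (norm_le_of_notMem_farSet hR hi hv).trans hK

lemma abs_sum_ballInd_sub_countExpansion_le (hn : n ≠ 0) (B : Set (EuclideanSpace ℝ (Fin d)))
    (M : ℕ) :
    |(n : ℝ)⁻¹ * ∑ i, ballInd r H h G i (nearSet x s B i) -
      countExpansion r H h M fun _ S => clusterCount G x s B S| ≤
      ((1 / 2) ^ M * fivePowAverage x s B).toReal := by
  have e1 : (countExpansion r H h M fun _ S => clusterCount G x s B S) = (n : ℝ)⁻¹ * ∑ i,
      countExpansion r H h M fun _ S => homCount G i (nearSet x s B i) S := by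
    simp only [countExpansion]
    rw [Finset.sum_comm, Finset.mul_sum]
    refine Finset.sum_congr rfl fun m _ => ?_
    rw [Finset.sum_comm, Finset.mul_sum]
    refine Finset.sum_congr rfl fun S _ => ?_
    have h1 := clusterCount_ne_top hn G x s B S
    rw [clusterCount_eq_sum_homCount] at h1 ⊢
    have h2 : ∑ i, homCount G i (nearSet x s B i) S ≠ ∞ := by
      intro h2
      rw [h2, ENNReal.mul_top (by simp)] at h1
      exact h1 rfl
    rw [ENNReal.toReal_mul, ENNReal.toReal_sum (ENNReal.sum_ne_top.1 h2), ← Finset.mul_sum]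
    simp only [ENNReal.toReal_inv, ENNReal.toReal_natCast]
    ring
  have e2 : ((1 / 2) ^ M * fivePowAverage x s B).toReal =
      (n : ℝ)⁻¹ * ∑ i, (1 / 2) ^ M * 5 ^ (nearSet x s B i).ncard := by
    rw [fivePowAverage, ENNReal.toReal_mul, ENNReal.toReal_mul, ENNReal.toReal_sum
      fun _ _ => ENNReal.pow_ne_top (by simp), ← Finset.mul_sum]
    simp only [ENNReal.toReal_inv, ENNReal.toReal_natCast, ENNReal.toReal_pow,
      ENNReal.toReal_ofNat, ENNReal.toReal_div, ENNReal.toReal_one]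
    ring
  rw [e1, e2, ← mul_sub, ← Finset.sum_sub_distrib, abs_mul,
    abs_of_nonneg (by positivity : (0 : ℝ) ≤ (n : ℝ)⁻¹)]
  refine mul_le_mul_of_nonneg_left ((Finset.abs_sum_le_sum_abs _ _).trans
    (Finset.sum_le_sum fun i _ => ?_)) (by positivity)
  exact abs_ballInd_sub_countExpansion_le r H h G i (Set.toFinite _)
    (self_notMem_nearSet x s B i) M

end Finite

/-! ### Truncation errors in the infinite graph -/

section Infinite

variable {Ω : Type*} [MeasurableSpace Ω] {P : Measure Ω} {α : ℝ≥0∞} {d : ℕ}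
  {μ : Measure ℝ} {Y : Ω → ℕ → EuclideanSpace ℝ (Fin d)} {W : Ω → ℕ → ℝ} {G : Ω → SimpleGraph ℕ}

lemma IsInfiniteGIRG.measurable_countExpansion (hG : IsInfiniteGIRG P α d μ Y W G)
    {B : Set (EuclideanSpace ℝ (Fin d))} (hB : MeasurableSet B) {U : Type*} (r : ℕ)
    (H : SimpleGraph U) (h : U) (M : ℕ) :
    Measurable fun ω => countExpansion r H h M fun _ S =>
      homCount (G ω) 0 (nearSet (Y ω) 1 B 0) S := by
  unfold countExpansion
  exact Finset.measurable_sum _ fun m _ => Finset.measurable_sum _ fun S _ =>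
    (hG.measurable_homCount hB S).ennreal_toReal.const_mul _

/-- Measurability is inherited from the expansions: they are measurable and converge to the
indicator as M → ∞ wherever there are finitely many near points. -/
lemma IsInfiniteGIRG.aestronglyMeasurable_ballInd [IsProbabilityMeasure P] [IsProbabilityMeasure μ]
    (hG : IsInfiniteGIRG P α d μ Y W G) (hμ0 : ∀ᵐ x ∂μ, 0 ≤ x)
    {B : Set (EuclideanSpace ℝ (Fin d))} (hB : MeasurableSet B) (hB' : volume B ≠ ∞) {U : Type*}
    (r : ℕ) (H : SimpleGraph U) (h : U) :
    AEStronglyMeasurable (fun ω => ballInd r H h (G ω) 0 (nearSet (Y ω) 1 B 0)) P := by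
  refine aestronglyMeasurable_of_tendsto_ae atTop
    (fun M => (hG.measurable_countExpansion hB r H h M).aestronglyMeasurable) ?_
  filter_upwards [hG.ae_finite_nearSet hμ0 hB hB'] with ω hω
  rw [tendsto_iff_dist_tendsto_zero]
  refine squeeze_zero (fun _ => dist_nonneg) (fun M => ?_)
    (g := fun M : ℕ => (1 / 2 : ℝ) ^ M * 5 ^ (nearSet (Y ω) 1 B 0).ncard) ?_
  · rw [dist_comm, Real.dist_eq]
    exact abs_ballInd_sub_countExpansion_le r H h (G ω) 0 hω (self_notMem_nearSet _ _ _ _) M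
  · simpa using (tendsto_pow_atTop_nhds_zero_of_lt_one (by norm_num : (0 : ℝ) ≤ 1 / 2)
      (by norm_num)).mul_const ((5 : ℝ) ^ (nearSet (Y ω) 1 B 0).ncard)

lemma integrable_of_abs_le_one [IsProbabilityMeasure P] {f : Ω → ℝ}
    (hf : AEStronglyMeasurable f P) (h : ∀ ω, |f ω| ≤ 1) : Integrable f P :=
  (integrable_const (1 : ℝ)).mono' hf (ae_of_all _ h)

lemma IsInfiniteGIRG.abs_integral_ballInd_sub_le [IsProbabilityMeasure P] [IsProbabilityMeasure μ]
    (hG : IsInfiniteGIRG P α d μ Y W G) (hμ0 : ∀ᵐ x ∂μ, 0 ≤ x)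
    {B : Set (EuclideanSpace ℝ (Fin d))} (hB : MeasurableSet B) (hB' : volume B ≠ ∞) {U : Type*}
    (r : ℕ) (H : SimpleGraph U) (h : U) (M : ℕ) :
    |∫ ω, ballInd r H h (G ω) 0 (nearSet (Y ω) 1 B 0) ∂P -
      countExpansion r H h M fun _ S => clusterDensity α B S μ| ≤
      ((1 / 2) ^ M * expMoment B).toReal := by
  have hfin : ∀ m, ∀ S ∈ (potentialEdges m).powerset,
      ∫⁻ ω, homCount (G ω) 0 (nearSet (Y ω) 1 B 0) S ∂P ≠ ∞ := by
    intro m S hS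
    rw [hG.lintegral_homCount hμ0 hB (Finset.mem_powerset.1 hS)]
    exact ((clusterDensity_le α hB S μ).trans_lt (ENNReal.pow_lt_top hB'.lt_top)).ne
  have hint : ∀ m, ∀ S ∈ (potentialEdges m).powerset,
      Integrable (fun ω => ballCoeff r H h m S *
        (homCount (G ω) 0 (nearSet (Y ω) 1 B 0) S).toReal) P := fun m S hS =>
    (integrable_toReal_of_lintegral_ne_top (hG.measurable_homCount hB S).aemeasurable
      (hfin m S hS)).const_mul _
  have e1 : (countExpansion r H h M fun _ S => clusterDensity α B S μ) =
      ∫ ω, countExpansion r H h M fun _ S => homCount (G ω) 0 (nearSet (Y ω) 1 B 0) S ∂P := by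
    simp only [countExpansion]
    rw [integral_finsetSum _ fun m _ => integrable_finsetSum _ (hint m)]
    refine Finset.sum_congr rfl fun m _ => ?_
    rw [integral_finsetSum _ (hint m)]
    refine Finset.sum_congr rfl fun S hS => ?_
    rw [integral_const_mul, integral_toReal (hG.measurable_homCount hB S).aemeasurable
      (ae_lt_top (hG.measurable_homCount hB S) (hfin m S hS)),
      hG.lintegral_homCount hμ0 hB (Finset.mem_powerset.1 hS)]
  have hexp : Integrable (fun ω => countExpansion r H h M fun _ S =>
      homCount (G ω) 0 (nearSet (Y ω) 1 B 0) S) P :=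
    integrable_finsetSum _ fun m _ => integrable_finsetSum _ (hint m)
  have hball := integrable_of_abs_le_one (hG.aestronglyMeasurable_ballInd hμ0 hB hB' r H h)
    fun ω => abs_ballInd_le r H h (G ω) 0 _
  rw [e1, ← integral_sub hball hexp, ← Real.norm_eq_abs]
  refine (norm_integral_le_lintegral_norm _).trans (ENNReal.toReal_mono
    (ENNReal.mul_ne_top (ENNReal.pow_ne_top (ENNReal.div_ne_top ENNReal.one_ne_top two_ne_zero))
      (expMoment_ne_top hB')) ?_)
  calc _ ≤ ∫⁻ ω, (1 / 2) ^ M * 5 ^ (nearSet (Y ω) 1 B 0).ncard ∂P := by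
        refine lintegral_mono_ae ?_
        filter_upwards [hG.ae_finite_nearSet hμ0 hB hB'] with ω hω
        refine (ENNReal.ofReal_le_ofReal (abs_ballInd_sub_countExpansion_le r H h (G ω) 0 hω
          (self_notMem_nearSet _ _ _ _) M)).trans (le_of_eq ?_)
        rw [ENNReal.ofReal_mul (by positivity), ENNReal.ofReal_pow (by norm_num),
          ENNReal.ofReal_pow (by norm_num), ENNReal.ofReal_div_of_pos (by norm_num)]
        simp
    _ = (1 / 2) ^ M * ∫⁻ ω, 5 ^ (nearSet (Y ω) 1 B 0).ncard ∂P :=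
        lintegral_const_mul' _ _ (ENNReal.pow_ne_top (by simp))
    _ ≤ _ := by
        gcongr
        exact hG.lintegral_five_pow_le hμ0 hB hB'

/-- By local finiteness the r-ball of the root is finite, hence contained in a large enough ball of
space, and the indicators are eventually constant in K. -/
theorem IsInfiniteGIRG.tendsto_integral_ballInd [IsProbabilityMeasure P] [IsProbabilityMeasure μ]
    (hG : IsInfiniteGIRG P α d μ Y W G) (hμ0 : ∀ᵐ x ∂μ, 0 ≤ x)
    (hlf : ∀ᵐ ω ∂P, IsLocallyFinite (G ω)) {U : Type*} (r : ℕ) (H : SimpleGraph U) (h : U) :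
    Tendsto (fun K : ℕ => ∫ ω, ballInd r H h (G ω) 0
      (nearSet (Y ω) 1 (Metric.closedBall 0 (K : ℝ)) 0) ∂P) atTop
      (𝓝 (P.real {ω | BallIso (G ω) 0 r H h})) := by
  classical
  have hB' : ∀ K : ℝ, volume (Metric.closedBall (0 : EuclideanSpace ℝ (Fin d)) K) ≠ ∞ :=
    fun K => measure_closedBall_lt_top.ne
  have hm := fun K : ℕ => hG.aestronglyMeasurable_ballInd hμ0
    (B := Metric.closedBall 0 (K : ℝ)) measurableSet_closedBall (hB' K) r H h
  have hlim : ∀ᵐ ω ∂P, Tendsto (fun K : ℕ => ballInd r H h (G ω) 0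
      (nearSet (Y ω) 1 (Metric.closedBall 0 (K : ℝ)) 0)) atTop
      (𝓝 ({ω | BallIso (G ω) 0 r H h}.indicator 1 ω)) := by
    filter_upwards [hlf] with ω hω
    obtain ⟨K₀, hK₀⟩ := ((finite_ballSet hω r 0).image fun v => ‖Y ω v - Y ω 0‖).bddAbove
    refine tendsto_const_nhds.congr' ?_
    filter_upwards [eventually_ge_atTop ⌈K₀⌉₊] with K hK
    rw [ballInd_eq_of_ballSet_subset]
    · simp [Set.indicator_apply]
    · intro v hv
      by_cases hv0 : v = 0
      · exact Or.inl hv0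
      · refine Or.inr ⟨hv0, ?_⟩
        rw [mem_closedBall_zero_iff, one_smul]
        exact (hK₀ ⟨v, hv, rfl⟩).trans (Nat.ceil_le.1 hK)
  -- The event is null measurable as a level set of an almost everywhere limit, so its probability
  -- is the integral of its indicator.
  have hmE : NullMeasurableSet {ω | BallIso (G ω) 0 r H h} P := by
    have h1 := (aestronglyMeasurable_of_tendsto_ae atTop hm hlim).aemeasurable
    have h2 := h1.nullMeasurableSet_preimage (measurableSet_singleton (1 : ℝ))
    convert h2 using 1
    ext ω
    simp [Set.indicator_apply]
  have e : P.real {ω | BallIso (G ω) 0 r H h} =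
      ∫ ω, {ω | BallIso (G ω) 0 r H h}.indicator (1 : Ω → ℝ) ω ∂P := by
    rw [integral_indicator₀ hmE]
    simp
  rw [e]
  exact tendsto_integral_of_dominated_convergence (fun _ => 1) hm (integrable_const 1)
    (fun K => ae_of_all _ fun ω => abs_ballInd_le r H h (G ω) 0 _) hlim

end Infinite

/-! ### Assembly of the approximations -/

section Convergence

variable {Ω : ℕ → Type*} [∀ n, MeasurableSpace (Ω n)] {P : ∀ n, Measure (Ω n)}
  [∀ n, IsProbabilityMeasure (P n)] {α : ℝ≥0∞} {d : ℕ} {μ : ProbabilityMeasure ℝ}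
  {X : ∀ n, Ω n → Fin n → EuclideanSpace ℝ (Fin d)} {W : ∀ n, Ω n → Fin n → ℝ}
  {G : ∀ n, Ω n → SimpleGraph (Fin n)}
  {Ω' : Type*} [MeasurableSpace Ω'] {Q : Measure Ω'} [IsProbabilityMeasure Q]
  {Y : Ω' → ℕ → EuclideanSpace ℝ (Fin d)} {W' : Ω' → ℕ → ℝ} {G' : Ω' → SimpleGraph ℕ}

theorem tendstoInProb_countExpansion (hG : ∀ n, IsGIRG (P n) α d n (X n) (W n) (G n))
    (hd : 1 ≤ d) (hW : Tendsto (empiricalProba W) (probFilter P) (𝓝 μ))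
    (hmean : TendstoInProb P (fun n ω => (∑ i, W n ω i) / n) (∫ x, x ∂(μ : Measure ℝ)))
    (hpos : 0 < ∫ x, x ∂(μ : Measure ℝ)) {K : ℝ} (hK : 0 ≤ K) {U : Type*} (r : ℕ)
    (H : SimpleGraph U) (h : U) (M : ℕ) :
    TendstoInProb P (fun n ω => countExpansion r H h M fun _ S =>
      clusterCount (G n ω) (X n ω) (girgScale d n) (Metric.closedBall 0 K) S)
      (countExpansion r H h M fun _ S =>
        clusterDensity α (Metric.closedBall (0 : EuclideanSpace ℝ (Fin d)) K) S μ) := by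
  rw [tendstoInProb_iff]
  exact tendsto_finsetSum _ fun m _ => tendsto_finsetSum _ fun S hS =>
    (tendstoInProb_iff.1 (tendstoInProb_clusterCount hG hd hW hmean hpos hK
      (Finset.mem_powerset.1 hS))).const_mul _

lemma tendsto_half_pow_mul {a : ℝ≥0∞} (ha : a ≠ ∞) :
    Tendsto (fun M : ℕ => (1 / 2 : ℝ≥0∞) ^ M * a) atTop (𝓝 0) := by
  have h1 : Tendsto (fun M : ℕ => (1 / 2 : ℝ≥0∞) ^ M) atTop (𝓝 0) :=
    ENNReal.tendsto_pow_atTop_nhds_zero_of_lt_one (by simp)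
  simpa using ENNReal.Tendsto.mul_const h1 (Or.inr ha)

/-- The parameters are chosen in the order R, K, M: R makes far vertices rare, K ≥ r R also makes
the spatial truncation small in the limit model, and M makes the expansion error small for this K.
Then n → ∞ with all three fixed. -/
theorem tendstoInProb_ballIso (hα : 1 < α)
    (hG : ∀ n, IsGIRG (P n) α d n (X n) (W n) (G n))
    (hd : 1 ≤ d) (hW : Tendsto (empiricalProba W) (probFilter P) (𝓝 μ))
    (hmean : TendstoInProb P (fun n ω => (∑ i, W n ω i) / n) (∫ x, x ∂(μ : Measure ℝ)))
    (hpos : 0 < ∫ x, x ∂(μ : Measure ℝ)) (hμ0 : ∀ᵐ x ∂(μ : Measure ℝ), 0 ≤ x)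
    (hμ : Integrable (fun x : ℝ => x) (μ : Measure ℝ))
    (hG' : IsInfiniteGIRG Q α d μ Y W' G') {U : Type*} (r : ℕ) (H : SimpleGraph U) (h : U) :
    TendstoInProb P
      (fun n ω => ({i : Fin n | BallIso (G n ω) i r H h}.ncard : ℝ) / n)
      (Q.real {ω | BallIso (G' ω) 0 r H h}) := by
  refine tendstoInProb_of_approx fun δ hδ => ?_
  have hδ2 : 0 < δ / 2 := half_pos hδ
  obtain ⟨R, hR⟩ := exists_measure_farAverage_le hG hα hd hW hmean hpos hμ0 hμ r hδ2
  have hlim := hG'.tendsto_integral_ballInd hμ0 (hG'.ae_isLocallyFinite hα hd hμ0 hμ) r H h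
  obtain ⟨K, hK1, hK2⟩ := ((hlim.eventually (Metric.closedBall_mem_nhds _ hδ2)).and
    (eventually_ge_atTop (r * R))).exists
  set B := Metric.closedBall (0 : EuclideanSpace ℝ (Fin d)) (K : ℝ) with hBdef
  have hB : MeasurableSet B := measurableSet_closedBall
  have hB' : volume B ≠ ∞ := measure_closedBall_lt_top.ne
  have hδ3 : 0 < ENNReal.ofReal (δ / 2) := ENNReal.ofReal_pos.2 hδ2
  -- The square of δ / 2 leaves δ / 2 after division by δ / 2 in Markov's inequality.
  have hδ4 : 0 < ENNReal.ofReal (δ / 2) * ENNReal.ofReal (δ / 2) := ENNReal.mul_pos hδ3.ne' hδ3.ne'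
  obtain ⟨M, hM1, hM2⟩ := (((tendsto_half_pow_mul (expMoment_ne_top hB')).eventually
    (gt_mem_nhds hδ3)).and ((tendsto_half_pow_mul (expMoment_ne_top hB')).eventually
    (gt_mem_nhds hδ4))).exists
  refine ⟨_, _, ?_, tendstoInProb_countExpansion hG hd hW hmean hpos K.cast_nonneg r H h M, ?_⟩
  · have h1 := (hG'.abs_integral_ballInd_sub_le hμ0 hB hB' r H h M).trans
      (ENNReal.toReal_le_of_le_ofReal hδ2.le hM1.le)
    rw [Real.dist_eq] at hK1
    rw [abs_sub_comm] at h1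
    calc _ ≤ _ := abs_sub_le _ _ _
      _ ≤ δ / 2 + δ / 2 := add_le_add h1 hK1
      _ = δ := add_halves δ
  · filter_upwards [hR, eventually_ne_atTop 0] with n h1 hn
    set F : Ω n → ℝ≥0∞ := fun ω => fivePowAverage (X n ω) (girgScale d n) B with hF
    have hFm : Measurable F := (hG n).measurable_fivePowAverage hB _
    calc _ ≤ P n ({ω | ENNReal.ofReal (δ / 2) ≤
          farAverage (G n ω) (X n ω) (girgScale d n) R r} ∪
          {ω | ENNReal.ofReal (δ / 2) ≤ (1 / 2) ^ M * F ω}) := by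
          refine measure_mono fun ω hω => ?_
          rw [Set.mem_ofPred_eq] at hω
          by_contra hc
          rw [Set.mem_union, not_or, Set.mem_ofPred_eq, Set.mem_ofPred_eq, not_le, not_le] at hc
          have h2 := abs_ballIso_proportion_sub_le r H h (G n ω) (X n ω) (girgScale d n) hn
            (R := R) (K := K) R.cast_nonneg (by exact_mod_cast hK2)
          have h3 := abs_sum_ballInd_sub_countExpansion_le r H h (G n ω) (X n ω) (girgScale d n)
            hn B M
          have h4 := (ENNReal.lt_ofReal_iff_toReal_lt hc.1.ne_top).1 hc.1
          have h5 := (ENNReal.lt_ofReal_iff_toReal_lt hc.2.ne_top).1 hc.2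
          have h6 := abs_sub_le (({i : Fin n | BallIso (G n ω) i r H h}.ncard : ℝ) / n)
            ((n : ℝ)⁻¹ * ∑ i, ballInd r H h (G n ω) i (nearSet (X n ω) (girgScale d n) B i))
            (countExpansion r H h M fun _ S =>
              clusterCount (G n ω) (X n ω) (girgScale d n) B S)
          linarith
      _ ≤ ENNReal.ofReal (δ / 2) + ENNReal.ofReal (δ / 2) := by
          refine (measure_union_le _ _).trans (add_le_add h1 ?_)
          refine (meas_ge_le_lintegral_div (hFm.const_mul _).aemeasurable hδ3.ne'
            ENNReal.ofReal_ne_top).trans (ENNReal.div_le_of_le_mul ?_)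
          rw [lintegral_const_mul _ hFm]
          refine le_trans ?_ hM2.le
          gcongr
          exact (hG n).lintegral_fivePowAverage_le hd hn hB (girgScale_pos hn) (girgScale_pow hd)
      _ = _ := by
          rw [← ENNReal.ofReal_add (by positivity) (by positivity), add_halves]

end Convergence

end

end SpatialGraph

theorem mainTheorem8 (α : ℝ≥0∞) (hα : 1 < α) (β : ℝ) (hβ : 2 < β) (d : ℕ) (hd : 1 ≤ d)
    -- the law of the limiting weight
    (μ : Measure ℝ) [IsProbabilityMeasure μ] (hμ : SpatialGraph.HasPowerLawTail μ β)
    -- the finite GIRGs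
    {Ω : ℕ → Type*} [∀ n, MeasurableSpace (Ω n)] (P : ∀ n, Measure (Ω n))
    [∀ n, IsProbabilityMeasure (P n)]
    (X : ∀ n, Ω n → Fin n → EuclideanSpace ℝ (Fin d)) (W : ∀ n, Ω n → Fin n → ℝ)
    (G : ∀ n, Ω n → SimpleGraph (Fin n))
    (hG : ∀ n, SpatialGraph.IsGIRG (P n) α d n (X n) (W n) (G n))
    -- the empirical weight distribution converges to `μ`, and the empirical mean to its mean
    (hW : ∀ x : ℝ, ContinuousAt (cdf μ) x →
      SpatialGraph.TendstoInProb P (fun n ω => ({i : Fin n | W n ω i ≤ x}.ncard : ℝ) / n) (cdf μ x))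
    (hmean : SpatialGraph.TendstoInProb P (fun n ω => (∑ i, W n ω i) / n) (∫ x, x ∂μ))
    -- the infinite GIRG
    {Ω' : Type*} [MeasurableSpace Ω'] (Q : Measure Ω') [IsProbabilityMeasure Q]
    (Y : Ω' → ℕ → EuclideanSpace ℝ (Fin d)) (W' : Ω' → ℕ → ℝ) (G' : Ω' → SimpleGraph ℕ)
    (hG' : SpatialGraph.IsInfiniteGIRG Q α d μ Y W' G') :
    SpatialGraph.ConvergesLocallyInProb P G Q G' 0 := by
  obtain ⟨μ, rfl⟩ : ∃ ν : ProbabilityMeasure ℝ, (ν : Measure ℝ) = μ := ⟨⟨μ, inferInstance⟩, rfl⟩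
  have hW' := SpatialGraph.tendsto_empiricalProba hW
  have hμ0 : ∀ᵐ x ∂(μ : Measure ℝ), 0 ≤ x :=
    SpatialGraph.ae_nonneg_of_tendsto_empiricalProba (fun n => (hG n).weight_nonneg) hW'
  have hint := hμ.integrable hβ hμ0
  refine ⟨hG'.ae_isLocallyFinite hα hd hμ0 hint, fun r U H h _ => ?_⟩
  simp only [Fintype.card_fin]
  exact SpatialGraph.tendstoInProb_ballIso hα hG hd hW' hmean (hμ.integral_pos hβ hμ0) hμ0 hint
    hG' r H h
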